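/- Theorem. Let $n\ge 3$ and $\delta>0$. There is a constant $C_\delta$, depending only on $n$ and $\delta$, such that the following holds. Let $w$ (real- or complex-valued) solve $$(\partial_t^2-\Delta)w=F \ \text{ in } \mathbb R_+\times\mathbb R^n,\qquad w(0,\cdot)=\partial_t w(0,\cdot)=0 .$$ Then for every $T>0$, with $S_T=[0,T]\times\mathbb R^n$ and $\langle x\rangle=(1+|x|^2)^{1/2}$, $$\bigl(\log(2+T)\bigr)^{-1/2}\|\langle x\rangle^{-1/2}w\|_{L^2(S_T)}+\|\langle x\rangle^{-1/2-\delta}w\|_{L^2(S_T)}+\|w(T,\cdot)\|_{L^2(\mathbb R^n)}$$ $$\le C_\delta\int_0^T\bigl\|\,|x|^{-(n-2)/2}F(t,\cdot)\bigr\|_{L^1_rL^2_\omega(|x|>1)}\,dt+C_\delta\int_0^T\|F(t,\cdot)\|_{L^{2n/(n+2)}(|x|<1)}\,dt ,$$ where both sides are allowed to be $+\infty$. Here $$\|h\|_{L^p_rL^q_\omega}=\Bigl\|\,\|h(r\,\cdot)\|_{L^q(S^{n-1},d\omega)}\Bigr\|_{L^p([0,\infty),\,r^{n-1}dr)},$$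 where $d\omega$ is the surface measure on $S^{n-1}$, and the norm over $|x|>1$ is the norm of the function set to zero for $|x|\le 1$. Solutions are taken in the sense of distributions: $w$ and $F$ are locally integrable on $[0,\infty)\times\mathbb R^n$; $w(t,\cdot)$ is locally integrable for every $t\ge0$; $t\mapsto\int w(t,x)\psi(x)\,dx$ is continuous on $[0,\infty)$ for every $\psi\in C_0^\infty(\mathbb R^n)$; and $$\int_0^\infty\!\!\int_{\mathbb R^n} w\,(\partial_t^2-\Delta)\varphi\,dx\,dt=\int_0^\infty\!\!\int_{\mathbb R^n}F\varphi\,dx\,dt\qquad\text{for all }\varphi\in C_0^\infty(\mathbb R\times\mathbb R^n),$$ which, as $\varphi$ need not vanish near $t=0$, includes the zero initial conditions. In particular classical $C^2$ solutions are covered. -/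

import Mathlib

open Set MeasureTheory
open scoped ENNReal NNReal ContDiff

noncomputable section

namespace WaveKSS

/-- Euclidean space `ℝⁿ`. -/
abbrev E (n : ℕ) : Type := EuclideanSpace ℝ (Fin n)

/-- The bracket `⟨x⟩ = (1 + |x|²)^{1/2}`. -/
def bracket {n : ℕ} (x : E n) : ℝ := Real.sqrt (1 + ‖x‖ ^ 2)

/-- The d'Alembertian `(∂ₜ² - Δ) φ` of a function of `(t, x) ∈ ℝ × ℝⁿ`. -/
def box {n : ℕ} (φ : ℝ × E n → ℝ) (p : ℝ × E n) : ℝ :=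
  iteratedDeriv 2 (fun s : ℝ => φ (s, p.2)) p.1
    - Laplacian.laplacian (fun y : E n => φ (p.1, y)) p.2

/-- The closed half space-time `[0, ∞) × ℝⁿ`. -/
def halfSpace (n : ℕ) : Set (ℝ × E n) := Ici (0 : ℝ) ×ˢ univ

/-- `w` solves `(∂ₜ² - Δ) w = F` in `ℝ₊ × ℝⁿ` with `w(0, ·) = ∂ₜ w(0, ·) = 0`, in the sense of
distributions. The test functions in `weak_eq` need not vanish near `t = 0`, so that this identity
contains both the equation and the two vanishing initial conditions (for a `C²` function `w` it is
equivalent to them, by integration by parts). The time slices `w(t, ·)` are meaningful for every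
`t ≥ 0` since `t ↦ w(t, ·)` is continuous with values in the distributions on `ℝⁿ`. -/
structure IsSolution {𝕜 : Type*} [RCLike 𝕜] {n : ℕ} (w F : ℝ → E n → 𝕜) : Prop where
  locInt_w : LocallyIntegrableOn (fun p : ℝ × E n => w p.1 p.2) (halfSpace n)
  locInt_F : LocallyIntegrableOn (fun p : ℝ × E n => F p.1 p.2) (halfSpace n)
  locInt_slice : ∀ t : ℝ, 0 ≤ t → LocallyIntegrable (w t)
  weak_cont : ∀ ψ : E n → ℝ, ContDiff ℝ ∞ ψ → HasCompactSupport ψ →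
    ContinuousOn (fun t : ℝ => ∫ x, ψ x • w t x) (Ici 0)
  weak_eq : ∀ φ : ℝ × E n → ℝ, ContDiff ℝ ∞ φ → HasCompactSupport φ →
    ∫ p in halfSpace n, box φ p • w p.1 p.2 = ∫ p in halfSpace n, φ p • F p.1 p.2

/-- The measure `r^{n-1} dr` on `(0, ∞)`. -/
def radialMeasure (n : ℕ) : Measure ℝ :=
  (volume.restrict (Ioi (0 : ℝ))).withDensity (fun r => ENNReal.ofReal (r ^ (n - 1)))

/-- The mixed norm `‖h‖_{L^p_r L^q_ω}`: the `L^p([0, ∞), r^{n-1} dr)` norm of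
`r ↦ ‖h(r ·)‖_{L^q(S^{n-1}, dω)}`, with `dω` the surface measure of the unit sphere. -/
def mixedNorm {𝕜 : Type*} [RCLike 𝕜] {n : ℕ} (p q : ℝ≥0∞) (h : E n → 𝕜) : ℝ≥0∞ :=
  eLpNorm
    (fun r : ℝ => eLpNorm (fun θ : Metric.sphere (0 : E n) 1 => h (r • (θ : E n))) q
      (volume : Measure (E n)).toSphere)
    p (radialMeasure n)

/-- The norm `‖h‖_{L^p_r L^q_ω(A)}` over a region `A ⊆ ℝⁿ`. -/
def mixedNormOn {𝕜 : Type*} [RCLike 𝕜] {n : ℕ} (p q : ℝ≥0∞) (A : Set (E n)) (h : E n → 𝕜) :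
    ℝ≥0∞ :=
  mixedNorm p q (A.indicator h)

/-- Lebesgue measure on the strip `S_T = [0, T] × ℝⁿ`. -/
def stripMeasure (n : ℕ) (T : ℝ) : Measure (ℝ × E n) :=
  volume.restrict (Icc 0 T ×ˢ univ)

/-- The weighted space-time norm `‖⟨x⟩^a w‖_{L²(S_T)}`. -/
def weightedStripNorm {𝕜 : Type*} [RCLike 𝕜] {n : ℕ} (a T : ℝ) (w : ℝ → E n → 𝕜) : ℝ≥0∞ :=
  eLpNorm (fun p : ℝ × E n => (bracket p.2 ^ a) • w p.1 p.2) 2 (stripMeasure n T)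

end WaveKSS

end

/-! The estimate is proved by duality, from weighted estimates for test functions `φ` that vanish
near and after time `T`. Put `G = box φ`. Energy conservation run backwards from `T` bounds the
energy at each time by `∫ |G| |∂ₜφ|`. The Morawetz multiplier `(R² + |x|²)^{-1/2} (x·∇φ + (n-1)/2
φ)`, whose bulk term is positive for `n ≥ 3`, bounds the local energy at the scale `⟨x⟩ ~ R`
uniformly in `R ≥ 1`. Both bounds are controlled by the same quantity `X = ∫ |G| (|∂φ|² +
φ²/⟨x⟩²)^{1/2}` (`sourcePairing`).

Summing over dyadic `R` gives `∫ a (|∂φ|² + φ²/⟨x⟩²) ≤ Λ X`. For `a = ⟨x⟩^{-1-2δ}` the sum is a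
geometric series and `Λ` depends on `n` and `δ` only. For `a = ⟨x⟩^{-1}` about `log(2+T)` shells
count equally, and beyond `⟨x⟩ ~ T` the energy bound integrated over `[0, T]` is enough, so `Λ ~
log(2+T)`. A weighted Cauchy–Schwarz inequality absorbs `X` and leaves `sup ‖∇φ(t)‖² ≤ 2Λ ∫ a⁻¹ G²`
(`DualEstimate`).

On the other side, `|∫ F φ|` is at most a constant times the source norm times `sup ‖∇φ(t)‖`: inside
the unit ball by Sobolev's inequality (`lintegral_ball_le`), outside by the trace inequality
`r^{(n-2)/2} ‖g(r·)‖_{L²(S^{n-1})} ≤ ‖∇g‖` (`lintegral_exterior_le`). Hence `φ ↦ ∫ F φ` is bounded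
with respect to `‖a^{-1/2} G‖`, and Riesz representation gives `y` in `L²` such that `a^{-1/2} y`
satisfies the weak equation of `w` on the strip. By uniqueness `a^{1/2} w = y`, which is the
weighted bound with constant of size `Λ^{1/2}` (`eLpNorm_sqrt_weight_mul_le`). No existence theorem
and no regularity of `w` is needed.

The bound at time `T` comes from the same scheme with `a = exp((t-T)/ε)`, for which the energy
inequality alone gives a dual constant `4ε`. This controls averages of `w` over `[T-ε, T]`, and weak
continuity lets `ε` tend to zero. Uniqueness is proved by mollification and an energy argument on
regions bounded by spacelike hyperboloids. -/

noncomputable section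

namespace WaveKSS

/-! ### Directional derivatives on space-time. -/

/-- The space-time `ℝ × ℝⁿ`. -/
abbrev ST (n : ℕ) : Type := ℝ × E n

/-- The derivative of a function on space-time in the direction `v`. -/
def pd {n : ℕ} (v : ST n) (ψ : ST n → ℝ) : ST n → ℝ := fun p => fderiv ℝ ψ p v

/-- The unit vector in the time direction. -/
def eT (n : ℕ) : ST n := (1, 0)

/-- The unit vectors in the space directions. -/
def eX {n : ℕ} (j : Fin n) : ST n := (0, EuclideanSpace.single j 1)

/-- The time derivative. -/
def dT {n : ℕ} (ψ : ST n → ℝ) : ST n → ℝ := pd (eT n) ψ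

/-- The space derivatives. -/
def dX {n : ℕ} (j : Fin n) (ψ : ST n → ℝ) : ST n → ℝ := pd (eX j) ψ

/-- The squared length of the space gradient. -/
def gradSq {n : ℕ} (ψ : ST n → ℝ) (p : ST n) : ℝ := ∑ j, dX j ψ p ^ 2

/-- The time slab `[a, b] × ℝⁿ`. -/
def slab (n : ℕ) (a b : ℝ) : Set (ST n) := Icc a b ×ˢ univ

section Derivatives

variable {n : ℕ} {v w : ST n} {f g : ST n → ℝ} {p : ST n}

lemma pd_add (hf : DifferentiableAt ℝ f p) (hg : DifferentiableAt ℝ g p) :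
    pd v (fun q => f q + g q) p = pd v f p + pd v g p := by
  simp [pd, fderiv_fun_add hf hg]

lemma pd_mul (hf : DifferentiableAt ℝ f p) (hg : DifferentiableAt ℝ g p) :
    pd v (fun q => f q * g q) p = pd v f p * g p + f p * pd v g p := by
  simp [pd, fderiv_fun_mul hf hg]; ring

lemma pd_const_mul (c : ℝ) (hf : DifferentiableAt ℝ f p) :
    pd v (fun q => c * f q) p = c * pd v f p := by
  simp [pd, fderiv_const_mul hf]

lemma pd_sum {ι : Type*} {s : Finset ι} {F : ι → ST n → ℝ}
    (hF : ∀ i ∈ s, DifferentiableAt ℝ (F i) p) :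
    pd v (fun q => ∑ i ∈ s, F i q) p = ∑ i ∈ s, pd v (F i) p := by
  simp [pd, fderiv_fun_sum hF]

lemma pd_sq (hf : DifferentiableAt ℝ f p) :
    pd v (fun q => f q ^ 2) p = 2 * f p * pd v f p := by
  simp only [pow_two]; rw [pd_mul hf hf]; ring

lemma contDiff_pd {k m : WithTop ℕ∞} (hf : ContDiff ℝ m f) (hkm : k + 1 ≤ m) :
    ContDiff ℝ k (pd v f) :=
  (hf.fderiv_right hkm).clm_apply contDiff_const

lemma contDiff_infty_pd (hf : ContDiff ℝ ∞ f) : ContDiff ℝ ∞ (pd v f) :=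
  contDiff_pd hf (by simp)

lemma hasCompactSupport_pd (hf : HasCompactSupport f) : HasCompactSupport (pd v f) :=
  hf.fderiv_apply (𝕜 := ℝ) v

lemma support_pd_subset : Function.support (pd v f) ⊆ tsupport f := by
  intro p hp
  by_contra h
  apply hp
  simp [pd, fderiv_of_notMem_tsupport ℝ h]

lemma tsupport_pd_subset : tsupport (pd v f) ⊆ tsupport f :=
  closure_minimal support_pd_subset (isClosed_tsupport f)

lemma pd_comm (hf : ContDiff ℝ 2 f) : pd v (pd w f) p = pd w (pd v f) p := by
  have h1 : DifferentiableAt ℝ (fderiv ℝ f) p :=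
    (hf.fderiv_right (m := 1) (by norm_num)).differentiable (by norm_num) p
  have h2 : IsSymmSndFDerivAt ℝ f p := hf.contDiffAt.isSymmSndFDerivAt (by simp)
  have key : ∀ a b : ST n, pd a (pd b f) p = fderiv ℝ (fderiv ℝ f) p a b := by
    intro a b
    unfold pd
    rw [fderiv_clm_apply h1 (differentiableAt_const b)]
    simp
  rw [key, key, h2.eq]

end Derivatives

/-! ### Integration over time slabs and the divergence theorem. -/

section Slab

variable {n : ℕ} {f : ST n → ℝ} {a b t : ℝ}

lemma hasFDerivAt_slice (t : ℝ) (x : E n) :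
    HasFDerivAt (fun y : E n => ((t, y) : ST n)) (ContinuousLinearMap.inr ℝ ℝ (E n)) x := by
  exact hasFDerivAt_prodMk_right t x

lemma fderiv_slice {p : ST n} (hf : DifferentiableAt ℝ f p) (v : E n) :
    fderiv ℝ (fun y => f (p.1, y)) p.2 v = pd (0, v) f p := by
  have h : HasFDerivAt (fun y => f (p.1, y))
      ((fderiv ℝ f p).comp (ContinuousLinearMap.inr ℝ ℝ (E n))) p.2 :=
    HasFDerivAt.comp (g := f) p.2 hf.hasFDerivAt (hasFDerivAt_slice p.1 p.2)
  rw [h.fderiv]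
  simp [pd]

lemma hasDerivAt_time {p : ST n} (hf : DifferentiableAt ℝ f p) :
    HasDerivAt (fun s => f (s, p.2)) (dT f p) p.1 := by
  have h : HasFDerivAt (fun s => f (s, p.2))
      ((fderiv ℝ f p).comp (ContinuousLinearMap.inl ℝ ℝ (E n))) p.1 :=
    HasFDerivAt.comp (g := f) p.1 hf.hasFDerivAt (hasFDerivAt_prodMk_left p.1 p.2)
  have := h.hasDerivAt
  simpa [dT, pd, eT] using this

lemma hasCompactSupport_slice (hf : HasCompactSupport f) (t : ℝ) :
    HasCompactSupport (fun x => f (t, x)) :=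
  HasCompactSupport.intro (hf.isCompact.image continuous_snd) fun _ hx => by
    by_contra h
    exact hx ⟨_, subset_tsupport f h, rfl⟩

lemma continuous_slice (hf : Continuous f) (t : ℝ) : Continuous (fun x => f (t, x)) :=
  hf.comp (by fun_prop)

lemma integrable_slice (hf : Continuous f) (hc : HasCompactSupport f) (t : ℝ) :
    Integrable (fun x => f (t, x)) :=
  (continuous_slice hf t).integrable_of_hasCompactSupport (hasCompactSupport_slice hc t)

lemma integrableOn_slab (hf : Continuous f) (hc : HasCompactSupport f) {s : Set (ST n)} :
    IntegrableOn f s :=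
  (hf.integrable_of_hasCompactSupport hc).integrableOn

lemma restrict_slab : (volume.restrict (slab n a b) : Measure (ST n)) =
    (volume.restrict (Icc a b)).prod volume := by
  rw [slab, Measure.volume_eq_prod, ← Measure.prod_restrict, Measure.restrict_univ]

lemma measurableSet_slab : MeasurableSet (slab n a b) :=
  measurableSet_Icc.prod MeasurableSet.univ

lemma setIntegral_slab {f : ST n → ℝ} (hf : IntegrableOn f (slab n a b)) :
    ∫ p in slab n a b, f p = ∫ t in Icc a b, ∫ x, f (t, x) := by
  unfold IntegrableOn at hf
  rw [restrict_slab] at hf ⊢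
  exact integral_prod _ hf

lemma integral_slice_pd_eq_zero (hf : ContDiff ℝ 1 f) (hc : HasCompactSupport f) (t : ℝ)
    (v : E n) : ∫ x, pd (0, v) f (t, x) = 0 := by
  have hg : ContDiff ℝ 1 (fun y => f (t, y)) := hf.comp (by fun_prop)
  have hgc := hasCompactSupport_slice hc t
  have hd := hg.differentiable (by norm_num)
  have h1 : ∀ x, pd (0, v) f (t, x) = fderiv ℝ (fun y => f (t, y)) x v := fun x =>
    (fderiv_slice (p := (t, x)) (hf.differentiable (by norm_num) _) v).symm
  have := integral_mul_fderiv_eq_neg_fderiv_mul_of_integrable (μ := (volume : Measure (E n)))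
    (f := fun _ => (1 : ℝ)) (g := fun y => f (t, y)) (v := v) (by simp) ?_ ?_
    (by simp) (fun x _ => hd x)
  · simp only [h1]
    simpa using this
  · simp only [one_mul]
    exact ((hg.continuous_fderiv (by norm_num)).clm_apply
      continuous_const).integrable_of_hasCompactSupport (hgc.fderiv_apply (𝕜 := ℝ) v)
  · simp only [one_mul]
    exact hg.continuous.integrable_of_hasCompactSupport hgc

/-- The divergence theorem on a slab, space components. -/
lemma setIntegral_slab_dX (hf : ContDiff ℝ 1 f) (hc : HasCompactSupport f) (j : Fin n) :
    ∫ p in slab n a b, dX j f p = 0 := by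
  have hcont : Continuous (dX j f) := (contDiff_pd (k := 0) hf (by norm_num)).continuous
  rw [setIntegral_slab (integrableOn_slab hcont (hasCompactSupport_pd hc))]
  have : ∀ t, ∫ x, dX j f (t, x) = 0 := fun t => integral_slice_pd_eq_zero hf hc t _
  simp [this]

/-- The divergence theorem on a slab, time component. -/
lemma setIntegral_slab_dT (hf : ContDiff ℝ 1 f) (hc : HasCompactSupport f) (hab : a ≤ b) :
    ∫ p in slab n a b, dT f p = (∫ x, f (b, x)) - ∫ x, f (a, x) := by
  have hcont : Continuous (dT f) := (contDiff_pd (k := 0) hf (by norm_num)).continuous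
  have hint : Integrable (dT f) ((volume.restrict (Icc a b)).prod volume) := by
    rw [← restrict_slab]
    exact integrableOn_slab hcont (hasCompactSupport_pd hc)
  rw [restrict_slab, integral_prod_symm _ hint,
    ← integral_sub (integrable_slice hf.continuous hc b) (integrable_slice hf.continuous hc a)]
  congr 1 with x
  rw [integral_Icc_eq_integral_Ioc, ← intervalIntegral.integral_of_le hab]
  refine intervalIntegral.integral_eq_sub_of_hasDerivAt (f := fun s => f (s, x)) (fun t _ => ?_) ?_
  · exact hasDerivAt_time (p := (t, x)) (hf.differentiable (by norm_num) _)
  · exact (hcont.comp (by fun_prop : Continuous fun t : ℝ => ((t, x) : ST n))).intervalIntegrable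
      _ _

/-- The divergence theorem on a slab. -/
lemma setIntegral_slab_divergence {A : ST n → ℝ} {B : Fin n → ST n → ℝ}
    (hA : ContDiff ℝ 1 A) (hAc : HasCompactSupport A) (hB : ∀ j, ContDiff ℝ 1 (B j))
    (hBc : ∀ j, HasCompactSupport (B j)) (hab : a ≤ b) :
    ∫ p in slab n a b, (dT A p - ∑ j, dX j (B j) p) = (∫ x, A (b, x)) - ∫ x, A (a, x) := by
  have hcont : ∀ {f : ST n → ℝ} (_ : ContDiff ℝ 1 f) v, Continuous (pd v f) := fun hf v =>
    (contDiff_pd (k := 0) hf (by norm_num)).continuous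
  have hint : ∀ j, IntegrableOn (dX j (B j)) (slab n a b) := fun j =>
    integrableOn_slab (hcont (hB j) _) (hasCompactSupport_pd (hBc j))
  have hAi : IntegrableOn (dT A) (slab n a b) :=
    integrableOn_slab (hcont hA _) (hasCompactSupport_pd hAc)
  rw [integral_sub hAi
    (integrable_finsetSum _ fun j _ => hint j), integral_finsetSum _ fun j _ => hint j,
    setIntegral_slab_dT hA hAc hab, Finset.sum_eq_zero fun j _ =>
      setIntegral_slab_dX (hB j) (hBc j) j, sub_zero]

end Slab

/-- Bridge from the iterated derivative and the Laplacian of slices, as used in the statement, to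
the directional derivatives in which all identities below are computed. -/
lemma box_eq {n : ℕ} {φ : ST n → ℝ} (hφ : ContDiff ℝ 2 φ) (p : ST n) :
    box φ p = dT (dT φ) p - ∑ j, dX j (dX j φ) p := by
  have hd : Differentiable ℝ φ := hφ.differentiable (by norm_num)
  have hpd : ∀ v, Differentiable ℝ (pd v φ) := fun v =>
    (contDiff_pd (k := 1) hφ (by norm_num)).differentiable (by norm_num)
  unfold box
  congr 1
  · rw [iteratedDeriv_succ, iteratedDeriv_one]
    have h1 : deriv (fun s => φ (s, p.2)) = fun s => dT φ (s, p.2) := by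
      ext s
      exact (hasDerivAt_time (p := (s, p.2)) (hd _)).deriv
    rw [h1]
    exact (hasDerivAt_time (f := dT φ) (p := p) (hpd _ _)).deriv
  · rw [InnerProductSpace.laplacian_eq_iteratedFDeriv_orthonormalBasis _
      (EuclideanSpace.basisFun (Fin n) ℝ)]
    refine Finset.sum_congr rfl fun j _ => ?_
    have hg : ContDiff ℝ 2 (fun y => φ (p.1, y)) := hφ.comp (by fun_prop)
    rw [iteratedFDeriv_two_apply]
    simp only [EuclideanSpace.basisFun_apply, Matrix.cons_val_zero, Matrix.cons_val_one]
    have h2 : DifferentiableAt ℝ (fderiv ℝ (fun y => φ (p.1, y))) p.2 :=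
      (hg.fderiv_right (m := 1) (by norm_num)).differentiable (by norm_num) _
    have h3 : fderiv ℝ (fun y => fderiv ℝ (fun y => φ (p.1, y)) y (EuclideanSpace.single j 1)) p.2
        (EuclideanSpace.single j 1) = fderiv ℝ (fderiv ℝ (fun y => φ (p.1, y))) p.2
        (EuclideanSpace.single j 1) (EuclideanSpace.single j 1) := by
      rw [fderiv_clm_apply h2 (differentiableAt_const _)]
      simp
    rw [← h3]
    have h4 : (fun y => fderiv ℝ (fun y => φ (p.1, y)) y (EuclideanSpace.single j 1))
        = fun y => dX j φ (p.1, y) := by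
      ext y
      exact fderiv_slice (p := (p.1, y)) (hd _) _
    rw [h4]
    exact fderiv_slice (p := p) (hpd _ _) _

/-! ### Energy identities. -/

/-- The energy density. -/
def energyDensity {n : ℕ} (u : ST n → ℝ) (p : ST n) : ℝ := (dT u p ^ 2 + gradSq u p) / 2

section Energy

variable {n : ℕ} {u w : ST n → ℝ}

lemma gradSq_nonneg (u : ST n → ℝ) (p : ST n) : 0 ≤ gradSq u p :=
  Finset.sum_nonneg fun _ _ => sq_nonneg _

lemma contDiff_gradSq (hu : ContDiff ℝ 2 u) : ContDiff ℝ 1 (gradSq u) :=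
  ContDiff.sum fun _ _ => (contDiff_pd hu (by norm_num)).pow 2

lemma contDiff_energyDensity (hu : ContDiff ℝ 2 u) : ContDiff ℝ 1 (energyDensity u) :=
  (((contDiff_pd hu (by norm_num)).pow 2).add (contDiff_gradSq hu)).div_const 2

lemma continuous_box (hu : ContDiff ℝ 2 u) : Continuous (box u) := by
  have h : ∀ v, Continuous (pd v (pd v u)) := fun v =>
    (contDiff_pd (k := 0) (m := 1) (contDiff_pd hu (by norm_num)) (by norm_num)).continuous
  have : box u = fun p => dT (dT u) p - ∑ j, dX j (dX j u) p := funext (box_eq hu)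
  rw [this]
  exact (h _).sub (continuous_finsetSum _ fun j _ => h _)

lemma box_eq_zero_of_notMem_tsupport (hu : ContDiff ℝ 2 u) {p : ST n} (hp : p ∉ tsupport u) :
    box u p = 0 := by
  have h : ∀ v, pd v (pd v u) p = 0 := fun v => by
    by_contra h
    exact hp (tsupport_pd_subset (support_pd_subset (f := pd v u) h))
  rw [box_eq hu]
  simp [dT, dX, h]

lemma hasCompactSupport_box (hu : ContDiff ℝ 2 u) (hc : HasCompactSupport u) :
    HasCompactSupport (box u) :=
  HasCompactSupport.intro hc.isCompact fun _ hp => box_eq_zero_of_notMem_tsupport hu hp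

lemma pd_eq_zero_of_notMem_tsupport {v p : ST n} (hp : p ∉ tsupport u) : pd v u p = 0 := by
  by_contra h
  exact hp (support_pd_subset h)

lemma gradSq_eq_zero_of_notMem_tsupport {p : ST n} (hp : p ∉ tsupport u) : gradSq u p = 0 := by
  simp [gradSq, dX, pd_eq_zero_of_notMem_tsupport hp]

lemma energyDensity_eq_zero_of_notMem_tsupport {p : ST n} (hp : p ∉ tsupport u) :
    energyDensity u p = 0 := by
  simp [energyDensity, dT, gradSq_eq_zero_of_notMem_tsupport hp, pd_eq_zero_of_notMem_tsupport hp]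

lemma dT_energyDensity (hu : ContDiff ℝ 2 u) (p : ST n) :
    dT (energyDensity u) p = dT u p * dT (dT u) p + ∑ j, dX j u p * dX j (dT u) p := by
  have hpd : ∀ v, DifferentiableAt ℝ (pd v u) p := fun v =>
    (contDiff_pd (k := 1) hu (by norm_num)).differentiable (by norm_num) p
  have h1 : energyDensity u = fun q => (1 / 2) * (dT u q ^ 2 + ∑ j, dX j u q ^ 2) := by
    ext q; simp only [energyDensity, gradSq]; ring
  have hs : ∀ j ∈ Finset.univ, DifferentiableAt ℝ (fun q => dX j u q ^ 2) p :=
    fun j _ => (hpd _).pow 2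
  have hsum : DifferentiableAt ℝ (fun q => ∑ j, dX j u q ^ 2) p :=
    DifferentiableAt.fun_sum hs
  rw [h1]
  unfold dT
  rw [pd_const_mul _ (by exact ((hpd _).pow 2).add hsum), pd_add (by exact (hpd _).pow 2) hsum,
    pd_sq (hpd _),
    pd_sum hs, mul_add, Finset.mul_sum]
  congr 1
  · ring
  · refine Finset.sum_congr rfl fun j _ => ?_
    unfold dX
    rw [pd_sq (hpd _), pd_comm hu]
    ring

/-- This is the divergence theorem for the field `w (e, -∂ₜu ∇u)`, with `e` the energy density. Only
the intersection of the two supports has to be compact: with `w = 1` the compactness comes from `u`,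
while in the uniqueness proof `u` is merely zero for early times and a conical cutoff `w` supplies
the rest. -/
lemma weighted_energy_identity (hw : ContDiff ℝ 1 w) (hu : ContDiff ℝ 2 u)
    (hc : IsCompact (tsupport w ∩ tsupport u)) {a b : ℝ} (hab : a ≤ b) :
    ∫ p in slab n a b, (dT w p * energyDensity u p - dT u p * ∑ j, dX j w p * dX j u p
        + w p * (dT u p * box u p))
      = (∫ x, w (b, x) * energyDensity u (b, x)) - ∫ x, w (a, x) * energyDensity u (a, x) := by
  have hpd : ∀ v, ContDiff ℝ 1 (pd v u) := fun v => contDiff_pd hu (by norm_num)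
  have hpdd : ∀ v p, DifferentiableAt ℝ (pd v u) p := fun v p =>
    (hpd v).differentiable (by norm_num) p
  have hwd : ∀ p, DifferentiableAt ℝ w p := fun p => hw.differentiable (by norm_num) p
  have he := contDiff_energyDensity hu
  have hA : ContDiff ℝ 1 (fun p => w p * energyDensity u p) := hw.mul he
  have hAc : HasCompactSupport (fun p => w p * energyDensity u p) := by
    refine HasCompactSupport.intro hc fun p hp => ?_
    by_cases h : p ∈ tsupport w
    · rw [energyDensity_eq_zero_of_notMem_tsupport fun h' => hp ⟨h, h'⟩, mul_zero]
    · rw [image_eq_zero_of_notMem_tsupport h, zero_mul]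
  have hB : ∀ j, ContDiff ℝ 1 (fun p => w p * (dT u p * dX j u p)) := fun j =>
    hw.mul ((hpd _).mul (hpd _))
  have hBc : ∀ j, HasCompactSupport (fun p => w p * (dT u p * dX j u p)) := fun j => by
    refine HasCompactSupport.intro hc fun p hp => ?_
    by_cases h : p ∈ tsupport w
    · rw [dT, pd_eq_zero_of_notMem_tsupport fun h' => hp ⟨h, h'⟩, zero_mul, mul_zero]
    · rw [image_eq_zero_of_notMem_tsupport h, zero_mul]
  rw [← setIntegral_slab_divergence hA hAc hB hBc hab]
  congr 1 with p
  have h1 : dT (fun p => w p * energyDensity u p) p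
      = dT w p * energyDensity u p + w p * dT (energyDensity u) p :=
    pd_mul (hwd p) (he.differentiable (by norm_num) p)
  have h2 : ∀ j, dX j (fun p => w p * (dT u p * dX j u p)) p
      = dX j w p * (dT u p * dX j u p) + w p * (dX j (dT u) p * dX j u p
        + dT u p * dX j (dX j u) p) := by
    intro j
    unfold dX
    rw [pd_mul (hwd p) (by exact (hpdd _ p).mul (hpdd _ p)), dT, pd_mul (hpdd _ p) (hpdd _ p)]
  rw [h1, dT_energyDensity hu, box_eq hu]
  simp only [h2, Finset.sum_add_distrib, ← Finset.mul_sum, mul_add, mul_sub]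
  have h3 : ∑ j, dX j w p * (dT u p * dX j u p) = dT u p * ∑ j, dX j w p * dX j u p := by
    rw [Finset.mul_sum]; exact Finset.sum_congr rfl fun j _ => by ring
  have h4 : ∑ j, dX j (dT u) p * dX j u p = ∑ j, dX j u p * dX j (dT u) p :=
    Finset.sum_congr rfl fun j _ => by ring
  rw [h3, h4]
  ring

/-- The energy identity. -/
lemma energy_identity (hu : ContDiff ℝ 2 u) (hc : HasCompactSupport u) {a b : ℝ} (hab : a ≤ b) :
    ∫ p in slab n a b, dT u p * box u p
      = (∫ x, energyDensity u (b, x)) - ∫ x, energyDensity u (a, x) := by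
  have := weighted_energy_identity (w := fun _ => 1) contDiff_const hu
    (hc.isCompact.inter_left (isClosed_tsupport _)) hab
  simpa [dT, dX, pd] using this

end Energy

/-! ### The Morawetz multiplier and the pointwise identity. -/

/-- The space coordinates, as functions on space-time. -/
def coord {n : ℕ} (k : Fin n) (p : ST n) : ℝ := p.2 k

/-- The radial weight `(R² + |x|²)^{-1/2}`, as a function on space-time. -/
def radialWeight {n : ℕ} (R : ℝ) (p : ST n) : ℝ := (Real.sqrt (R ^ 2 + ‖p.2‖ ^ 2))⁻¹

/-- The function `x · ∇φ`. -/
def radialDeriv {n : ℕ} (φ : ST n → ℝ) (p : ST n) : ℝ := ∑ k, coord k p * dX k φ p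

/-- The Morawetz multiplier `(R² + |x|²)^{-1/2} (x · ∇φ + c φ)`. -/
def multiplier {n : ℕ} (R c : ℝ) (φ : ST n → ℝ) (p : ST n) : ℝ :=
  radialWeight R p * radialDeriv φ p + c * (radialWeight R p * φ p)

section Multiplier

variable {n : ℕ} {R c : ℝ} {φ : ST n → ℝ} {p : ST n}

lemma contDiff_coord (k : Fin n) {m : WithTop ℕ∞} : ContDiff ℝ m (coord k) := by
  have : coord k = fun p : ST n => (EuclideanSpace.proj k : E n →L[ℝ] ℝ) p.2 := by
    ext p; simp [coord]
  rw [this]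
  exact (ContinuousLinearMap.contDiff _).comp contDiff_snd

lemma pd_coord (k : Fin n) (v : ST n) : pd v (coord k) p = v.2 k := by
  have : coord k = ((EuclideanSpace.proj k : E n →L[ℝ] ℝ).comp
      (ContinuousLinearMap.snd ℝ ℝ (E n)) : ST n → ℝ) := by
    ext p; simp [coord]
  rw [this, pd, ContinuousLinearMap.fderiv]
  simp

lemma dX_coord (j k : Fin n) : dX j (coord k) p = if k = j then 1 else 0 := by
  rw [dX, pd_coord]; simp [eX]

lemma sum_coord_sq (p : ST n) : ∑ k, coord k p ^ 2 = ‖p.2‖ ^ 2 := by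
  rw [EuclideanSpace.norm_sq_eq]; simp [coord]

lemma radialWeight_pos (hR : 0 < R) : 0 < radialWeight R p := by
  unfold radialWeight; positivity

lemma radialWeight_sq_mul (hR : 0 < R) : radialWeight R p ^ 2 * (R ^ 2 + ‖p.2‖ ^ 2) = 1 := by
  unfold radialWeight
  rw [inv_pow, Real.sq_sqrt (by positivity)]
  exact inv_mul_cancel₀ (by positivity)

lemma contDiff_radialWeight (hR : 0 < R) {m : WithTop ℕ∞} :
    ContDiff ℝ m (radialWeight R : ST n → ℝ) := by
  unfold radialWeight
  refine ContDiff.inv (ContDiff.sqrt (contDiff_const.add ?_) fun p => ?_) fun p => ?_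
  · exact (contDiff_norm_sq ℝ).comp contDiff_snd
  · positivity
  · positivity

/-- Obtained by differentiating the identity `h² (R² + |x|²) = 1`, which avoids differentiating the
square root. -/
lemma pd_radialWeight (hR : 0 < R) (v : ST n) :
    pd v (radialWeight R) p = -(radialWeight R p ^ 3 * ∑ k, coord k p * v.2 k) := by
  have hd : DifferentiableAt ℝ (radialWeight R) p :=
    (contDiff_radialWeight hR (m := 1)).differentiable (by norm_num) p
  have hcd : ∀ k, DifferentiableAt ℝ (coord k) p := fun k =>
    (contDiff_coord k (m := 1)).differentiable (by norm_num) p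
  have hs : ∀ k ∈ Finset.univ, DifferentiableAt ℝ (fun q => coord k q ^ 2) p :=
    fun k _ => (hcd k).pow 2
  have h1 : (fun q : ST n => radialWeight R q ^ 2 * (R ^ 2 + ∑ k, coord k q ^ 2))
      = fun _ => 1 := by
    ext q; rw [sum_coord_sq, radialWeight_sq_mul hR]
  have h2 := congrArg (fun f => pd v f p) h1
  beta_reduce at h2
  have hs' := DifferentiableAt.fun_sum hs
  rw [pd_mul (by exact hd.pow 2) (by exact (differentiableAt_const _).add hs'), pd_sq hd, pd_add (differentiableAt_const _)
    (DifferentiableAt.fun_sum hs), pd_sum hs] at h2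
  have h3 : ∀ c : ℝ, pd v (fun _ => c) p = 0 := fun c => by simp [pd]
  simp only [h3, pd_sq (hcd _), pd_coord, sum_coord_sq] at h2
  have h4 : ∑ x, 2 * coord x p * v.2 x = 2 * ∑ k, coord k p * v.2 k := by
    rw [Finset.mul_sum]; exact Finset.sum_congr rfl fun _ _ => by ring
  rw [h4] at h2
  have h5 := radialWeight_sq_mul (p := p) hR
  have h6 := radialWeight_pos (p := p) hR
  generalize radialWeight R p = h at *
  generalize ∑ k, coord k p * v.2 k = s at *
  linear_combination (h / 2) * h2 - (pd v (radialWeight R) p) * h5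

lemma dT_radialWeight (hR : 0 < R) : dT (radialWeight R) p = 0 := by
  rw [dT, pd_radialWeight hR]; simp [eT]

lemma dX_radialWeight (hR : 0 < R) (j : Fin n) :
    dX j (radialWeight R) p = -(radialWeight R p ^ 3 * coord j p) := by
  rw [dX, pd_radialWeight hR]; simp [eX]

lemma contDiff_radialDeriv (hφ : ContDiff ℝ 2 φ) : ContDiff ℝ 1 (radialDeriv φ) :=
  ContDiff.sum fun k _ => (contDiff_coord k).mul (contDiff_pd hφ (by norm_num))

lemma contDiff_multiplier (hR : 0 < R) (hφ : ContDiff ℝ 2 φ) :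
    ContDiff ℝ 1 (multiplier R c φ) :=
  ((contDiff_radialWeight hR).mul (contDiff_radialDeriv hφ)).add
    (contDiff_const.mul ((contDiff_radialWeight hR).mul (hφ.of_le (by norm_num))))

lemma multiplier_eq_zero_of_notMem_tsupport (hp : p ∉ tsupport φ) : multiplier R c φ p = 0 := by
  simp [multiplier, radialDeriv, dX, pd_eq_zero_of_notMem_tsupport hp,
    image_eq_zero_of_notMem_tsupport hp]

lemma radialDeriv_sq_le (p : ST n) : radialDeriv φ p ^ 2 ≤ ‖p.2‖ ^ 2 * gradSq φ p := by
  rw [← sum_coord_sq]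
  exact Finset.sum_mul_sq_le_sq_mul_sq _ _ _

lemma pd_radialDeriv (hφ : ContDiff ℝ 2 φ) (v : ST n) :
    pd v (radialDeriv φ) p = ∑ k, v.2 k * dX k φ p + ∑ k, coord k p * pd v (dX k φ) p := by
  have hpd : ∀ v, DifferentiableAt ℝ (pd v φ) p := fun v =>
    (contDiff_pd (k := 1) hφ (by norm_num)).differentiable (by norm_num) p
  have hcd : ∀ k, DifferentiableAt ℝ (coord k) p := fun k =>
    (contDiff_coord k (m := 1)).differentiable (by norm_num) p
  unfold radialDeriv
  rw [pd_sum (fun k _ => by exact (hcd k).mul (hpd _)), ← Finset.sum_add_distrib]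
  refine Finset.sum_congr rfl fun k _ => ?_
  rw [pd_mul (hcd k) (by exact hpd _), pd_coord]

lemma pd_multiplier (hR : 0 < R) (hφ : ContDiff ℝ 2 φ) (v : ST n) :
    pd v (multiplier R c φ) p = pd v (radialWeight R) p * radialDeriv φ p
      + radialWeight R p * pd v (radialDeriv φ) p
      + c * (pd v (radialWeight R) p * φ p + radialWeight R p * pd v φ p) := by
  have hd : DifferentiableAt ℝ (radialWeight R) p :=
    (contDiff_radialWeight hR (m := 1)).differentiable (by norm_num) p
  have hφd : DifferentiableAt ℝ φ p := hφ.differentiable (by norm_num) p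
  have hrd : DifferentiableAt ℝ (radialDeriv φ) p :=
    (contDiff_radialDeriv hφ).differentiable (by norm_num) p
  unfold multiplier
  rw [pd_add (by exact hd.mul hrd) (by exact (hd.mul hφd).const_mul c), pd_mul hd hrd,
    pd_const_mul c (by exact hd.mul hφd), pd_mul hd hφd]

lemma gradSq_pd (hφ : ContDiff ℝ 2 φ) (v : ST n) :
    pd v (gradSq φ) p = 2 * ∑ k, dX k φ p * pd v (dX k φ) p := by
  have hpd : ∀ v, DifferentiableAt ℝ (pd v φ) p := fun v =>
    (contDiff_pd (k := 1) hφ (by norm_num)).differentiable (by norm_num) p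
  unfold gradSq
  rw [pd_sum (fun k _ => by exact (hpd _).pow 2), Finset.mul_sum]
  refine Finset.sum_congr rfl fun k _ => ?_
  rw [pd_sq (by exact hpd _)]
  ring

/-- The bulk term in the Morawetz identity. -/
def morawetzBulk {n : ℕ} (R c : ℝ) (φ : ST n → ℝ) (p : ST n) : ℝ :=
  (radialWeight R p - ‖p.2‖ ^ 2 * radialWeight R p ^ 3) / 2 * dT φ p ^ 2
    + (radialWeight R p + ‖p.2‖ ^ 2 * radialWeight R p ^ 3) / 2 * gradSq φ p
    - radialWeight R p ^ 3 * radialDeriv φ p ^ 2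
    + c / 2 * (n * radialWeight R p ^ 3 - 3 * ‖p.2‖ ^ 2 * radialWeight R p ^ 5) * φ p ^ 2

/-- The space components of the flux in the Morawetz identity. -/
def morawetzFlux {n : ℕ} (R c : ℝ) (φ : ST n → ℝ) (j : Fin n) (p : ST n) : ℝ :=
  1 / 2 * ((radialWeight R p * coord j p) * (dT φ p ^ 2 - gradSq φ p))
    + dX j φ p * multiplier R c φ p
    + c / 2 * (φ p ^ 2 * (coord j p * radialWeight R p ^ 3))

lemma contDiff_morawetzFlux (hR : 0 < R) (hφ : ContDiff ℝ 2 φ) (j : Fin n) :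
    ContDiff ℝ 1 (morawetzFlux R c φ j) := by
  have h1 : ∀ v, ContDiff ℝ 1 (pd v φ) := fun v => contDiff_pd hφ (by norm_num)
  have h2 := contDiff_radialWeight (n := n) hR (m := 1)
  have h3 := contDiff_coord j (m := 1)
  exact ((contDiff_const.mul ((h2.mul h3).mul (((h1 _).pow 2).sub (contDiff_gradSq hφ)))).add
    ((h1 _).mul (contDiff_multiplier hR hφ))).add
    (contDiff_const.mul (((hφ.of_le (by norm_num)).pow 2).mul (h3.mul (h2.pow 3))))

lemma morawetzFlux_eq_zero_of_notMem_tsupport (j : Fin n) (hp : p ∉ tsupport φ) :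
    morawetzFlux R c φ j p = 0 := by
  simp [morawetzFlux, dT, pd_eq_zero_of_notMem_tsupport hp,
    gradSq_eq_zero_of_notMem_tsupport hp, multiplier_eq_zero_of_notMem_tsupport hp,
    image_eq_zero_of_notMem_tsupport hp]

/-- Each term is arranged as a factor independent of `j` times an expression in `j` whose sum is a
named quantity: `|x|²`, `gradSq`, `radialDeriv`, or a second-order term that cancels. The sum over
`j` in `morawetz_pointwise` is then mechanical. -/
lemma dX_morawetzFlux (hR : 0 < R) (hφ : ContDiff ℝ 2 φ) (j : Fin n) :
    dX j (morawetzFlux R c φ j) p =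
      (-(radialWeight R p ^ 3) * (dT φ p ^ 2 - gradSq φ p) / 2
          - 3 / 2 * c * φ p ^ 2 * radialWeight R p ^ 5) * coord j p ^ 2
        + (radialWeight R p * (dT φ p ^ 2 - gradSq φ p) / 2
          + c / 2 * φ p ^ 2 * radialWeight R p ^ 3)
        + (radialWeight R p * dT φ p) * (coord j p * dT (dX j φ) p)
        - radialWeight R p * (coord j p * ∑ k, dX k φ p * dX j (dX k φ) p)
        + multiplier R c φ p * dX j (dX j φ) p
        + (-(radialWeight R p ^ 3 * radialDeriv φ p)) * (coord j p * dX j φ p)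
        + (radialWeight R p + c * radialWeight R p) * dX j φ p ^ 2
        + radialWeight R p * (dX j φ p * ∑ k, coord k p * dX j (dX k φ) p) := by
  have hpd : ∀ v, DifferentiableAt ℝ (pd v φ) p := fun v =>
    (contDiff_pd (k := 1) hφ (by norm_num)).differentiable (by norm_num) p
  have hcd : DifferentiableAt ℝ (coord j) p :=
    (contDiff_coord j (m := 1)).differentiable (by norm_num) p
  have hd : DifferentiableAt ℝ (radialWeight R) p :=
    (contDiff_radialWeight hR (m := 1)).differentiable (by norm_num) p
  have hφd : DifferentiableAt ℝ φ p := hφ.differentiable (by norm_num) p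
  have hmd : DifferentiableAt ℝ (multiplier R c φ) p :=
    (contDiff_multiplier hR hφ).differentiable (by norm_num) p
  have hgd : DifferentiableAt ℝ (gradSq φ) p :=
    (contDiff_gradSq hφ).differentiable (by norm_num) p
  have hw3 : dX j (fun q => radialWeight R q ^ 3) p
      = -(3 * radialWeight R p ^ 5 * coord j p) := by
    have : (fun q : ST n => radialWeight R q ^ 3)
        = fun q => radialWeight R q * radialWeight R q ^ 2 := by ext q; ring
    rw [this, dX, pd_mul hd (by exact hd.pow 2), pd_sq hd, ← dX, dX_radialWeight hR]
    ring
  have ht : pd (eX j) (dT φ) p = dT (dX j φ) p := pd_comm hφ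
  have hsub : pd (eX j) (fun q => dT φ q ^ 2 - gradSq φ q) p
      = 2 * dT φ p * dT (dX j φ) p - 2 * ∑ k, dX k φ p * dX j (dX k φ) p := by
    have : (fun q => dT φ q ^ 2 - gradSq φ q) = fun q => dT φ q ^ 2 + (-1) * gradSq φ q := by
      ext q; ring
    rw [this, pd_add (by exact (hpd _).pow 2) (by exact hgd.const_mul _), pd_const_mul _ hgd,
      pd_sq (by exact hpd _), gradSq_pd hφ, ht]
    simp only [dX]
    ring
  have hdr : pd (eX j) (radialDeriv φ) p
      = dX j φ p + ∑ k, coord k p * dX j (dX k φ) p := by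
    rw [pd_radialDeriv hφ]
    simp [eX, dX]
  have hdw : pd (eX j) (radialWeight R) p = -(radialWeight R p ^ 3 * coord j p) :=
    dX_radialWeight hR j
  have hdc : pd (eX j) (coord j) p = 1 := by
    have := dX_coord (p := p) j j
    rwa [if_pos rfl] at this
  have hmul : pd (eX j) (multiplier R c φ) p = -(radialWeight R p ^ 3 * coord j p)
      * radialDeriv φ p + radialWeight R p * (dX j φ p + ∑ k, coord k p * dX j (dX k φ) p)
      + c * (-(radialWeight R p ^ 3 * coord j p) * φ p + radialWeight R p * dX j φ p) := by
    rw [pd_multiplier hR hφ, hdw, hdr]; rfl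
  have hdd : DifferentiableAt ℝ (fun q => dT φ q ^ 2 - gradSq φ q) p := by
    exact ((hpd _).pow 2).sub hgd
  have e1 : pd (eX j) (fun q => 1 / 2 * ((radialWeight R q * coord j q)
      * (dT φ q ^ 2 - gradSq φ q))) p = 1 / 2 * ((-(radialWeight R p ^ 3 * coord j p) * coord j p
      + radialWeight R p * 1) * (dT φ p ^ 2 - gradSq φ p) + (radialWeight R p * coord j p)
      * (2 * dT φ p * dT (dX j φ) p - 2 * ∑ k, dX k φ p * dX j (dX k φ) p)) := by
    rw [pd_const_mul _ (by exact (hd.mul hcd).mul hdd), pd_mul (by exact hd.mul hcd) hdd, hsub,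
      pd_mul hd hcd, hdw, hdc]
  have e2 : pd (eX j) (fun q => dX j φ q * multiplier R c φ q) p
      = dX j (dX j φ) p * multiplier R c φ p + dX j φ p * pd (eX j) (multiplier R c φ) p := by
    rw [pd_mul (by exact hpd _) hmd]; rfl
  have e3 : pd (eX j) (fun q => c / 2 * (φ q ^ 2 * (coord j q * radialWeight R q ^ 3))) p
      = c / 2 * (2 * φ p * dX j φ p * (coord j p * radialWeight R p ^ 3)
        + φ p ^ 2 * (1 * radialWeight R p ^ 3
          + coord j p * (-(3 * radialWeight R p ^ 5 * coord j p)))) := by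
    rw [pd_const_mul _ (by exact (hφd.pow 2).mul (hcd.mul (hd.pow 3))),
      pd_mul (by exact hφd.pow 2) (by exact hcd.mul (hd.pow 3)), pd_sq hφd,
      pd_mul hcd (by exact hd.pow 3), hdc, ← hw3]
    rfl
  unfold morawetzFlux
  rw [dX, pd_add (by exact (((hd.mul hcd).mul hdd).const_mul _).add ((hpd _).mul hmd))
    (by exact ((hφd.pow 2).mul (hcd.mul (hd.pow 3))).const_mul _),
    pd_add (by exact ((hd.mul hcd).mul hdd).const_mul _) (by exact (hpd _).mul hmd), e1, e2, e3,
    hmul]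
  ring

/-- The pointwise Morawetz identity. -/
lemma morawetz_pointwise (hR : 0 < R) (hφ : ContDiff ℝ 2 φ) (hc : 2 * c = n - 1) :
    dT (fun q => dT φ q * multiplier R c φ q) p - ∑ j, dX j (morawetzFlux R c φ j) p
      = box φ p * multiplier R c φ p - morawetzBulk R c φ p := by
  have hpd : ∀ v, DifferentiableAt ℝ (pd v φ) p := fun v =>
    (contDiff_pd (k := 1) hφ (by norm_num)).differentiable (by norm_num) p
  have hmd : DifferentiableAt ℝ (multiplier R c φ) p :=
    (contDiff_multiplier hR hφ).differentiable (by norm_num) p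
  have h1 : dT (fun q => dT φ q * multiplier R c φ q) p
      = dT (dT φ) p * multiplier R c φ p + dT φ p * (radialWeight R p
        * ∑ k, coord k p * dT (dX k φ) p + c * (radialWeight R p * dT φ p)) := by
    rw [dT, pd_mul (by exact hpd _) hmd, pd_multiplier hR hφ, pd_radialDeriv hφ,
      show pd (eT n) (radialWeight R) p = 0 from dT_radialWeight hR]
    simp [eT, dT]
  -- By symmetry of second derivatives the two contractions of the Hessian with `x` and `∇φ` agree,
  -- so the second-order terms outside `box φ` cancel.
  have h2 : ∑ j, (coord j p * ∑ k, dX k φ p * dX j (dX k φ) p)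
      = ∑ j, (dX j φ p * ∑ k, coord k p * dX j (dX k φ) p) := by
    simp only [Finset.mul_sum]
    rw [Finset.sum_comm]
    refine Finset.sum_congr rfl fun j _ => Finset.sum_congr rfl fun k _ => ?_
    rw [show dX k (dX j φ) p = dX j (dX k φ) p from pd_comm hφ]
    ring
  rw [h1, box_eq hφ]
  simp only [dX_morawetzFlux hR hφ, Finset.sum_add_distrib, Finset.sum_sub_distrib,
    ← Finset.mul_sum, h2, sum_coord_sq, Finset.sum_const, Finset.card_univ, Fintype.card_fin,
    nsmul_eq_mul]
  rw [← radialDeriv, ← gradSq, morawetzBulk]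
  generalize multiplier R c φ p = m
  -- With `c = (n-1)/2` the multiples of `h (∂ₜφ² - |∇φ|²)` coming from the divergence of `h x` and
  -- from the zeroth-order part of the multiplier combine to the coefficients in `morawetzBulk`,
  -- which no longer involve `n` in the first-order terms.
  have hn : (n : ℝ) = 2 * c + 1 := by linarith
  rw [hn]
  ring

end Multiplier

/-! ### Elementary facts on the bracket. -/

section Bracket

variable {n : ℕ} {x : E n}

lemma bracket_sq (x : E n) : bracket x ^ 2 = 1 + ‖x‖ ^ 2 :=
  Real.sq_sqrt (by positivity)

lemma one_le_bracket (x : E n) : 1 ≤ bracket x :=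
  Real.one_le_sqrt.mpr (by nlinarith [sq_nonneg ‖x‖])

lemma bracket_pos (x : E n) : 0 < bracket x := one_pos.trans_le (one_le_bracket x)

lemma continuous_bracket : Continuous (bracket : E n → ℝ) := by
  unfold bracket; fun_prop

lemma norm_le_bracket (x : E n) : ‖x‖ ≤ bracket x := by
  have := bracket_sq x
  have := bracket_pos x
  nlinarith [norm_nonneg x]

lemma continuous_bracket_rpow (s : ℝ) : Continuous (fun x : E n => bracket x ^ s) :=
  continuous_bracket.rpow_const fun x => Or.inl (bracket_pos x).ne'

end Bracket

/-! ### The Morawetz inequality at a fixed scale. -/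

/-- The sum of the squares of the derivatives of `φ` and of `⟨x⟩⁻¹ φ`. -/
def fullDensity {n : ℕ} (φ : ST n → ℝ) (p : ST n) : ℝ :=
  dT φ p ^ 2 + gradSq φ p + (φ p / bracket p.2) ^ 2

/-- The density controlled by the Morawetz identity at the scale `R`. -/
def scaleDensity {n : ℕ} (R : ℝ) (φ : ST n → ℝ) (p : ST n) : ℝ :=
  R ^ 2 * radialWeight R p ^ 3 * (dT φ p ^ 2 + gradSq φ p + radialWeight R p ^ 2 * φ p ^ 2)

section Morawetz

variable {n : ℕ} {R c T : ℝ} {φ : ST n → ℝ} {p : ST n}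

lemma integrableOn_of_tsupport {f : ST n → ℝ} (hf : Continuous f) (hc : HasCompactSupport φ)
    (h0 : ∀ p ∉ tsupport φ, f p = 0) {s : Set (ST n)} : IntegrableOn f s :=
  integrableOn_slab hf (HasCompactSupport.intro hc.isCompact h0)

lemma integrable_slice_of_tsupport {f : ST n → ℝ} (hf : Continuous f) (hc : HasCompactSupport φ)
    (h0 : ∀ p ∉ tsupport φ, f p = 0) (t : ℝ) : Integrable fun x => f (t, x) :=
  integrable_slice hf (HasCompactSupport.intro hc.isCompact h0) t

lemma continuous_pd (hφ : ContDiff ℝ 1 φ) (v : ST n) : Continuous (pd v φ) :=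
  (contDiff_pd (k := 0) hφ (by norm_num)).continuous

lemma continuous_gradSq (hφ : ContDiff ℝ 1 φ) : Continuous (gradSq φ) :=
  continuous_finsetSum _ fun _ _ => (continuous_pd hφ _).pow 2

lemma continuous_fullDensity (hφ : ContDiff ℝ 1 φ) : Continuous (fullDensity φ) :=
  (((continuous_pd hφ _).pow 2).add (continuous_gradSq hφ)).add ((hφ.continuous.div
    (continuous_bracket.comp continuous_snd) fun p => (bracket_pos p.2).ne').pow 2)

lemma fullDensity_nonneg : 0 ≤ fullDensity φ p := by
  have := gradSq_nonneg φ p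
  unfold fullDensity; positivity

lemma fullDensity_eq_zero_of_notMem_tsupport (hp : p ∉ tsupport φ) : fullDensity φ p = 0 := by
  simp [fullDensity, dT, pd_eq_zero_of_notMem_tsupport hp, gradSq_eq_zero_of_notMem_tsupport hp,
    image_eq_zero_of_notMem_tsupport hp]

lemma continuous_scaleDensity (hR : 0 < R) (hφ : ContDiff ℝ 1 φ) :
    Continuous (scaleDensity R φ) := by
  have h := (contDiff_radialWeight (n := n) hR (m := 1)).continuous
  exact (continuous_const.mul (h.pow 3)).mul ((((continuous_pd hφ _).pow 2).add
    (continuous_gradSq hφ)).add ((h.pow 2).mul (hφ.continuous.pow 2)))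

lemma scaleDensity_nonneg (hR : 0 < R) : 0 ≤ scaleDensity R φ p := by
  have := gradSq_nonneg φ p
  have := radialWeight_pos (p := p) hR
  unfold scaleDensity; positivity

lemma scaleDensity_eq_zero_of_notMem_tsupport (hp : p ∉ tsupport φ) :
    scaleDensity R φ p = 0 := by
  simp [scaleDensity, dT, pd_eq_zero_of_notMem_tsupport hp, gradSq_eq_zero_of_notMem_tsupport hp,
    image_eq_zero_of_notMem_tsupport hp]

lemma norm_sq_mul_radialWeight_sq_le (hR : 0 < R) : ‖p.2‖ ^ 2 * radialWeight R p ^ 2 ≤ 1 := by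
  have := radialWeight_sq_mul (p := p) hR
  nlinarith [mul_nonneg (sq_nonneg (radialWeight R p)) (sq_nonneg R)]

/-- Write `h` for the radial weight and `r = |x|`. Since `h² (R² + r²) = 1`, one has `h - r²h³ =
R²h³` and `h + r²h³ = R²h³ + 2r²h³`, and the excess `r²h³ |∇φ|²` dominates `h³ (x·∇φ)²` by
Cauchy–Schwarz. In the zeroth-order term `n h³ - 3r²h⁵ = 3R²h⁵ + (n-3)(R² + r²)h⁵`. This is where `n
≥ 3` enters, together with `c ≥ 1`. -/
lemma scaleDensity_le_morawetzBulk (hn : 3 ≤ n) (hR : 0 < R) (hc : 2 * c = n - 1) :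
    scaleDensity R φ p / 2 ≤ morawetzBulk R c φ p := by
  have h1 := radialWeight_sq_mul (p := p) hR
  have h2 := radialWeight_pos (p := p) hR
  have h3 := radialDeriv_sq_le (φ := φ) p
  have hn' : (3 : ℝ) ≤ n := by exact_mod_cast hn
  unfold scaleDensity morawetzBulk
  generalize radialWeight R p = h at *
  generalize gradSq φ p = S at *
  generalize radialDeriv φ p = P at *
  generalize ‖p.2‖ = r at *
  have e1 : h = h ^ 3 * (R ^ 2 + r ^ 2) := by linear_combination -h * h1
  have e3 : h ^ 3 = h ^ 5 * (R ^ 2 + r ^ 2) := by linear_combination -h ^ 3 * h1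
  have k1 : 0 ≤ h ^ 3 * (r ^ 2 * S - P ^ 2) := mul_nonneg (by positivity) (by linarith)
  have k2 : 0 ≤ h ^ 5 * ((n - 3) * (R ^ 2 + r ^ 2)) := by
    have : (0 : ℝ) ≤ n - 3 := by linarith
    positivity
  have e4 : (n : ℝ) * h ^ 3 - 3 * r ^ 2 * h ^ 5
      = 3 * R ^ 2 * h ^ 5 + h ^ 5 * ((n - 3) * (R ^ 2 + r ^ 2)) := by
    linear_combination (n : ℝ) * e3
  have k3 : R ^ 2 * h ^ 5 ≤ c * (n * h ^ 3 - 3 * r ^ 2 * h ^ 5) := by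
    rw [e4]
    have hc1 : 1 ≤ c := by linarith
    have : 0 ≤ R ^ 2 * h ^ 5 := by positivity
    nlinarith
  have k4 : R ^ 2 * h ^ 5 * φ p ^ 2 ≤ c * (n * h ^ 3 - 3 * r ^ 2 * h ^ 5) * φ p ^ 2 :=
    mul_le_mul_of_nonneg_right k3 (sq_nonneg _)
  have e5 : (h - r ^ 2 * h ^ 3) = R ^ 2 * h ^ 3 := by linear_combination e1
  have e6 : (h + r ^ 2 * h ^ 3) = R ^ 2 * h ^ 3 + 2 * r ^ 2 * h ^ 3 := by linear_combination e1
  rw [e5, e6]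
  nlinarith

lemma continuous_multiplier (hR : 0 < R) (hφ : ContDiff ℝ 2 φ) :
    Continuous (multiplier R c φ) := (contDiff_multiplier hR hφ).continuous

/-- The `L²` bound for the multiplier on time slices. For `c = (n - 1) / 2` the last term has a
favourable sign, for `c = (n - 2) / 2` this is Hardy's inequality. -/
lemma integral_multiplier_sq_le (hR : 0 < R) (hc0 : 0 ≤ c) (hφ : ContDiff ℝ 2 φ)
    (hc : HasCompactSupport φ) (t : ℝ) :
    ∫ x, multiplier R c φ (t, x) ^ 2 ≤ (∫ x, gradSq φ (t, x))
      + c * (c - n + 2) * ∫ x, radialWeight R ((t, x) : ST n) ^ 2 * φ (t, x) ^ 2 := by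
  have hwc := contDiff_radialWeight (n := n) hR (m := 1)
  have hφ1 : ContDiff ℝ 1 φ := hφ.of_le (by norm_num)
  -- The divergence of `V = h² φ² x` contains the cross term `2h² φ (x·∇φ)` from the square of the
  -- multiplier and has zero integral over each slice. The remaining multiples of `h²φ²` add up to
  -- at most `c(c-n+2) h²φ²`, because `r²h² ≤ 1`.
  let V : Fin n → ST n → ℝ := fun j q => radialWeight R q ^ 2 * (coord j q * φ q ^ 2)
  have hV : ∀ j, ContDiff ℝ 1 (V j) := fun j =>
    (hwc.pow 2).mul ((contDiff_coord j).mul (hφ1.pow 2))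
  have hVc : ∀ j, HasCompactSupport (V j) := fun j =>
    HasCompactSupport.intro hc.isCompact fun q hq => by
      simp [V, image_eq_zero_of_notMem_tsupport hq]
  have hdiv : ∫ x, ∑ j, dX j (V j) (t, x) = 0 := by
    have hi : ∀ j, Integrable fun x => dX j (V j) (t, x) := fun j =>
      integrable_slice (continuous_pd (hV j) _) (hasCompactSupport_pd (hVc j)) t
    rw [integral_finsetSum _ fun j _ => hi j]
    exact Finset.sum_eq_zero fun j _ => integral_slice_pd_eq_zero (hV j) (hVc j) t _
  have hdV : ∀ q j, dX j (V j) q = (-2 * radialWeight R q ^ 4 * φ q ^ 2) * coord j q ^ 2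
      + radialWeight R q ^ 2 * φ q ^ 2 + 2 * radialWeight R q ^ 2 * φ q
        * (coord j q * dX j φ q) := by
    intro q j
    have hcd : DifferentiableAt ℝ (coord j) q :=
      (contDiff_coord j (m := 1)).differentiable (by norm_num) q
    have hd : DifferentiableAt ℝ (radialWeight R) q := hwc.differentiable (by norm_num) q
    have hφd : DifferentiableAt ℝ φ q := hφ.differentiable (by norm_num) q
    have h1 : pd (eX j) (radialWeight R) q = -(radialWeight R q ^ 3 * coord j q) :=
      dX_radialWeight hR j
    have h2 : pd (eX j) (coord j) q = 1 := by
      have := dX_coord (p := q) j j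
      rwa [if_pos rfl] at this
    rw [dX, pd_mul (by exact hd.pow 2) (by exact hcd.mul (hφd.pow 2)), pd_sq hd, h1,
      pd_mul hcd (by exact hφd.pow 2), h2, pd_sq hφd, ← dX]
    ring
  have hsum : ∀ q, ∑ j, dX j (V j) q = -2 * ‖q.2‖ ^ 2 * radialWeight R q ^ 4 * φ q ^ 2
      + n * (radialWeight R q ^ 2 * φ q ^ 2)
      + 2 * radialWeight R q ^ 2 * φ q * radialDeriv φ q := by
    intro q
    simp only [hdV, Finset.sum_add_distrib, ← Finset.mul_sum, sum_coord_sq, Finset.sum_const,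
      Finset.card_univ, Fintype.card_fin, nsmul_eq_mul]
    rw [← radialDeriv]
    ring
  have hpt : ∀ q, multiplier R c φ q ^ 2 ≤ gradSq φ q
      + c * (c - n + 2) * (radialWeight R q ^ 2 * φ q ^ 2) + c * ∑ j, dX j (V j) q := by
    intro q
    rw [hsum q]
    have h1 := norm_sq_mul_radialWeight_sq_le (p := q) hR
    have h3 := radialDeriv_sq_le (φ := φ) q
    have h4 := gradSq_nonneg φ q
    unfold multiplier
    generalize radialWeight R q = h at *
    generalize gradSq φ q = S at *
    generalize radialDeriv φ q = P at *
    generalize ‖q.2‖ = r at *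
    have k1 : h ^ 2 * P ^ 2 ≤ S := by
      have : h ^ 2 * P ^ 2 ≤ h ^ 2 * (r ^ 2 * S) := mul_le_mul_of_nonneg_left h3 (sq_nonneg _)
      nlinarith
    have k2 : 0 ≤ c * (h ^ 2 * φ q ^ 2) * (1 - r ^ 2 * h ^ 2) :=
      mul_nonneg (by positivity) (by linarith)
    nlinarith
  have i1 : Integrable fun x => gradSq φ (t, x) :=
    integrable_slice_of_tsupport (continuous_gradSq hφ1) hc
      (fun p hp => gradSq_eq_zero_of_notMem_tsupport hp) t
  have i2 : Integrable fun x => radialWeight R ((t, x) : ST n) ^ 2 * φ (t, x) ^ 2 :=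
    integrable_slice_of_tsupport (f := fun q => radialWeight R q ^ 2 * φ q ^ 2)
      ((hwc.continuous.pow 2).mul (hφ.continuous.pow 2)) hc
      (fun p hp => by simp [image_eq_zero_of_notMem_tsupport hp]) t
  have i3 : Integrable fun x => ∑ j, dX j (V j) ((t, x) : ST n) :=
    integrable_finsetSum _ fun j _ => integrable_slice (continuous_pd (hV j) _)
      (hasCompactSupport_pd (hVc j)) t
  have i4 : Integrable fun x => multiplier R c φ (t, x) ^ 2 :=
    integrable_slice_of_tsupport (f := fun q => multiplier R c φ q ^ 2)
      ((continuous_multiplier hR hφ).pow 2) hc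
      (fun p hp => by simp [multiplier_eq_zero_of_notMem_tsupport hp]) t
  calc ∫ x, multiplier R c φ (t, x) ^ 2
      ≤ ∫ x, (gradSq φ (t, x) + c * (c - n + 2) * (radialWeight R ((t, x) : ST n) ^ 2
          * φ (t, x) ^ 2) + c * ∑ j, dX j (V j) (t, x)) :=
        integral_mono i4 ((i1.add (i2.const_mul _)).add (i3.const_mul _)) fun x => hpt (t, x)
    _ = _ := by
        rw [integral_add (by exact i1.add (i2.const_mul _)) (i3.const_mul _),
          integral_add i1 (i2.const_mul _), integral_const_mul, integral_const_mul, hdiv]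
        ring

/-- The Morawetz inequality at the scale `R`. -/
lemma integral_scaleDensity_le (hn : 3 ≤ n) (hR : 0 < R) (hc2 : 2 * c = n - 1)
    (hφ : ContDiff ℝ 2 φ) (hc : HasCompactSupport φ) (hT : 0 ≤ T)
    (hφT : ∀ x, (T, x) ∉ tsupport φ) :
    (∫ p in slab n 0 T, scaleDensity R φ p) / 2
      ≤ (∫ p in slab n 0 T, |box φ p| * |multiplier R c φ p|)
        + ∫ x, energyDensity φ (0, x) := by
  have hn' : (3 : ℝ) ≤ n := by exact_mod_cast hn
  have hφ1 : ContDiff ℝ 1 φ := hφ.of_le (by norm_num)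
  have hm := contDiff_multiplier (c := c) hR hφ
  have hbox := continuous_box hφ
  have hA : ContDiff ℝ 1 (fun q => dT φ q * multiplier R c φ q) :=
    (contDiff_pd hφ (by norm_num)).mul hm
  have hA0 : ∀ q ∉ tsupport φ, dT φ q * multiplier R c φ q = 0 := fun q hq => by
    rw [multiplier_eq_zero_of_notMem_tsupport hq, mul_zero]
  have hAc : HasCompactSupport (fun q => dT φ q * multiplier R c φ q) :=
    HasCompactSupport.intro hc.isCompact hA0
  have key := setIntegral_slab_divergence hA hAc (contDiff_morawetzFlux (c := c) hR hφ)
    (fun j => HasCompactSupport.intro hc.isCompact fun q hq =>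
      morawetzFlux_eq_zero_of_notMem_tsupport j hq) hT
  simp only [morawetz_pointwise hR hφ hc2] at key
  have iG : IntegrableOn (fun q => box φ q * multiplier R c φ q) (slab n 0 T) :=
    integrableOn_of_tsupport (hbox.mul hm.continuous) hc fun q hq => by
      simp [multiplier_eq_zero_of_notMem_tsupport hq]
  have iB : IntegrableOn (morawetzBulk R c φ) (slab n 0 T) := by
    refine integrableOn_of_tsupport ?_ hc fun q hq => ?_
    · have h1 := (contDiff_radialWeight (n := n) hR (m := 1)).continuous
      have h2 := continuous_pd hφ1 (eT n)
      have h3 := continuous_gradSq hφ1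
      have h4 := (contDiff_radialDeriv hφ).continuous
      have h5 := hφ.continuous
      change Continuous (dT φ) at h2
      unfold morawetzBulk
      fun_prop
    · simp [morawetzBulk, dT, pd_eq_zero_of_notMem_tsupport hq,
        gradSq_eq_zero_of_notMem_tsupport hq, image_eq_zero_of_notMem_tsupport hq,
        radialDeriv, dX]
  have iS : IntegrableOn (fun q => scaleDensity R φ q / 2) (slab n 0 T) :=
    integrableOn_of_tsupport ((continuous_scaleDensity hR hφ1).div_const 2) hc fun q hq => by
      simp [scaleDensity_eq_zero_of_notMem_tsupport hq]
  rw [integral_sub iG iB] at key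
  have hT0 : ∫ x, dT φ (T, x) * multiplier R c φ (T, x) = 0 := by
    simp [fun x => hA0 (T, x) (hφT x)]
  rw [hT0, zero_sub] at key
  have h1 : (∫ p in slab n 0 T, scaleDensity R φ p) / 2
      ≤ ∫ p in slab n 0 T, morawetzBulk R c φ p := by
    rw [← integral_div]
    exact integral_mono iS iB fun q => scaleDensity_le_morawetzBulk hn hR hc2
  have h2 : ∫ p in slab n 0 T, box φ p * multiplier R c φ p
      ≤ ∫ p in slab n 0 T, |box φ p| * |multiplier R c φ p| := by
    refine integral_mono iG ?_ fun q => ?_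
    · have := iG.norm
      simpa [abs_mul] using this
    · change box φ q * multiplier R c φ q ≤ |box φ q| * |multiplier R c φ q|
      rw [← abs_mul]; exact le_abs_self _
  have i1 : Integrable fun x => dT φ (0, x) ^ 2 :=
    integrable_slice_of_tsupport (f := fun q => dT φ q ^ 2) ((continuous_pd hφ1 _).pow 2) hc
      (fun p hp => by simp [dT, pd_eq_zero_of_notMem_tsupport hp]) 0
  have i2 : Integrable fun x => multiplier R c φ (0, x) ^ 2 :=
    integrable_slice_of_tsupport (f := fun q => multiplier R c φ q ^ 2)
      (hm.continuous.pow 2) hc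
      (fun p hp => by simp [multiplier_eq_zero_of_notMem_tsupport hp]) 0
  have i3 : Integrable fun x => gradSq φ (0, x) :=
    integrable_slice_of_tsupport (continuous_gradSq hφ1) hc
      (fun p hp => gradSq_eq_zero_of_notMem_tsupport hp) 0
  have h3 : ∫ x, dT φ (0, x) * multiplier R c φ (0, x)
      ≤ ∫ x, energyDensity φ (0, x) := by
    -- For `c = (n-1)/2` the coefficient `c(c-n+2)` equals `c(3-n)/2 ≤ 0`. The `L²` norm of the
    -- multiplier is therefore at most that of the gradient, and the boundary term at time zero is
    -- at most the energy.
    have h4 := integral_multiplier_sq_le hR (c := c) (by linarith) hφ hc 0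
    have h5 : c * (c - n + 2)
        * ∫ x, radialWeight R ((0, x) : ST n) ^ 2 * φ (0, x) ^ 2 ≤ 0 := by
      refine mul_nonpos_of_nonpos_of_nonneg (mul_nonpos_of_nonneg_of_nonpos ?_ ?_) ?_
      · linarith
      · linarith
      · exact integral_nonneg fun x => by positivity
    have h6 : ∫ x, dT φ (0, x) * multiplier R c φ (0, x)
        ≤ ∫ x, (1 / 2 * dT φ (0, x) ^ 2 + 1 / 2 * multiplier R c φ (0, x) ^ 2) :=
      integral_mono (integrable_slice hA.continuous hAc 0)
        ((i1.const_mul _).add (i2.const_mul _)) fun x => by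
          change _ ≤ 1 / 2 * dT φ (0, x) ^ 2 + 1 / 2 * multiplier R c φ (0, x) ^ 2
          nlinarith [sq_nonneg (dT φ (0, x) - multiplier R c φ (0, x))]
    rw [integral_add (i1.const_mul _) (i2.const_mul _), integral_const_mul,
      integral_const_mul] at h6
    have h7 : ∫ x, energyDensity φ (0, x)
        = 1 / 2 * (∫ x, dT φ (0, x) ^ 2) + 1 / 2 * ∫ x, gradSq φ (0, x) := by
      rw [← integral_const_mul, ← integral_const_mul,
        ← integral_add (i1.const_mul _) (i3.const_mul _)]
      congr 1 with x
      simp only [energyDensity]; ring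
    linarith
  linarith

end Morawetz

/-! ### Weighted dual estimates for test functions vanishing near time `T`. -/

section DualEstimates

variable {n : ℕ} {R c T : ℝ} {φ : ST n → ℝ} {p : ST n}

/-- The energy vanishes at time `T`, so the energy identity is read backwards from there. -/
lemma integral_energyDensity_le (hφ : ContDiff ℝ 2 φ) (hc : HasCompactSupport φ)
    (hφT : ∀ x, (T, x) ∉ tsupport φ) {t : ℝ} (ht : t ∈ Icc 0 T) :
    ∫ x, energyDensity φ (t, x) ≤ ∫ p in slab n 0 T, |box φ p| * |dT φ p| := by
  have hφ1 : ContDiff ℝ 1 φ := hφ.of_le (by norm_num)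
  have h1 := energy_identity hφ hc ht.2
  have h2 : ∫ x, energyDensity φ (T, x) = 0 := by
    simp [fun x => energyDensity_eq_zero_of_notMem_tsupport (hφT x)]
  rw [h2, zero_sub] at h1
  have hcont : Continuous fun p => |box φ p| * |dT φ p| :=
    (continuous_box hφ).abs.mul (continuous_pd hφ1 _).abs
  have h0 : ∀ p ∉ tsupport φ, |box φ p| * |dT φ p| = 0 := fun p hp => by
    simp [dT, pd_eq_zero_of_notMem_tsupport hp]
  calc ∫ x, energyDensity φ (t, x) = -∫ p in slab n t T, dT φ p * box φ p := by linarith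
    _ = ∫ p in slab n t T, -(dT φ p * box φ p) := (integral_neg _).symm
    _ ≤ ∫ p in slab n t T, |box φ p| * |dT φ p| := by
        refine integral_mono ?_ (integrableOn_of_tsupport hcont hc h0) fun p => ?_
        · refine (integrableOn_of_tsupport (f := fun p => dT φ p * box φ p)
            ((continuous_pd hφ1 _).mul (continuous_box hφ)) hc fun p hp => ?_).neg
          simp [dT, pd_eq_zero_of_notMem_tsupport hp]
        · change -(dT φ p * box φ p) ≤ |box φ p| * |dT φ p|
          rw [← abs_mul, mul_comm (dT φ p)]
          exact neg_le_abs _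
    _ ≤ ∫ p in slab n 0 T, |box φ p| * |dT φ p| := by
        refine setIntegral_mono_set (integrableOn_of_tsupport hcont hc h0)
          (Filter.Eventually.of_forall fun p => by positivity)
          (LE.le.eventuallyLE ?_)
        exact prod_mono (Icc_subset_Icc_left ht.1) le_rfl

/-- The bound is uniform in the scale: for `R ≥ 1` the radial weight is at most both `1/⟨x⟩` and,
where `x ≠ 0`, `1/|x|`. Hence one source pairing serves all dyadic scales. -/
lemma abs_multiplier_le (hR : 1 ≤ R) (hc : 0 ≤ c) :
    |multiplier R c φ p| ≤ (1 + c) * √(fullDensity φ p) := by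
  have hR0 : 0 < R := by linarith
  have h1 := radialWeight_sq_mul (p := p) hR0
  have h2 := radialWeight_pos (p := p) hR0
  have h3 := radialDeriv_sq_le (φ := φ) p
  have h4 := norm_sq_mul_radialWeight_sq_le (p := p) hR0
  have h5 := gradSq_nonneg φ p
  have hb := bracket_pos p.2
  have hb2 := bracket_sq p.2
  have k1 : |radialWeight R p * radialDeriv φ p| ≤ √(fullDensity φ p) := by
    refine Real.abs_le_sqrt ?_
    calc (radialWeight R p * radialDeriv φ p) ^ 2
        = radialWeight R p ^ 2 * radialDeriv φ p ^ 2 := by ring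
      _ ≤ radialWeight R p ^ 2 * (‖p.2‖ ^ 2 * gradSq φ p) := by gcongr
      _ = (‖p.2‖ ^ 2 * radialWeight R p ^ 2) * gradSq φ p := by ring
      _ ≤ 1 * gradSq φ p := by gcongr
      _ ≤ fullDensity φ p := by
          unfold fullDensity
          nlinarith [sq_nonneg (dT φ p), sq_nonneg (φ p / bracket p.2)]
  have k2 : |radialWeight R p * φ p| ≤ √(fullDensity φ p) := by
    refine Real.abs_le_sqrt ?_
    have : radialWeight R p ^ 2 ≤ (bracket p.2 ^ 2)⁻¹ := by
      rw [le_inv_comm₀ (by positivity) (by positivity), hb2,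
        eq_inv_of_mul_eq_one_left h1, inv_inv]
      nlinarith
    calc (radialWeight R p * φ p) ^ 2 = radialWeight R p ^ 2 * φ p ^ 2 := by ring
      _ ≤ (bracket p.2 ^ 2)⁻¹ * φ p ^ 2 := by gcongr
      _ = (φ p / bracket p.2) ^ 2 := by rw [div_pow]; ring
      _ ≤ fullDensity φ p := by
          unfold fullDensity
          nlinarith [sq_nonneg (dT φ p)]
  calc |multiplier R c φ p| ≤ |radialWeight R p * radialDeriv φ p|
        + |c * (radialWeight R p * φ p)| := abs_add_le _ _
    _ = |radialWeight R p * radialDeriv φ p| + c * |radialWeight R p * φ p| := by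
        rw [abs_mul c, abs_of_nonneg hc]
    _ ≤ √(fullDensity φ p) + c * √(fullDensity φ p) := by gcongr
    _ = _ := by ring

/-- The pairing of the source `box φ` with the square root of the full density. -/
def sourcePairing {n : ℕ} (T : ℝ) (φ : ST n → ℝ) : ℝ :=
  ∫ p in slab n 0 T, |box φ p| * √(fullDensity φ p)

lemma continuous_sourcePairing (hφ : ContDiff ℝ 2 φ) :
    Continuous fun p => |box φ p| * √(fullDensity φ p) :=
  (continuous_box hφ).abs.mul (continuous_fullDensity (hφ.of_le (by norm_num))).sqrt

lemma integrableOn_sourcePairing (hφ : ContDiff ℝ 2 φ) (hc : HasCompactSupport φ)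
    {s : Set (ST n)} : IntegrableOn (fun p => |box φ p| * √(fullDensity φ p)) s :=
  integrableOn_of_tsupport (continuous_sourcePairing hφ) hc fun p hp => by
    simp [box_eq_zero_of_notMem_tsupport hφ hp]

lemma sourcePairing_nonneg : 0 ≤ sourcePairing T φ :=
  integral_nonneg fun p => by positivity

lemma integral_energyDensity_le_sourcePairing (hφ : ContDiff ℝ 2 φ) (hc : HasCompactSupport φ)
    (hφT : ∀ x, (T, x) ∉ tsupport φ) {t : ℝ} (ht : t ∈ Icc 0 T) :
    ∫ x, energyDensity φ (t, x) ≤ sourcePairing T φ := by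
  have hφ1 : ContDiff ℝ 1 φ := hφ.of_le (by norm_num)
  refine (integral_energyDensity_le hφ hc hφT ht).trans ?_
  refine integral_mono ?_ (integrableOn_sourcePairing hφ hc) fun p => ?_
  · exact integrableOn_of_tsupport ((continuous_box hφ).abs.mul (continuous_pd hφ1 _).abs) hc
      fun p hp => by simp [box_eq_zero_of_notMem_tsupport hφ hp]
  · refine mul_le_mul_of_nonneg_left (Real.abs_le_sqrt ?_) (abs_nonneg _)
    have := gradSq_nonneg φ p
    unfold fullDensity
    nlinarith [sq_nonneg (φ p / bracket p.2)]

/-- In the constant, `n` bounds `1 + c = (n+1)/2` from the multiplier, the added `1` is the energy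
at time zero, and the factor `2` undoes the half in the Morawetz inequality. It does not depend on
`R`. -/
lemma setIntegral_scaleDensity_le (hn : 3 ≤ n) (hR : 1 ≤ R) (hφ : ContDiff ℝ 2 φ)
    (hc : HasCompactSupport φ) (hT : 0 ≤ T) (hφT : ∀ x, (T, x) ∉ tsupport φ) :
    ∫ p in slab n 0 T, scaleDensity R φ p ≤ 2 * (n + 1) * sourcePairing T φ := by
  have hn' : (3 : ℝ) ≤ n := by exact_mod_cast hn
  have hR0 : 0 < R := by linarith
  have h1 := integral_scaleDensity_le (c := ((n : ℝ) - 1) / 2) hn hR0 (by ring) hφ hc hT hφT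
  have h2 := integral_energyDensity_le_sourcePairing hφ hc hφT (left_mem_Icc.mpr hT)
  have h3 : ∫ p in slab n 0 T, |box φ p| * |multiplier R (((n : ℝ) - 1) / 2) φ p|
      ≤ n * sourcePairing T φ := by
    unfold sourcePairing
    rw [← integral_const_mul]
    refine integral_mono ?_ ((integrableOn_sourcePairing hφ hc).const_mul _) fun p => ?_
    · exact integrableOn_of_tsupport ((continuous_box hφ).abs.mul
        (continuous_multiplier hR0 hφ).abs) hc
        fun p hp => by simp [box_eq_zero_of_notMem_tsupport hφ hp]
    · have h4 := abs_multiplier_le (φ := φ) (p := p) hR (c := ((n : ℝ) - 1) / 2) (by linarith)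
      have h5 : (1 + ((n : ℝ) - 1) / 2) * √(fullDensity φ p) ≤ n * √(fullDensity φ p) := by
        gcongr; linarith
      calc |box φ p| * |multiplier R (((n : ℝ) - 1) / 2) φ p|
          ≤ |box φ p| * (n * √(fullDensity φ p)) := by gcongr; exact h4.trans h5
        _ = n * (|box φ p| * √(fullDensity φ p)) := by ring
  linarith

/-- Hardy's inequality. -/
lemma integral_div_bracket_sq_le (hn : 3 ≤ n) (hφ : ContDiff ℝ 2 φ)
    (hc : HasCompactSupport φ) (t : ℝ) :
    ∫ x, (φ (t, x) / bracket x) ^ 2 ≤ 4 * ∫ x, gradSq φ (t, x) := by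
  have hn' : (3 : ℝ) ≤ n := by exact_mod_cast hn
  have h1 := integral_multiplier_sq_le (R := 1) (c := ((n : ℝ) - 2) / 2) one_pos (by linarith)
    hφ hc t
  have h2 : 0 ≤ ∫ x, multiplier 1 (((n : ℝ) - 2) / 2) φ (t, x) ^ 2 :=
    integral_nonneg fun x => by positivity
  have h3 : ∀ x, (φ (t, x) / bracket x) ^ 2
      = radialWeight 1 ((t, x) : ST n) ^ 2 * φ (t, x) ^ 2 := fun x => by
    have : radialWeight 1 ((t, x) : ST n) = (bracket x)⁻¹ := by
      simp [radialWeight, bracket]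
    rw [this]; ring
  simp only [h3]
  have h4 : 0 ≤ ∫ x, radialWeight 1 ((t, x) : ST n) ^ 2 * φ (t, x) ^ 2 :=
    integral_nonneg fun x => by positivity
  generalize (∫ x, radialWeight 1 ((t, x) : ST n) ^ 2 * φ (t, x) ^ 2) = H at *
  -- At `c = (n-2)/2` the coefficient `c(c-n+2)` is `-(n-2)²/4`, at most `-1/4`. Nonnegativity of
  -- the left-hand side in `integral_multiplier_sq_le` is then Hardy's inequality.
  have h5 : ((n : ℝ) - 2) / 2 * (((n : ℝ) - 2) / 2 - n + 2) * H
      = -(((n : ℝ) - 2) ^ 2 / 4 * H) := by ring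
  have h6 : 1 / 4 * H ≤ ((n : ℝ) - 2) ^ 2 / 4 * H := by gcongr; nlinarith
  linarith

lemma integral_gradSq_le_energy (hφ : ContDiff ℝ 2 φ) (hc : HasCompactSupport φ) (t : ℝ) :
    ∫ x, gradSq φ (t, x) ≤ 2 * ∫ x, energyDensity φ (t, x) := by
  have hφ1 : ContDiff ℝ 1 φ := hφ.of_le (by norm_num)
  rw [← integral_const_mul]
  refine integral_mono (integrable_slice_of_tsupport (continuous_gradSq hφ1) hc
      (fun p hp => gradSq_eq_zero_of_notMem_tsupport hp) t)
    ((integrable_slice_of_tsupport (contDiff_energyDensity hφ).continuous hc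
      (fun p hp => energyDensity_eq_zero_of_notMem_tsupport hp) t).const_mul _) fun x => ?_
  simp only [energyDensity]
  nlinarith [sq_nonneg (dT φ (t, x))]

/-- The full density integrates to twice the energy plus the Hardy term, and the latter is at most
`4 · 2` times the energy; hence the factor `10`. -/
lemma integral_fullDensity_le (hn : 3 ≤ n) (hφ : ContDiff ℝ 2 φ) (hc : HasCompactSupport φ)
    (hφT : ∀ x, (T, x) ∉ tsupport φ) {t : ℝ} (ht : t ∈ Icc 0 T) :
    ∫ x, fullDensity φ (t, x) ≤ 10 * sourcePairing T φ := by
  have h1 := integral_energyDensity_le_sourcePairing hφ hc hφT ht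
  have h2 := integral_gradSq_le_energy hφ hc t
  have h3 := integral_div_bracket_sq_le hn hφ hc t
  have i1 := integrable_slice_of_tsupport (contDiff_energyDensity hφ).continuous hc
    (fun p hp => energyDensity_eq_zero_of_notMem_tsupport hp) t
  have i2 : Integrable fun x => (φ (t, x) / bracket x) ^ 2 :=
    integrable_slice_of_tsupport (f := fun p => (φ p / bracket p.2) ^ 2)
      ((hφ.continuous.div (continuous_bracket.comp continuous_snd)
        fun p => (bracket_pos p.2).ne').pow 2) hc
      (fun p hp => by simp [image_eq_zero_of_notMem_tsupport hp]) t
  have h4 : ∫ x, fullDensity φ (t, x)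
      = 2 * (∫ x, energyDensity φ (t, x)) + ∫ x, (φ (t, x) / bracket x) ^ 2 := by
    rw [← integral_const_mul, ← integral_add (i1.const_mul _) i2]
    congr 1 with x
    simp only [fullDensity, energyDensity]; ring
  linarith

lemma setIntegral_fullDensity_le (hn : 3 ≤ n) (hφ : ContDiff ℝ 2 φ) (hc : HasCompactSupport φ)
    (hT : 0 ≤ T) (hφT : ∀ x, (T, x) ∉ tsupport φ) :
    ∫ p in slab n 0 T, fullDensity φ p ≤ T * (10 * sourcePairing T φ) := by
  have hi : IntegrableOn (fullDensity φ) (slab n 0 T) :=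
    integrableOn_of_tsupport (continuous_fullDensity (hφ.of_le (by norm_num))) hc
      fun p hp => fullDensity_eq_zero_of_notMem_tsupport hp
  rw [setIntegral_slab hi]
  have hi' : IntegrableOn (fun t => ∫ x, fullDensity φ (t, x)) (Icc 0 T) := by
    unfold IntegrableOn at hi ⊢
    rw [restrict_slab] at hi
    exact hi.integral_prod_left
  calc ∫ t in Icc 0 T, ∫ x, fullDensity φ (t, x)
      ≤ ∫ t in Icc 0 T, 10 * sourcePairing T φ :=
        setIntegral_mono_on hi' continuous_const.integrableOn_Icc measurableSet_Icc fun t ht =>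
          integral_fullDensity_le hn hφ hc hφT ht
    _ = T * (10 * sourcePairing T φ) := by simp [hT]

/-- On the shell `R ≤ ⟨x⟩ ≤ 2R` the radial weight is at least `1/(2⟨x⟩)` and `R² ≥ ⟨x⟩²/4`. The
losses `4` from `R²`, `8` from the cubed weight and `4` from the zeroth-order term multiply to
`128`. -/
lemma fullDensity_le_scaleDensity (hR : 1 ≤ R) (h1 : R ≤ bracket p.2) (h2 : bracket p.2 ≤ 2 * R) :
    fullDensity φ p / bracket p.2 ≤ 128 * scaleDensity R φ p := by
  have hR0 : 0 < R := by linarith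
  have hw := radialWeight_sq_mul (p := p) hR0
  have hw0 := radialWeight_pos (p := p) hR0
  have hb := bracket_pos p.2
  have hb2 := bracket_sq p.2
  have hg := gradSq_nonneg φ p
  unfold fullDensity scaleDensity
  generalize bracket p.2 = b at *
  have hwb : (2 * b)⁻¹ ≤ radialWeight R p := by
    refine le_of_sq_le_sq ?_ hw0.le
    rw [eq_inv_of_mul_eq_one_left hw, inv_pow]
    refine inv_anti₀ (by positivity) ?_
    nlinarith
  have hwb2 : (2 * b)⁻¹ ^ 2 ≤ radialWeight R p ^ 2 := by gcongr
  have hwb3 : (2 * b)⁻¹ ^ 3 ≤ radialWeight R p ^ 3 := by gcongr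
  have hRb : b ^ 2 / 4 ≤ R ^ 2 := by nlinarith
  have e1 : b ^ 2 / 4 * (2 * b)⁻¹ ^ 3 = 1 / (32 * b) := by field_simp; norm_num
  have e2 : (2 * b)⁻¹ ^ 2 * φ p ^ 2 = (φ p / b) ^ 2 / 4 := by field_simp; ring
  calc (dT φ p ^ 2 + gradSq φ p + (φ p / b) ^ 2) / b
      = 128 * (1 / (32 * b) * ((dT φ p ^ 2 + gradSq φ p + (φ p / b) ^ 2) / 4)) := by
        field_simp; ring
    _ ≤ 128 * (1 / (32 * b) * (dT φ p ^ 2 + gradSq φ p + (φ p / b) ^ 2 / 4)) := by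
        gcongr; nlinarith [sq_nonneg (dT φ p)]
    _ = 128 * (b ^ 2 / 4 * (2 * b)⁻¹ ^ 3
          * (dT φ p ^ 2 + gradSq φ p + (2 * b)⁻¹ ^ 2 * φ p ^ 2)) := by rw [e1, e2]
    _ ≤ 128 * (R ^ 2 * radialWeight R p ^ 3
          * (dT φ p ^ 2 + gradSq φ p + radialWeight R p ^ 2 * φ p ^ 2)) := by gcongr

/-- The dyadic decomposition of the weighted density. -/
lemma rpow_mul_fullDensity_le_sum {θ : ℝ} (hθ : 0 ≤ θ) {K : ℕ} (hK : bracket p.2 < 2 ^ K) :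
    bracket p.2 ^ (-1 - θ) * fullDensity φ p
      ≤ ∑ k ∈ Finset.range K, 128 * ((2 : ℝ) ^ k) ^ (-θ) * scaleDensity (2 ^ k) φ p := by
  have hb := bracket_pos p.2
  obtain ⟨k, hk1, hk2⟩ := exists_nat_pow_near (one_le_bracket p.2) (one_lt_two (α := ℝ))
  have hkK : k < K := by
    by_contra h
    have : (2 : ℝ) ^ K ≤ 2 ^ k := pow_le_pow_right₀ (by norm_num) (not_lt.mp h)
    linarith
  have h2k : (1 : ℝ) ≤ 2 ^ k := one_le_pow₀ (by norm_num)
  have h2k0 : (0 : ℝ) < 2 ^ k := by positivity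
  have hnn : ∀ i ∈ Finset.range K,
      0 ≤ 128 * ((2 : ℝ) ^ i) ^ (-θ) * scaleDensity (2 ^ i) φ p := fun i _ =>
    mul_nonneg (by positivity) (scaleDensity_nonneg (by positivity))
  refine le_trans ?_ (Finset.single_le_sum hnn (Finset.mem_range.mpr hkK))
  have h1 := fullDensity_le_scaleDensity (φ := φ) (p := p) h2k hk1 (by rw [pow_succ] at hk2; linarith)
  have h2 : bracket p.2 ^ (-θ) ≤ ((2 : ℝ) ^ k) ^ (-θ) :=
    Real.rpow_le_rpow_of_nonpos h2k0 hk1 (by linarith)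
  have h3 := fullDensity_nonneg (φ := φ) (p := p)
  calc bracket p.2 ^ (-1 - θ) * fullDensity φ p
      = bracket p.2 ^ (-θ) * (fullDensity φ p / bracket p.2) := by
        rw [sub_eq_add_neg, Real.rpow_add hb, Real.rpow_neg_one]; ring
    _ ≤ ((2 : ℝ) ^ k) ^ (-θ) * (128 * scaleDensity (2 ^ k) φ p) := by gcongr
    _ = _ := by ring

lemma integral_dyadic_sum_le (hn : 3 ≤ n) (hφ : ContDiff ℝ 2 φ) (hc : HasCompactSupport φ)
    (hT : 0 ≤ T) (hφT : ∀ x, (T, x) ∉ tsupport φ) (θ : ℝ) (K : ℕ) :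
    ∫ p in slab n 0 T, ∑ k ∈ Finset.range K,
        128 * ((2 : ℝ) ^ k) ^ (-θ) * scaleDensity (2 ^ k) φ p
      ≤ (256 * (n + 1) * ∑ k ∈ Finset.range K, ((2 : ℝ) ^ k) ^ (-θ)) * sourcePairing T φ := by
  have hφ1 : ContDiff ℝ 1 φ := hφ.of_le (by norm_num)
  rw [integral_finsetSum _ fun k _ => (integrableOn_of_tsupport (continuous_scaleDensity
    (by positivity) hφ1) hc fun p hp => scaleDensity_eq_zero_of_notMem_tsupport hp).const_mul _,
    Finset.mul_sum, Finset.sum_mul]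
  refine Finset.sum_le_sum fun k _ => ?_
  rw [integral_const_mul]
  have h1 := setIntegral_scaleDensity_le hn (R := 2 ^ k) (one_le_pow₀ (by norm_num)) hφ hc hT hφT
  calc 128 * ((2 : ℝ) ^ k) ^ (-θ) * ∫ p in slab n 0 T, scaleDensity (2 ^ k) φ p
      ≤ 128 * ((2 : ℝ) ^ k) ^ (-θ) * (2 * (n + 1) * sourcePairing T φ) := by gcongr
    _ = _ := by ring

lemma integrableOn_dyadic_sum (hφ : ContDiff ℝ 2 φ) (hc : HasCompactSupport φ) (θ : ℝ) (K : ℕ)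
    {s : Set (ST n)} : IntegrableOn (fun p => ∑ k ∈ Finset.range K,
        128 * ((2 : ℝ) ^ k) ^ (-θ) * scaleDensity (2 ^ k) φ p) s :=
  integrable_finsetSum _ fun k _ => (integrableOn_of_tsupport (continuous_scaleDensity
    (by positivity) (hφ.of_le (by norm_num))) hc
      fun p hp => scaleDensity_eq_zero_of_notMem_tsupport hp).const_mul _

lemma sum_two_pow_rpow_le {θ : ℝ} (hθ : 0 < θ) (K : ℕ) :
    ∑ k ∈ Finset.range K, ((2 : ℝ) ^ k) ^ (-θ) ≤ (1 - (2 : ℝ) ^ (-θ))⁻¹ := by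
  have h1 : ∀ k : ℕ, ((2 : ℝ) ^ k) ^ (-θ) = ((2 : ℝ) ^ (-θ)) ^ k := fun k => by
    rw [← Real.rpow_natCast, ← Real.rpow_natCast, ← Real.rpow_mul (by norm_num),
      ← Real.rpow_mul (by norm_num), mul_comm]
  simp only [h1]
  have h2 : (2 : ℝ) ^ (-θ) < 1 := Real.rpow_lt_one_of_one_lt_of_neg (by norm_num) (by linarith)
  have h3 : (0 : ℝ) < (2 : ℝ) ^ (-θ) := by positivity
  rw [← tsum_geometric_of_lt_one h3.le h2]
  exact (summable_geometric_of_lt_one h3.le h2).sum_le_tsum _ fun i _ => by positivity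

/-- The number `K` of shells meeting the support depends on `φ`, but the geometric series bounds the
sum independently of `K`; this needs `θ > 0`. -/
lemma setIntegral_rpow_mul_fullDensity_le (hn : 3 ≤ n) {θ : ℝ} (hθ : 0 < θ)
    (hφ : ContDiff ℝ 2 φ) (hc : HasCompactSupport φ) (hT : 0 ≤ T)
    (hφT : ∀ x, (T, x) ∉ tsupport φ) :
    ∫ p in slab n 0 T, bracket p.2 ^ (-1 - θ) * fullDensity φ p
      ≤ (256 * (n + 1) * (1 - (2 : ℝ) ^ (-θ))⁻¹) * sourcePairing T φ := by
  have hφ1 : ContDiff ℝ 1 φ := hφ.of_le (by norm_num)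
  obtain ⟨B, hB⟩ := hc.isCompact.bddAbove_image
    (f := fun p : ST n => bracket p.2) (continuous_bracket.comp continuous_snd).continuousOn
  obtain ⟨K, hK⟩ := pow_unbounded_of_one_lt B (one_lt_two (α := ℝ))
  have h1 : ∫ p in slab n 0 T, bracket p.2 ^ (-1 - θ) * fullDensity φ p
      ≤ ∫ p in slab n 0 T, ∑ k ∈ Finset.range K,
        128 * ((2 : ℝ) ^ k) ^ (-θ) * scaleDensity (2 ^ k) φ p := by
    refine integral_mono ?_ (integrableOn_dyadic_sum hφ hc θ K) fun p => ?_
    · exact integrableOn_of_tsupport (((continuous_bracket_rpow _).comp continuous_snd).mul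
        (continuous_fullDensity hφ1)) hc
        fun p hp => by simp [fullDensity_eq_zero_of_notMem_tsupport hp]
    · by_cases hp : p ∈ tsupport φ
      · exact rpow_mul_fullDensity_le_sum hθ.le ((hB (mem_image_of_mem _ hp)).trans_lt hK)
      · change bracket p.2 ^ (-1 - θ) * fullDensity φ p ≤ _
        rw [fullDensity_eq_zero_of_notMem_tsupport hp, mul_zero]
        exact Finset.sum_nonneg fun k _ => mul_nonneg (by positivity)
          (scaleDensity_nonneg (by positivity))
  refine (h1.trans (integral_dyadic_sum_le hn hφ hc hT hφT θ K)).trans ?_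
  gcongr
  · exact sourcePairing_nonneg
  · exact sum_two_pow_rpow_le hθ K

/-- In the borderline case `θ = 0` every shell contributes equally, so only shells up to `⟨x⟩ ~ 2^K`
are summed. Beyond, `⟨x⟩⁻¹ ≤ T⁻¹`, and `T⁻¹` is compensated by integrating the energy bound over
`[0, T]`. With `2^K` comparable to `2 + T` this produces the logarithm. -/
lemma setIntegral_inv_mul_fullDensity_le (hn : 3 ≤ n) (hφ : ContDiff ℝ 2 φ)
    (hc : HasCompactSupport φ) (hT : 0 < T) (hφT : ∀ x, (T, x) ∉ tsupport φ) {K : ℕ}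
    (hK : T ≤ 2 ^ K) :
    ∫ p in slab n 0 T, bracket p.2 ^ (-1 : ℝ) * fullDensity φ p
      ≤ (256 * (n + 1) * K + 10) * sourcePairing T φ := by
  have hφ1 : ContDiff ℝ 1 φ := hφ.of_le (by norm_num)
  have hX := sourcePairing_nonneg (T := T) (φ := φ)
  have iq : IntegrableOn (fullDensity φ) (slab n 0 T) :=
    integrableOn_of_tsupport (continuous_fullDensity hφ1) hc
      fun p hp => fullDensity_eq_zero_of_notMem_tsupport hp
  have h1 : ∫ p in slab n 0 T, bracket p.2 ^ (-1 : ℝ) * fullDensity φ p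
      ≤ ∫ p in slab n 0 T, ((∑ k ∈ Finset.range K,
        128 * ((2 : ℝ) ^ k) ^ (-(0 : ℝ)) * scaleDensity (2 ^ k) φ p)
        + T⁻¹ * fullDensity φ p) := by
    refine integral_mono ?_ ((integrableOn_dyadic_sum hφ hc 0 K).add (iq.const_mul _)) fun p => ?_
    · exact integrableOn_of_tsupport (((continuous_bracket_rpow _).comp continuous_snd).mul
        (continuous_fullDensity hφ1)) hc
        fun p hp => by simp [fullDensity_eq_zero_of_notMem_tsupport hp]
    · have hq := fullDensity_nonneg (φ := φ) (p := p)
      rcases lt_or_ge (bracket p.2) (2 ^ K) with h | h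
      · have := rpow_mul_fullDensity_le_sum (φ := φ) le_rfl h
        rw [sub_zero] at this
        exact this.trans (le_add_of_nonneg_right (by positivity))
      · refine le_trans ?_ (le_add_of_nonneg_left (Finset.sum_nonneg fun k _ =>
          mul_nonneg (by positivity) (scaleDensity_nonneg (by positivity))))
        rw [Real.rpow_neg_one]
        gcongr
        exact hK.trans h
  rw [integral_add (integrableOn_dyadic_sum hφ hc 0 K) (iq.const_mul _), integral_const_mul] at h1
  have h2 := integral_dyadic_sum_le hn hφ hc hT.le hφT 0 K
  have h3 := setIntegral_fullDensity_le hn hφ hc hT.le hφT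
  have h4 : T⁻¹ * ∫ p in slab n 0 T, fullDensity φ p ≤ 10 * sourcePairing T φ := by
    rw [inv_mul_le_iff₀ hT]; exact h3
  simp only [neg_zero, Real.rpow_zero, Finset.sum_const, Finset.card_range, nsmul_eq_mul,
    mul_one] at h1 h2
  linarith

/-- Absorption: a weighted bound of the density by the source pairing gives an estimate of the
energy by a weighted norm of the source. -/
lemma integral_gradSq_le_of_weight {a : ST n → ℝ} (ha : Continuous a) (ha0 : ∀ p, 0 < a p)
    {Λ : ℝ} (hΛ : 0 < Λ) (hφ : ContDiff ℝ 2 φ) (hc : HasCompactSupport φ)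
    (d : ST n → ℝ) (hd : Continuous d)
    (hd1 : ∀ t ∈ Icc 0 T, ∫ x, energyDensity φ (t, x) ≤ ∫ p in slab n 0 T, |box φ p| * |d p|)
    (hd0 : ∀ p ∉ tsupport φ, d p = 0)
    (h : ∫ p in slab n 0 T, a p * d p ^ 2 ≤ Λ * ∫ p in slab n 0 T, |box φ p| * |d p|)
    {t : ℝ} (ht : t ∈ Icc 0 T) :
    ∫ x, gradSq φ (t, x) ≤ 2 * Λ * ∫ p in slab n 0 T, (a p)⁻¹ * box φ p ^ 2 := by
  have i1 : IntegrableOn (fun p => a p * d p ^ 2) (slab n 0 T) :=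
    integrableOn_of_tsupport (ha.mul (hd.pow 2)) hc fun p hp => by simp [hd0 p hp]
  have i2 : IntegrableOn (fun p => (a p)⁻¹ * box φ p ^ 2) (slab n 0 T) :=
    integrableOn_of_tsupport ((ha.inv₀ fun p => (ha0 p).ne').mul ((continuous_box hφ).pow 2)) hc
      fun p hp => by simp [box_eq_zero_of_notMem_tsupport hφ hp]
  have i3 : IntegrableOn (fun p => |box φ p| * |d p|) (slab n 0 T) :=
    integrableOn_of_tsupport ((continuous_box hφ).abs.mul hd.abs) hc
      fun p hp => by simp [hd0 p hp]
  -- Young's inequality, weighted so that `h` turns the first term into half of the left-hand side.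
  -- Absorbing it bounds the pairing by `Λ ∫ a⁻¹ (box φ)²`; the factor `2` in the conclusion relates
  -- the gradient to the energy.
  have h1 : ∫ p in slab n 0 T, |box φ p| * |d p|
      ≤ ∫ p in slab n 0 T, (1 / (2 * Λ) * (a p * d p ^ 2)
        + Λ / 2 * ((a p)⁻¹ * box φ p ^ 2)) := by
    refine integral_mono i3 ((i1.const_mul _).add (i2.const_mul _)) fun p => ?_
    change |box φ p| * |d p| ≤ 1 / (2 * Λ) * (a p * d p ^ 2) + Λ / 2 * ((a p)⁻¹ * box φ p ^ 2)
    have hap := ha0 p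
    rw [← sq_abs (d p), ← sq_abs (box φ p)]
    have : 1 / (2 * Λ) * (a p * |d p| ^ 2) + Λ / 2 * ((a p)⁻¹ * |box φ p| ^ 2)
        - |box φ p| * |d p| = (a p * |d p| - Λ * |box φ p|) ^ 2 / (2 * Λ * a p) := by
      field_simp; ring
    have h2 : 0 ≤ (a p * |d p| - Λ * |box φ p|) ^ 2 / (2 * Λ * a p) := by positivity
    linarith
  rw [integral_add (i1.const_mul _) (i2.const_mul _), integral_const_mul,
    integral_const_mul] at h1
  have h2 : 1 / (2 * Λ) * ∫ p in slab n 0 T, a p * d p ^ 2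
      ≤ 1 / 2 * ∫ p in slab n 0 T, |box φ p| * |d p| := by
    calc 1 / (2 * Λ) * ∫ p in slab n 0 T, a p * d p ^ 2
        ≤ 1 / (2 * Λ) * (Λ * ∫ p in slab n 0 T, |box φ p| * |d p|) := by gcongr
      _ = _ := by field_simp
  have h3 := hd1 t ht
  have h4 := integral_gradSq_le_energy hφ hc t
  linarith

/-- The dual weighted estimate: `Λ` is admissible for the weight `a` on `[0, T] × ℝⁿ`. -/
def DualEstimate {n : ℕ} (T : ℝ) (a : ST n → ℝ) (Λ : ℝ) : Prop :=
  ∀ φ : ST n → ℝ, ContDiff ℝ 2 φ → HasCompactSupport φ → (∀ x, (T, x) ∉ tsupport φ) →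
    ∀ t ∈ Icc 0 T, ∫ x, gradSq φ (t, x)
      ≤ Λ * ∫ p in slab n 0 T, (a p)⁻¹ * box φ p ^ 2

lemma dualEstimate_of_fullDensity {a : ST n → ℝ} (ha : Continuous a) (ha0 : ∀ p, 0 < a p)
    {Λ : ℝ} (hΛ : 0 < Λ) (h : ∀ φ : ST n → ℝ, ContDiff ℝ 2 φ → HasCompactSupport φ →
      (∀ x, (T, x) ∉ tsupport φ) →
      ∫ p in slab n 0 T, a p * fullDensity φ p ≤ Λ * sourcePairing T φ) :
    DualEstimate T a (2 * Λ) := by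
  intro φ hφ hc hφT t ht
  have e1 : ∀ p, |√(fullDensity φ p)| = √(fullDensity φ p) := fun p =>
    abs_of_nonneg (Real.sqrt_nonneg _)
  refine integral_gradSq_le_of_weight ha ha0 hΛ hφ hc (fun p => √(fullDensity φ p))
    (continuous_fullDensity (hφ.of_le (by norm_num))).sqrt ?_ ?_ ?_ ht
  · intro t ht
    simp only [e1]
    exact integral_energyDensity_le_sourcePairing hφ hc hφT ht
  · intro p hp
    simp [fullDensity_eq_zero_of_notMem_tsupport hp]
  · simp only [e1, Real.sq_sqrt fullDensity_nonneg]
    exact h φ hφ hc hφT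

lemma dualEstimate_rpow (hn : 3 ≤ n) {θ : ℝ} (hθ : 0 < θ) (hT : 0 ≤ T) :
    DualEstimate T (fun p : ST n => bracket p.2 ^ (-1 - θ))
      (2 * (256 * (n + 1) * (1 - (2 : ℝ) ^ (-θ))⁻¹)) := by
  have h2 : (2 : ℝ) ^ (-θ) < 1 := Real.rpow_lt_one_of_one_lt_of_neg (by norm_num) (by linarith)
  refine dualEstimate_of_fullDensity ((continuous_bracket_rpow _).comp continuous_snd)
    (fun p => Real.rpow_pos_of_pos (bracket_pos _) _) ?_ fun φ hφ hc hφT =>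
    setIntegral_rpow_mul_fullDensity_le hn hθ hφ hc hT hφT
  have : 0 < 1 - (2 : ℝ) ^ (-θ) := by linarith
  positivity

lemma dualEstimate_inv (hn : 3 ≤ n) (hT : 0 < T) :
    DualEstimate T (fun p : ST n => bracket p.2 ^ (-1 : ℝ))
      (2 * ((256 * (n + 1) * 4 + 20) * Real.log (2 + T))) := by
  have hlog2 : 1 / 2 < Real.log 2 := by have := Real.log_two_gt_d9; linarith
  have hlogT : Real.log 2 ≤ Real.log (2 + T) := Real.log_le_log (by norm_num) (by linarith)
  refine dualEstimate_of_fullDensity ((continuous_bracket_rpow _).comp continuous_snd)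
    (fun p => Real.rpow_pos_of_pos (bracket_pos _) _) ?_ fun φ hφ hc hφT => ?_
  · have : 0 < Real.log (2 + T) := by linarith
    positivity
  -- Here `2^k ≤ 2 + T < 2^(k+1)`, so `K = k + 1` is admissible. As `log 2 > 1/2`, both `k` and `1`
  -- are at most `2 log(2+T)`, whence `k + 1 ≤ 4 log(2+T)` and `10 ≤ 20 log(2+T)`.
  · obtain ⟨k, hk1, hk2⟩ := exists_nat_pow_near (x := 2 + T) (y := 2) (by linarith) (by norm_num)
    have hk : (k : ℝ) * Real.log 2 ≤ Real.log (2 + T) := by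
      rw [← Real.log_pow]; exact Real.log_le_log (by positivity) hk1
    refine (setIntegral_inv_mul_fullDensity_le hn hφ hc hT hφT (K := k + 1)
      (by linarith)).trans ?_
    refine mul_le_mul_of_nonneg_right ?_ sourcePairing_nonneg
    have hk' : (k : ℝ) ≤ 2 * Real.log (2 + T) := by nlinarith [Nat.cast_nonneg (α := ℝ) k]
    have h1 : 1 ≤ 2 * Real.log (2 + T) := by linarith
    push_cast
    have hn0 : (0 : ℝ) ≤ n := Nat.cast_nonneg n
    nlinarith

/-- The energy inequality alone suffices: the weight depends on time only, and its integral over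
`[0, T]` is at most `ε`. The weight is at least `1/e` on `[T-ε, T]`, so the gain of `ε` measures the
solution on a thin slab before `T`. -/
lemma dualEstimate_exp {ε : ℝ} (hε : 0 < ε) (hT : 0 < T) :
    DualEstimate T (fun p : ST n => Real.exp ((p.1 - T) / ε)) (4 * ε) := by
  intro φ hφ hc hφT t ht
  have hφ1 : ContDiff ℝ 1 φ := hφ.of_le (by norm_num)
  have hexp : Continuous fun p : ST n => Real.exp ((p.1 - T) / ε) := by fun_prop
  have := integral_gradSq_le_of_weight (a := fun p : ST n => Real.exp ((p.1 - T) / ε)) hexp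
    (fun p => Real.exp_pos _) (Λ := 2 * ε) (by positivity)
    hφ hc (dT φ) (continuous_pd hφ1 _) (fun t ht => integral_energyDensity_le hφ hc hφT ht)
    (fun p hp => pd_eq_zero_of_notMem_tsupport hp) ?_ ht
  · refine this.trans (le_of_eq ?_); ring
  set Y := ∫ p in slab n 0 T, |box φ p| * |dT φ p| with hY
  have hi : IntegrableOn (fun p => Real.exp ((p.1 - T) / ε) * dT φ p ^ 2) (slab n 0 T) :=
    integrableOn_of_tsupport (hexp.mul ((continuous_pd hφ1 _).pow 2)) hc fun p hp => by
      simp [pd_eq_zero_of_notMem_tsupport hp]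
  rw [setIntegral_slab hi]
  have hi' : IntegrableOn (fun t => ∫ x, Real.exp ((t - T) / ε) * dT φ (t, x) ^ 2)
      (Icc 0 T) := by
    unfold IntegrableOn at hi ⊢
    rw [restrict_slab] at hi
    exact hi.integral_prod_left
  have hY0 : 0 ≤ Y := integral_nonneg fun p => by positivity
  have hslice : ∀ t ∈ Icc 0 T, ∫ x, Real.exp ((t - T) / ε) * dT φ (t, x) ^ 2
      ≤ Real.exp ((t - T) / ε) * (2 * Y) := by
    intro t ht
    rw [integral_const_mul]
    gcongr
    have h1 := integral_energyDensity_le hφ hc hφT ht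
    have h2 : ∫ x, dT φ (t, x) ^ 2 ≤ ∫ x, 2 * energyDensity φ (t, x) := by
      refine integral_mono (integrable_slice_of_tsupport (f := fun p => dT φ p ^ 2)
        ((continuous_pd hφ1 _).pow 2) hc
        (fun p hp => by simp [dT, pd_eq_zero_of_notMem_tsupport hp]) t)
        ((integrable_slice_of_tsupport (contDiff_energyDensity hφ).continuous hc
        (fun p hp => energyDensity_eq_zero_of_notMem_tsupport hp) t).const_mul _) fun x => ?_
      simp only [energyDensity]
      nlinarith [gradSq_nonneg φ (t, x)]
    rw [integral_const_mul] at h2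
    linarith
  have hcexp : Continuous fun t : ℝ => Real.exp ((t - T) / ε) := by fun_prop
  calc ∫ t in Icc 0 T, ∫ x, Real.exp ((t - T) / ε) * dT φ (t, x) ^ 2
      ≤ ∫ t in Icc 0 T, Real.exp ((t - T) / ε) * (2 * Y) :=
        setIntegral_mono_on hi' ((hcexp.mul continuous_const).integrableOn_Icc) measurableSet_Icc
          hslice
    _ = (∫ t in Icc 0 T, Real.exp ((t - T) / ε)) * (2 * Y) := integral_mul_const _ _
    _ ≤ ε * (2 * Y) := by
        gcongr
        rw [integral_Icc_eq_integral_Ioc, ← intervalIntegral.integral_of_le hT.le]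
        have hder : ∀ t ∈ uIcc 0 T, HasDerivAt (fun t => ε * Real.exp ((t - T) / ε))
            (Real.exp ((t - T) / ε)) t := fun t _ => by
          have := (((hasDerivAt_id t).sub_const T).div_const ε).exp.const_mul ε
          refine this.congr_deriv ?_
          simp only [id]; field_simp
        rw [intervalIntegral.integral_eq_sub_of_hasDerivAt hder (hcexp.intervalIntegrable _ _)]
        simp only [sub_self, zero_div, Real.exp_zero, mul_one]
        have : 0 < ε * Real.exp ((0 - T) / ε) := by positivity
        linarith
    _ = 2 * ε * Y := by ring

end DualEstimates

/-! ### Duality on time slices: polar coordinates, traces and Sobolev's inequality. -/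

section SliceDuality

open Metric

variable {n : ℕ}

lemma eLpNorm_two_sq {α F : Type*} [MeasurableSpace α] [NormedAddCommGroup F] (μ : Measure α)
    (f : α → F) : eLpNorm f 2 μ ^ 2 = ∫⁻ x, ‖f x‖ₑ ^ 2 ∂μ := by
  have := eLpNorm_nnreal_pow_eq_lintegral (f := f) (μ := μ) (p := 2) (by norm_num)
  simpa using this

lemma lintegral_enorm_mul_le {α : Type*} [MeasurableSpace α] {μ : Measure α} {f g : α → ℝ}
    (p q : ℝ≥0∞) [ENNReal.HolderTriple p q 1] (hf : AEStronglyMeasurable f μ)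
    (hg : AEStronglyMeasurable g μ) :
    ∫⁻ x, ‖f x‖ₑ * ‖g x‖ₑ ∂μ ≤ eLpNorm f p μ * eLpNorm g q μ := by
  have := eLpNorm_smul_le_mul_eLpNorm (p := p) (q := q) (r := 1) hg hf
  refine le_trans (le_of_eq ?_) this
  rw [eLpNorm_one_eq_lintegral_enorm]
  simp [enorm_mul]

lemma radialMeasure_eq_map (n : ℕ) : radialMeasure n
    = Measure.map ((↑) : Ioi (0 : ℝ) → ℝ) (Measure.volumeIoiPow (n - 1)) := by
  have hm : Measurable fun r : ℝ => ENNReal.ofReal (r ^ (n - 1)) := by fun_prop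
  ext s hs
  rw [radialMeasure, withDensity_apply _ hs, Measure.map_apply measurable_subtype_coe hs,
    Measure.volumeIoiPow, withDensity_apply _ (measurable_subtype_coe hs),
    ← map_comap_subtype_coe measurableSet_Ioi,
    setLIntegral_map hs hm measurable_subtype_coe]

/-- Polar coordinates preserve the measure. -/
lemma measurePreserving_polar (hn : 0 < n) :
    MeasurePreserving (fun z : sphere (0 : E n) 1 × ℝ => z.2 • (z.1 : E n))
      ((volume : Measure (E n)).toSphere.prod (radialMeasure n)) volume := by
  have : Nonempty (Fin n) := ⟨⟨0, hn⟩⟩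
  have h1 := ((volume : Measure (E n)).measurePreserving_homeomorphUnitSphereProd)
  rw [finrank_euclideanSpace, Fintype.card_fin] at h1
  have h2 : MeasurePreserving (homeomorphUnitSphereProd (E n)).symm
      ((volume : Measure (E n)).toSphere.prod (Measure.volumeIoiPow (n - 1)))
      (volume.comap ((↑) : ({0}ᶜ : Set (E n)) → E n)) :=
    h1.symm (homeomorphUnitSphereProd (E n)).toMeasurableEquiv
  have h3 : MeasurePreserving ((↑) : ({0}ᶜ : Set (E n)) → E n)
      (volume.comap ((↑) : ({0}ᶜ : Set (E n)) → E n)) volume := by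
    refine ⟨measurable_subtype_coe, ?_⟩
    rw [map_comap_subtype_coe (measurableSet_singleton _).compl]
    exact Measure.restrict_eq_self_of_ae_mem (compl_mem_ae_iff.mpr (measure_singleton _))
  have h4 := h3.comp h2
  have hmeas : Measurable fun z : sphere (0 : E n) 1 × ℝ => z.2 • (z.1 : E n) := by fun_prop
  refine ⟨hmeas, ?_⟩
  rw [radialMeasure_eq_map n]
  conv_lhs => rw [← Measure.map_id (μ := (volume : Measure (E n)).toSphere)]
  rw [Measure.map_prod_map _ _ measurable_id measurable_subtype_coe,
    Measure.map_map hmeas (measurable_id.prodMap measurable_subtype_coe)]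
  refine Eq.trans ?_ h4.map_eq
  congr 1

instance : SFinite (radialMeasure n) := by unfold radialMeasure; infer_instance

lemma radialMeasure_ae_pos : ∀ᵐ r ∂radialMeasure n, 0 < r := by
  have h : radialMeasure n ≪ volume.restrict (Ioi 0) := withDensity_absolutelyContinuous _ _
  exact h.ae_le (ae_restrict_mem measurableSet_Ioi)

/-- A one-dimensional weighted trace inequality. -/
lemma pow_mul_sq_le_integral {f f' : ℝ → ℝ} {m : ℕ} (hm : 1 ≤ m) {r b : ℝ} (hr : 0 < r)
    (hrb : r ≤ b) (hf : ∀ s, HasDerivAt f (f' s) s) (hf' : Continuous f') (hb : f b = 0) :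
    r ^ m * f r ^ 2 ≤ ∫ s in r..b, s ^ (m + 1) * f' s ^ 2 := by
  obtain ⟨k, rfl⟩ : ∃ k, m = k + 1 := ⟨m - 1, by omega⟩
  have hfc : Continuous f := continuous_iff_continuousAt.mpr fun s => (hf s).continuousAt
  have hder : ∀ s ∈ uIcc r b, HasDerivAt (fun s => s ^ (k + 1) * f s ^ 2)
      (((k + 1 : ℕ) : ℝ) * s ^ k * f s ^ 2 + s ^ (k + 1) * (2 * f s * f' s)) s := fun s _ => by
    have := (hasDerivAt_pow (k + 1) s).mul ((hf s).pow 2)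
    refine this.congr_deriv ?_
    simp
  have hcont : Continuous fun s =>
      ((k + 1 : ℕ) : ℝ) * s ^ k * f s ^ 2 + s ^ (k + 1) * (2 * f s * f' s) := by fun_prop
  have h1 := intervalIntegral.integral_eq_sub_of_hasDerivAt hder (hcont.intervalIntegrable _ _)
  rw [hb] at h1
  have h2 : ∫ s in r..b, -(((k + 1 : ℕ) : ℝ) * s ^ k * f s ^ 2 + s ^ (k + 1) * (2 * f s * f' s))
      ≤ ∫ s in r..b, s ^ (k + 1 + 1) * f' s ^ 2 := by
    refine intervalIntegral.integral_mono_on hrb (hcont.neg.intervalIntegrable _ _)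
      (Continuous.intervalIntegrable (by fun_prop) _ _) fun s hs => ?_
    have hs0 : 0 ≤ s ^ k := pow_nonneg (hr.le.trans hs.1) k
    -- This nonnegative expression equals `(s^(k+1) f²)' + s^(k+2) f'²`, the difference of the two
    -- integrands.
    have h3 : 0 ≤ s ^ k * (f s + s * f' s) ^ 2 + k * (s ^ k * f s ^ 2) := by positivity
    push_cast
    have h4 : s ^ (k + 1 + 1) = s ^ k * s ^ 2 := by ring
    have h5 : s ^ (k + 1) = s ^ k * s := by ring
    rw [h4, h5]
    nlinarith
  rw [intervalIntegral.integral_neg, h1] at h2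
  linarith

/-- The one-dimensional inequality with `m = n - 2` puts the weight `s^(n-1)` on the derivative,
which is exactly the density of the radial measure. The endpoint `b` lies beyond the support of `g`.
-/
lemma ray_trace_le (hn : 3 ≤ n) {g : E n → ℝ} (hg : ContDiff ℝ 1 g) (hc : HasCompactSupport g)
    {r : ℝ} (hr : 0 < r) (θ : sphere (0 : E n) 1) :
    ENNReal.ofReal (r ^ (n - 2)) * ‖g (r • (θ : E n))‖ₑ ^ 2
      ≤ ∫⁻ s, ‖fderiv ℝ g (s • (θ : E n))‖ₑ ^ 2 ∂radialMeasure n := by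
  have hθ : ‖(θ : E n)‖ = 1 := by simp
  obtain ⟨B, hB⟩ := hc.isCompact.isBounded.exists_norm_le
  set b := max r (B + 1) with hb
  have hgb : g (b • (θ : E n)) = 0 := by
    by_contra h
    have h1 := hB _ (subset_tsupport g h)
    rw [norm_smul, hθ, mul_one, Real.norm_eq_abs] at h1
    have := le_abs_self b
    have := le_max_right r (B + 1)
    linarith
  have hder : ∀ s, HasDerivAt (fun s : ℝ => g (s • (θ : E n)))
      (fderiv ℝ g (s • (θ : E n)) θ) s := fun s => by
    have h1 : HasDerivAt (fun s : ℝ => s • (θ : E n)) ((1 : ℝ) • (θ : E n)) s :=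
      (hasDerivAt_id s).smul_const _
    rw [one_smul] at h1
    exact (hg.differentiable (by norm_num) _).hasFDerivAt.comp_hasDerivAt s h1
  have hfc : Continuous (fderiv ℝ g) := hg.continuous_fderiv (by norm_num)
  have hcont : Continuous fun s : ℝ => fderiv ℝ g (s • (θ : E n)) θ := by fun_prop
  have key := pow_mul_sq_le_integral (m := n - 2) (by omega) hr (le_max_left r (B + 1)) hder hcont
    hgb
  rw [show n - 2 + 1 = n - 1 by omega] at key
  have hpt : ∀ s : ℝ, (fderiv ℝ g (s • (θ : E n)) θ) ^ 2 ≤ ‖fderiv ℝ g (s • (θ : E n))‖ ^ 2 := by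
    intro s
    rw [← sq_abs, ← Real.norm_eq_abs]
    have := (fderiv ℝ g (s • (θ : E n))).le_opNorm (θ : E n)
    rw [hθ, mul_one] at this
    gcongr
  have hm : Measurable fun r : ℝ => ENNReal.ofReal (r ^ (n - 1)) := by fun_prop
  rw [radialMeasure, lintegral_withDensity_eq_lintegral_mul _ hm (by fun_prop)]
  calc ENNReal.ofReal (r ^ (n - 2)) * ‖g (r • (θ : E n))‖ₑ ^ 2
      = ENNReal.ofReal (r ^ (n - 2) * g (r • (θ : E n)) ^ 2) := by
        rw [ENNReal.ofReal_mul (by positivity), ← sq_abs, ← Real.norm_eq_abs,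
          ENNReal.ofReal_pow (norm_nonneg _), ofReal_norm]
    _ ≤ ENNReal.ofReal (∫ s in r..b, s ^ (n - 1) * fderiv ℝ g (s • (θ : E n)) θ ^ 2) :=
        ENNReal.ofReal_le_ofReal key
    _ = ∫⁻ s in Ioc r b, ENNReal.ofReal (s ^ (n - 1) * fderiv ℝ g (s • (θ : E n)) θ ^ 2) := by
        rw [intervalIntegral.integral_of_le (le_max_left _ _), ofReal_integral_eq_lintegral_ofReal]
        · exact (Continuous.integrableOn_Icc (by fun_prop)).mono_set Ioc_subset_Icc_self
        · filter_upwards [ae_restrict_mem measurableSet_Ioc] with s hs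
          have : 0 < s := hr.trans hs.1
          positivity
    _ ≤ ∫⁻ s in Ioc r b, ENNReal.ofReal (s ^ (n - 1)) * ‖fderiv ℝ g (s • (θ : E n))‖ₑ ^ 2 := by
        refine setLIntegral_mono' measurableSet_Ioc fun s hs => ?_
        have : 0 < s := hr.trans hs.1
        rw [ENNReal.ofReal_mul (by positivity), ← ofReal_norm,
          ← ENNReal.ofReal_pow (norm_nonneg _)]
        exact mul_le_mul_right (ENNReal.ofReal_le_ofReal (hpt s)) _
    _ ≤ ∫⁻ s in Ioi 0, ENNReal.ofReal (s ^ (n - 1)) * ‖fderiv ℝ g (s • (θ : E n))‖ₑ ^ 2 :=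
        lintegral_mono_set fun s hs => hr.trans hs.1
    _ = _ := by simp

/-- Integration of `ray_trace_le` over the sphere turns its right-hand side into the full Dirichlet
integral in polar coordinates. This `L^∞_r L²_ω` bound is dual to the `L¹_r L²_ω` norm of the
source. -/
lemma sphere_trace_le (hn : 3 ≤ n) {g : E n → ℝ} (hg : ContDiff ℝ 1 g)
    (hc : HasCompactSupport g) {r : ℝ} (hr : 0 < r) :
    eLpNorm (fun θ : sphere (0 : E n) 1 => r ^ (((n : ℝ) - 2) / 2) * g (r • (θ : E n))) 2
      (volume : Measure (E n)).toSphere ≤ eLpNorm (fderiv ℝ g) 2 volume := by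
  have hfc : Continuous (fderiv ℝ g) := hg.continuous_fderiv (by norm_num)
  rw [← ENNReal.pow_le_pow_left_iff two_ne_zero, eLpNorm_two_sq, eLpNorm_two_sq]
  have hmp := measurePreserving_polar (n := n) (by omega)
  have hm : Measurable fun x => ‖fderiv ℝ g x‖ₑ ^ 2 := by fun_prop
  rw [← hmp.lintegral_comp hm, lintegral_prod _ (by exact (hm.comp hmp.measurable).aemeasurable)]
  refine lintegral_mono fun θ => ?_
  refine le_trans (le_of_eq ?_) (ray_trace_le hn hg hc hr θ)
  rw [enorm_mul, mul_pow, ← ofReal_norm (r ^ (((n : ℝ) - 2) / 2)),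
    Real.norm_of_nonneg (by positivity), ← ENNReal.ofReal_pow (by positivity),
    ← Real.rpow_natCast (r ^ _), ← Real.rpow_mul hr.le]
  congr 2
  rw [← Real.rpow_natCast]
  congr 1
  rw [Nat.cast_sub (by omega)]
  push_cast; ring

/-- Duality in the exterior of the unit ball. -/
lemma lintegral_exterior_le (hn : 3 ≤ n) {F g : E n → ℝ} (hF : AEStronglyMeasurable F volume)
    (hg : ContDiff ℝ 1 g) (hc : HasCompactSupport g) :
    ∫⁻ x in {x : E n | 1 < ‖x‖}, ‖F x‖ₑ * ‖g x‖ₑ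
      ≤ mixedNormOn 1 2 {x : E n | 1 < ‖x‖} (fun x => (‖x‖ ^ (-(((n : ℝ) - 2) / 2))) • F x)
        * eLpNorm (fderiv ℝ g) 2 volume := by
  set A : Set (E n) := {x : E n | 1 < ‖x‖} with hA
  have hAm : MeasurableSet A := measurableSet_lt measurable_const measurable_norm
  set s : ℝ := ((n : ℝ) - 2) / 2
  set h : E n → ℝ := A.indicator (fun x => (‖x‖ ^ (-s)) • F x) with hh
  have hhm : AEStronglyMeasurable h volume := by
    refine AEStronglyMeasurable.indicator ?_ hAm
    have hnm : Measurable fun x : E n => ‖x‖ ^ (-s) := by fun_prop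
    exact hnm.aestronglyMeasurable.smul hF
  have hmp := measurePreserving_polar (n := n) (by omega)
  -- The weight `|x|^{-s}` is shifted onto `F` and its inverse onto `g`, with `s = (n-2)/2`; Hölder
  -- on each sphere then meets the trace inequality for `g`.
  have hpt : ∀ x : E n, A.indicator (fun x => ‖F x‖ₑ * ‖g x‖ₑ) x = ‖h x‖ₑ * ‖‖x‖ ^ s * g x‖ₑ := by
    intro x
    by_cases hx : x ∈ A
    · have hx0 : 0 < ‖x‖ := one_pos.trans hx
      rw [hh, indicator_of_mem hx, indicator_of_mem hx, smul_eq_mul, ← enorm_mul, ← enorm_mul]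
      congr 1
      rw [Real.rpow_neg hx0.le]
      field_simp
    · simp [hh, hx]
  have hGm : Measurable fun x : E n => ‖‖x‖ ^ s * g x‖ₑ := by
    have := hg.continuous.measurable
    fun_prop
  have hprod : AEStronglyMeasurable (fun z : sphere (0 : E n) 1 × ℝ => h (z.2 • (z.1 : E n)))
      ((volume : Measure (E n)).toSphere.prod (radialMeasure n)) :=
    hhm.comp_measurePreserving hmp
  rw [← lintegral_indicator hAm, lintegral_congr hpt]
  have e1 : ∫⁻ x, ‖h x‖ₑ * ‖‖x‖ ^ s * g x‖ₑ
      = ∫⁻ z : sphere (0 : E n) 1 × ℝ, ‖h (z.2 • (z.1 : E n))‖ₑ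
        * ‖‖z.2 • (z.1 : E n)‖ ^ s * g (z.2 • (z.1 : E n))‖ₑ
        ∂((volume : Measure (E n)).toSphere.prod (radialMeasure n)) := by
    conv_lhs => rw [← hmp.map_eq]
    rw [lintegral_map' _ hmp.measurable.aemeasurable]
    rw [hmp.map_eq]
    exact hhm.enorm.mul hGm.aemeasurable
  rw [e1, lintegral_prod_symm _
    (by exact hprod.enorm.mul (hGm.comp hmp.measurable).aemeasurable)]
  have hslice : ∀ᵐ r ∂radialMeasure n,
      AEStronglyMeasurable (fun θ : sphere (0 : E n) 1 => h (r • (θ : E n)))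
        (volume : Measure (E n)).toSphere := hprod.prod_swap.prodMk_left
  rw [mixedNormOn, mixedNorm, eLpNorm_one_eq_lintegral_enorm,
    ← lintegral_mul_const' _ _ ?_]
  · refine lintegral_mono_ae ?_
    filter_upwards [hslice, radialMeasure_ae_pos] with r hr hr0
    have e2 : ∀ θ : sphere (0 : E n) 1, ‖r • (θ : E n)‖ = r := fun θ => by
      rw [norm_smul]; simp [abs_of_pos hr0]
    simp only [e2]
    have hgm : Continuous fun θ : sphere (0 : E n) 1 => r ^ s * g (r • (θ : E n)) := by
      have := hg.continuous
      fun_prop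
    refine (lintegral_enorm_mul_le 2 2 hr hgm.aestronglyMeasurable).trans ?_
    rw [enorm_eq_self]
    gcongr
    exact sphere_trace_le hn hg hc hr0
  · have hfc : Continuous (fderiv ℝ g) := hg.continuous_fderiv (by norm_num)
    exact (hfc.memLp_of_hasCompactSupport (hc.fderiv (𝕜 := ℝ))).eLpNorm_ne_top

/-- Duality in the unit ball. -/
lemma lintegral_ball_le (hn : 3 ≤ n) {F g : E n → ℝ} (hF : AEStronglyMeasurable F volume)
    (hg : ContDiff ℝ 1 g) (hc : HasCompactSupport g) :
    ∫⁻ x in {x : E n | ‖x‖ < 1}, ‖F x‖ₑ * ‖g x‖ₑ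
      ≤ eLpNorm F (ENNReal.ofReal (2 * (n : ℝ) / ((n : ℝ) + 2)))
          (volume.restrict {x : E n | ‖x‖ < 1})
        * (SNormLESNormFDerivOfEqConst ℝ (volume : Measure (E n)) 2
          * eLpNorm (fderiv ℝ g) 2 volume) := by
  have hn' : (3 : ℝ) ≤ n := by exact_mod_cast hn
  -- The Sobolev exponent `2n/(n-2)` of the gradient in `L²`, conjugate to `2n/(n+2)`.
  set q : ℝ≥0 := (2 * (n : ℝ) / ((n : ℝ) - 2)).toNNReal with hq
  have hq0 : (0 : ℝ) ≤ 2 * (n : ℝ) / ((n : ℝ) - 2) :=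
    div_nonneg (by linarith) (by linarith)
  have hsob := eLpNorm_le_eLpNorm_fderiv_of_eq (volume : Measure (E n)) hg hc (p := 2) (p' := q)
    (by norm_num) (by rw [finrank_euclideanSpace, Fintype.card_fin]; omega) (by
      rw [hq, Real.coe_toNNReal _ hq0, finrank_euclideanSpace, Fintype.card_fin]
      have : (n : ℝ) - 2 ≠ 0 := by linarith
      have : (n : ℝ) ≠ 0 := by linarith
      push_cast
      field_simp)
  have : ENNReal.HolderTriple (ENNReal.ofReal (2 * (n : ℝ) / ((n : ℝ) + 2))) q 1 := by
    refine ⟨?_⟩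
    have h2 : (0 : ℝ) < 2 * (n : ℝ) / ((n : ℝ) - 2) := div_pos (by linarith) (by linarith)
    rw [show (q : ℝ≥0∞) = ENNReal.ofReal (2 * (n : ℝ) / ((n : ℝ) - 2)) from rfl,
      ← ENNReal.ofReal_inv_of_pos (by positivity), ← ENNReal.ofReal_inv_of_pos h2,
      ← ENNReal.ofReal_add (by positivity) (by positivity), inv_one, ← ENNReal.ofReal_one]
    congr 1
    have : (n : ℝ) - 2 ≠ 0 := by linarith
    have : (n : ℝ) ≠ 0 := by linarith
    field_simp
    ring
  refine (lintegral_enorm_mul_le (ENNReal.ofReal (2 * (n : ℝ) / ((n : ℝ) + 2))) q hF.restrict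
    hg.continuous.aestronglyMeasurable).trans ?_
  gcongr
  exact (eLpNorm_mono_measure g Measure.restrict_le_self).trans hsob

/-- The constant in the duality estimate on time slices. -/
def sliceConst (n : ℕ) : ℝ≥0 := max 1 (SNormLESNormFDerivOfEqConst ℝ (volume : Measure (E n)) 2)

lemma one_le_sliceConst : (1 : ℝ≥0∞) ≤ sliceConst n := by
  exact_mod_cast le_max_left _ _

lemma sobolevConst_le_sliceConst :
    (SNormLESNormFDerivOfEqConst ℝ (volume : Measure (E n)) 2 : ℝ≥0∞) ≤ sliceConst n := by
  exact_mod_cast le_max_right _ _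

lemma restrict_exterior_add_restrict_ball (hn : 0 < n) :
    (volume.restrict {x : E n | 1 < ‖x‖} + volume.restrict {x : E n | ‖x‖ < 1}) = volume := by
  have hcover : ({x : E n | 1 < ‖x‖} ∪ {x : E n | ‖x‖ < 1} : Set (E n)) =ᵐ[volume] univ := by
    rw [ae_eq_univ]
    have : Nontrivial (E n) := by
      have : Nonempty (Fin n) := ⟨⟨0, hn⟩⟩
      infer_instance
    refine measure_mono_null (fun x hx => ?_)
      (Measure.addHaar_sphere (volume : Measure (E n)) 0 1)
    simp only [mem_compl_iff, mem_union, mem_ofPred_eq, not_or, not_lt] at hx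
    simpa using le_antisymm hx.1 hx.2
  rw [← Measure.restrict_union _ (measurableSet_lt measurable_norm measurable_const),
    Measure.restrict_congr_set hcover, Measure.restrict_univ]
  exact Set.disjoint_left.mpr fun x (h1 : 1 < ‖x‖) (h2 : ‖x‖ < 1) => lt_asymm h1 h2

end SliceDuality

/-! ### Uniqueness for the wave equation. -/

section Uniqueness

open Filter Topology Convolution

variable {n : ℕ}

/-- The test functions on space-time which vanish near and after time `T`. -/
structure IsTestBefore {n : ℕ} (T : ℝ) (φ : ST n → ℝ) : Prop where
  contDiff : ContDiff ℝ ∞ φ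
  hasCompactSupport : HasCompactSupport φ
  tsupport_subset : ∀ p ∈ tsupport φ, p.1 < T

/-- The square of the positive part. -/
def posSq (s : ℝ) : ℝ := max s 0 ^ 2

lemma hasDerivAt_posSq (s : ℝ) : HasDerivAt posSq (2 * max s 0) s := by
  have hne : ∀ y ≠ (0 : ℝ), HasDerivAt posSq (2 * max y 0) y := by
    intro y hy
    rcases lt_or_gt_of_ne hy with h | h
    · have h1 : posSq =ᶠ[𝓝 y] fun _ => 0 := by
        filter_upwards [gt_mem_nhds h] with z hz
        simp [posSq, max_eq_right hz.le]
      rw [max_eq_right h.le, mul_zero]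
      exact (hasDerivAt_const y (0 : ℝ)).congr_of_eventuallyEq h1
    · have h1 : posSq =ᶠ[𝓝 y] fun z => z ^ 2 := by
        filter_upwards [lt_mem_nhds h] with z hz
        simp [posSq, max_eq_left (le_of_lt hz)]
      rw [max_eq_left h.le]
      simpa using (hasDerivAt_pow 2 y).congr_of_eventuallyEq h1
  rcases eq_or_ne s 0 with rfl | hs
  · refine hasDerivAt_of_hasDerivAt_of_ne (g := fun y => 2 * max y 0) hne ?_ ?_
    · exact Continuous.continuousAt (by unfold posSq; fun_prop)
    · exact Continuous.continuousAt (by fun_prop)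
  · exact hne s hs

/-- Squaring makes the positive part `C¹`, the regularity that `weighted_energy_identity` requires
of its weight. -/
lemma contDiff_posSq : ContDiff ℝ 1 posSq := by
  rw [contDiff_one_iff_deriv]
  refine ⟨fun s => (hasDerivAt_posSq s).differentiableAt, ?_⟩
  have : deriv posSq = fun s => 2 * max s 0 := funext fun s => (hasDerivAt_posSq s).deriv
  rw [this]
  fun_prop

/-- The function `t + ⟨x - x₀⟩`, whose level sets are spacelike hyperboloids. -/
def coneFun {n : ℕ} (x₀ : E n) (p : ST n) : ℝ := p.1 + bracket (p.2 - x₀)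

lemma contDiff_coneFun (x₀ : E n) {m : WithTop ℕ∞} : ContDiff ℝ m (coneFun x₀) := by
  unfold coneFun bracket
  refine contDiff_fst.add (ContDiff.sqrt (contDiff_const.add ?_) fun p => ?_)
  · exact (contDiff_norm_sq ℝ).comp (contDiff_snd.sub contDiff_const)
  · positivity

/-- The derivative of the bracket is found by differentiating its square. The space gradient is `(x
- x₀)/⟨x - x₀⟩`, of length less than `1`, so the level sets are spacelike. -/
lemma pd_coneFun (x₀ : E n) (v p : ST n) :
    pd v (coneFun x₀) p
      = v.1 + (∑ k, (coord k p - x₀ k) * v.2 k) / bracket (p.2 - x₀) := by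
  have hβ : ContDiff ℝ 1 fun q : ST n => bracket (q.2 - x₀) := by
    have : (fun q : ST n => bracket (q.2 - x₀)) = fun q => coneFun x₀ q - q.1 := by
      ext q; simp [coneFun]
    rw [this]
    exact (contDiff_coneFun x₀).sub contDiff_fst
  have hβd : DifferentiableAt ℝ (fun q : ST n => bracket (q.2 - x₀)) p :=
    hβ.differentiable (by norm_num) p
  have hcd : ∀ k, DifferentiableAt ℝ (coord k) p := fun k =>
    (contDiff_coord k (m := 1)).differentiable (by norm_num) p
  have h0 : ∀ c : ℝ, pd v (fun _ => c) p = 0 := fun c => by simp [pd]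
  have hs : ∀ k ∈ Finset.univ, DifferentiableAt ℝ (fun q => (coord k q + -x₀ k) ^ 2) p :=
    fun k _ => ((hcd k).add_const _).pow 2
  have h1 : (fun q : ST n => bracket (q.2 - x₀) ^ 2)
      = fun q => 1 + ∑ k, (coord k q + -x₀ k) ^ 2 := by
    ext q
    rw [bracket_sq, EuclideanSpace.norm_sq_eq]
    simp [coord, sub_eq_add_neg]
  have h2 := congrArg (fun f => pd v f p) h1
  beta_reduce at h2
  have hs' := DifferentiableAt.fun_sum hs
  rw [pd_sq hβd, pd_add (differentiableAt_const _) hs', pd_sum hs, h0] at h2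
  have h3 : ∀ k, pd v (fun q => (coord k q + -x₀ k) ^ 2) p
      = 2 * ((coord k p - x₀ k) * v.2 k) := fun k => by
    rw [pd_sq (by exact (hcd k).add_const _), pd_add (hcd k) (differentiableAt_const _), h0,
      pd_coord]
    ring
  simp only [h3, ← Finset.mul_sum] at h2
  have hb := bracket_pos (p.2 - x₀)
  have h4 : pd v (fun q : ST n => bracket (q.2 - x₀)) p
      = (∑ k, (coord k p - x₀ k) * v.2 k) / bracket (p.2 - x₀) := by
    rw [eq_div_iff hb.ne']; linarith
  have h5 : pd v (fun q : ST n => q.1) p = v.1 := by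
    have : fderiv ℝ (fun q : ST n => q.1) p = ContinuousLinearMap.fst ℝ ℝ (E n) :=
      fderiv_fst
    rw [pd, this]; rfl
  unfold coneFun
  rw [pd_add differentiableAt_fst hβd, h4, h5]

/-- The cutoff function, supported in the cone-like region `t + ⟨x - x₀⟩ ≤ s`. -/
def coneWeight {n : ℕ} (s : ℝ) (x₀ : E n) (p : ST n) : ℝ := posSq (s - coneFun x₀ p)

lemma contDiff_coneWeight (s : ℝ) (x₀ : E n) : ContDiff ℝ 1 (coneWeight s x₀) :=
  contDiff_posSq.comp (contDiff_const.sub (contDiff_coneFun x₀))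

lemma pd_coneWeight (s : ℝ) (x₀ : E n) (v p : ST n) :
    pd v (coneWeight s x₀) p = -(2 * max (s - coneFun x₀ p) 0 * pd v (coneFun x₀) p) := by
  have hd : HasFDerivAt (coneFun x₀) (fderiv ℝ (coneFun x₀) p) p :=
    ((contDiff_coneFun x₀ (m := 1)).differentiable (by norm_num) p).hasFDerivAt
  have h := (hasDerivAt_posSq (s - coneFun x₀ p)).comp_hasFDerivAt p (hd.const_sub s)
  have h' : fderiv ℝ (coneWeight s x₀) p = _ := h.fderiv
  rw [pd, h']
  simp [pd]

lemma coneWeight_eq_zero {s : ℝ} {x₀ : E n} {p : ST n} (h : s ≤ coneFun x₀ p) :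
    coneWeight s x₀ p = 0 := by
  simp [coneWeight, posSq, max_eq_right (sub_nonpos.mpr h)]

/-- Uniqueness for smooth solutions: a solution on `t < T` which vanishes for negative times
vanishes. -/
lemma eq_zero_of_box_eq_zero {u : ST n → ℝ} (hu : ContDiff ℝ 2 u) {ε T : ℝ}
    (hneg : ∀ p : ST n, p.1 < -ε → u p = 0) (hbox : ∀ p : ST n, p.1 < T → box u p = 0)
    {p : ST n} (hp : p.1 < T) : u p = 0 := by
  have hu1 : ContDiff ℝ 1 u := hu.of_le (by norm_num)
  have hts : tsupport u ⊆ {p | -ε ≤ p.1} := by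
    refine closure_minimal (fun q hq => ?_) (isClosed_le continuous_const continuous_fst)
    by_contra h
    exact hq (hneg q (not_le.mp h))
  have hdT : ∀ p₀ : ST n, p₀.1 < T → dT u p₀ = 0 := by
    rintro ⟨t₀, x₀⟩ ht₀
    change t₀ < T at ht₀
    -- Since the bracket is at least `1`, the cutoff with `s = T + 1` vanishes for `t ≥ T`, where
    -- nothing is known about `box u`. At `(t₀, x₀)` the argument of the cutoff is still `T - t₀ >
    -- 0`.
    set s := T + 1 with hs
    set W : ST n → ℝ := coneWeight s x₀ with hW
    have hWc : ContDiff ℝ 1 W := contDiff_coneWeight s x₀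
    have htW : tsupport W ⊆ {p | coneFun x₀ p ≤ s} := by
      refine closure_minimal (fun q hq => ?_)
        (isClosed_le (contDiff_coneFun x₀ (m := 1)).continuous continuous_const)
      by_contra h
      exact hq (coneWeight_eq_zero (not_le.mp h).le)
    have hK : IsCompact (tsupport W ∩ tsupport u) := by
      refine IsCompact.of_isClosed_subset
        ((isCompact_Icc (a := -ε) (b := s)).prod (isCompact_closedBall x₀ (s + ε)))
        ((isClosed_tsupport _).inter (isClosed_tsupport _)) fun q hq => ?_
      have h1 : q.1 + bracket (q.2 - x₀) ≤ s := htW hq.1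
      have h2 : -ε ≤ q.1 := hts hq.2
      have h3 := norm_le_bracket (q.2 - x₀)
      have h4 := bracket_pos (q.2 - x₀)
      refine ⟨⟨h2, by linarith⟩, ?_⟩
      rw [Metric.mem_closedBall, dist_eq_norm]
      linarith
    set I : ST n → ℝ := fun p => 2 * max (s - coneFun x₀ p) 0 * (energyDensity u p
      - dT u p * ∑ j, ((coord j p - x₀ j) / bracket (p.2 - x₀)) * dX j u p) with hI
    have hIeq : ∀ p, dT W p * energyDensity u p - dT u p * ∑ j, dX j W p * dX j u p
        + W p * (dT u p * box u p) = -I p := by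
      intro p
      have e1 : dT W p = -(2 * max (s - coneFun x₀ p) 0) := by
        rw [dT, hW, pd_coneWeight, pd_coneFun]; simp [eT]
      have e2 : ∀ j, dX j W p = -(2 * max (s - coneFun x₀ p) 0)
          * ((coord j p - x₀ j) / bracket (p.2 - x₀)) := by
        intro j
        rw [dX, hW, pd_coneWeight, pd_coneFun]
        simp [eX]
      have e3 : W p * (dT u p * box u p) = 0 := by
        rcases lt_or_ge p.1 T with h | h
        · rw [hbox p h]; ring
        · have : W p = 0 := coneWeight_eq_zero (by
            have := one_le_bracket (p.2 - x₀)
            unfold coneFun; linarith)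
          rw [this]; ring
      rw [e3]
      simp only [e1, e2, mul_assoc, ← Finset.mul_sum, hI]
      ring
    -- The cutoff is constant along spacelike surfaces: `|∂ₜu y·∇u|` is at most the energy density
    -- because `|y| ≤ 1`.
    have hInn : ∀ p, 0 ≤ I p := by
      intro p
      have hm : 0 ≤ max (s - coneFun x₀ p) 0 := le_max_right _ _
      have hb := bracket_pos (p.2 - x₀)
      set y : Fin n → ℝ := fun j => (coord j p - x₀ j) / bracket (p.2 - x₀) with hy
      have hy1 : ∑ j, y j ^ 2 ≤ 1 := by
        simp only [hy, div_pow, ← Finset.sum_div]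
        rw [div_le_one (by positivity), bracket_sq, EuclideanSpace.norm_sq_eq]
        simp [coord]
      have hcs := Finset.sum_mul_sq_le_sq_mul_sq Finset.univ y (fun j => dX j u p)
      have hg := gradSq_nonneg u p
      have hcs' : (∑ j, y j * dX j u p) ^ 2 ≤ gradSq u p := by
        refine hcs.trans ?_
        exact mul_le_of_le_one_left hg hy1
      have : 0 ≤ energyDensity u p - dT u p * ∑ j, y j * dX j u p := by
        unfold energyDensity
        nlinarith [sq_nonneg (dT u p - ∑ j, y j * dX j u p)]
      exact mul_nonneg (by positivity) this
    have hIcont : Continuous I := by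
      have h1 := (contDiff_coneFun x₀ (m := 1)).continuous
      have h2 := (contDiff_energyDensity hu).continuous
      have h3 : Continuous (dT u) := continuous_pd hu1 _
      have h4 : ∀ j, Continuous (dX j u) := fun j => continuous_pd hu1 _
      have h5 : ∀ j, Continuous fun p : ST n => (coord j p - x₀ j) / bracket (p.2 - x₀) :=
        fun j => (((contDiff_coord j (m := 1)).continuous).sub continuous_const).div
          (continuous_bracket.comp (continuous_snd.sub continuous_const))
          fun p => (bracket_pos _).ne'
      refine (continuous_const.mul ((continuous_const.sub h1).max continuous_const)).mul
        (h2.sub (h3.mul (continuous_finsetSum _ fun j _ => (h5 j).mul (h4 j))))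
    have hI0 : ∀ p, p ∉ tsupport u → I p = 0 := by
      intro p hp
      simp [hI, energyDensity_eq_zero_of_notMem_tsupport hp, dT,
        pd_eq_zero_of_notMem_tsupport hp]
    have hI0' : ∀ p, s ≤ coneFun x₀ p → I p = 0 := by
      intro p hp
      simp [hI, max_eq_right (sub_nonpos.mpr hp)]
    have hIcs : HasCompactSupport I := by
      refine HasCompactSupport.intro
        ((isCompact_Icc (a := -ε) (b := s)).prod (isCompact_closedBall x₀ (s + ε)))
        fun q hq => ?_
      by_contra hne
      apply hq
      have h2 : -ε ≤ q.1 := hts (by by_contra h; exact hne (hI0 q h))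
      have h1 : q.1 + bracket (q.2 - x₀) ≤ s := by
        by_contra h; exact hne (hI0' q (not_le.mp h).le)
      have h3 := norm_le_bracket (q.2 - x₀)
      have h4 := bracket_pos (q.2 - x₀)
      refine ⟨⟨h2, by linarith⟩, ?_⟩
      rw [Metric.mem_closedBall, dist_eq_norm]
      linarith
    -- The slab begins before the support of `u` and ends where the cutoff vanishes, so both
    -- boundary terms are zero and the nonnegative continuous `I` has zero integral.
    set a := min (-ε) s - 1 with ha
    have hab : a ≤ s := by have := min_le_right (-ε) s; linarith
    have key := weighted_energy_identity hWc hu hK hab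
    simp only [hIeq] at key
    have hb0 : ∀ x, W (s, x) * energyDensity u (s, x) = 0 := fun x => by
      have : W (s, x) = 0 := coneWeight_eq_zero (by
        have := bracket_pos (x - x₀)
        simp only [coneFun]; linarith)
      rw [this, zero_mul]
    have ha0 : ∀ x, W (a, x) * energyDensity u (a, x) = 0 := fun x => by
      rw [energyDensity_eq_zero_of_notMem_tsupport, mul_zero]
      intro h
      have h1 : -ε ≤ a := hts h
      have := min_le_left (-ε) s
      linarith
    simp only [hb0, ha0, integral_zero, sub_zero, integral_neg, neg_eq_zero] at key
    rw [setIntegral_eq_integral_of_forall_compl_eq_zero] at key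
    · by_contra hne
      -- At the centre `x = x₀` the gradient of the bracket vanishes, so `I` is a positive multiple
      -- of the energy density there.
      have hIp : I (t₀, x₀) ≠ 0 := by
        have hb1 : bracket (0 : E n) = 1 := by simp [bracket]
        have : I (t₀, x₀) = 2 * (s - (t₀ + 1)) * energyDensity u (t₀, x₀) := by
          simp [hI, coneFun, coord, hb1]
          left
          linarith
        rw [this]
        have h1 : 0 < dT u (t₀, x₀) ^ 2 := by positivity
        have h2 := gradSq_nonneg u (t₀, x₀)
        have h3 : 0 < energyDensity u (t₀, x₀) := by unfold energyDensity; linarith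
        have h4 : 0 < s - (t₀ + 1) := by linarith
        positivity
      have := hIcont.integral_pos_of_hasCompactSupport_nonneg_nonzero (μ := volume) hIcs hInn hIp
      linarith
    · intro q hq
      by_contra hne
      apply hq
      have h2 : -ε ≤ q.1 := hts (by by_contra h; exact hne (hI0 q h))
      have h1 : q.1 + bracket (q.2 - x₀) ≤ s := by
        by_contra h; exact hne (hI0' q (not_le.mp h).le)
      have h4 := bracket_pos (q.2 - x₀)
      have := min_le_left (-ε) s
      exact ⟨⟨by linarith, by linarith⟩, mem_univ _⟩
  obtain ⟨t, x⟩ := p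
  change t < T at hp
  rcases lt_or_ge t (-ε) with h | h
  · exact hneg _ h
  · have hder : ∀ r, HasDerivAt (fun r => u (r, x)) (dT u (r, x)) r := fun r =>
      hasDerivAt_time (p := (r, x)) (hu.differentiable (by norm_num) _)
    have := constant_of_has_deriv_right_zero (f := fun r => u (r, x)) (a := -ε - 1) (b := t)
      (fun r _ => (hder r).continuousAt.continuousWithinAt) (fun r hr => by
        have := (hder r).hasDerivWithinAt (s := Ici r)
        rwa [hdT (r, x) (hr.2.trans hp)] at this) t ⟨by linarith, le_rfl⟩
    rw [this]
    exact hneg _ (by change -ε - 1 < -ε; linarith)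

instance : (volume : Measure (ST n)).IsAddHaarMeasure :=
  Measure.prod.instIsAddHaarMeasure (volume : Measure ℝ) (volume : Measure (E n))

lemma pd_convolution {f g : ST n → ℝ} (hfc : HasCompactSupport f) (hf : ContDiff ℝ 1 f)
    (hg : LocallyIntegrable g) (v p : ST n) :
    pd v (f ⋆[ContinuousLinearMap.lsmul ℝ ℝ, volume] g) p
      = (pd v f ⋆[ContinuousLinearMap.lsmul ℝ ℝ, volume] g) p := by
  rw [pd, (hfc.hasFDerivAt_convolution_left _ hf hg p).fderiv, convolution,
    ContinuousLinearMap.integral_apply]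
  · rfl
  · exact (hfc.fderiv (𝕜 := ℝ)).convolutionExists_left _ (hf.continuous_fderiv (by norm_num)) hg p

lemma ContDiff.two_of_infty {f : ST n → ℝ} (hf : ContDiff ℝ ∞ f) : ContDiff ℝ 2 f :=
  mod_cast contDiff_infty.mp hf 2

lemma pd_comp_sub_left {f : ST n → ℝ} (hf : Differentiable ℝ f) (v p q : ST n) :
    pd v (fun z => f (p - z)) q = -pd v f (p - q) := by
  have h : HasFDerivAt (fun z => f (p - z))
      ((fderiv ℝ f (p - q)).comp (-ContinuousLinearMap.id ℝ (ST n))) q :=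
    HasFDerivAt.comp q (hf (p - q)).hasFDerivAt ((hasFDerivAt_id q).const_sub p)
  rw [pd, h.fderiv]
  simp [pd]

/-- The derivatives fall on the mollifier, and the signs from the reflection `z ↦ p - z` cancel in
second derivatives. The value is thus a pairing of `g` with `box` of a test function, as in the weak
equation. -/
lemma box_convolution {f g : ST n → ℝ} (hfc : HasCompactSupport f) (hf : ContDiff ℝ ∞ f)
    (hg : LocallyIntegrable g) (p : ST n) :
    box (f ⋆[ContinuousLinearMap.lsmul ℝ ℝ, volume] g) p
      = ∫ q, g q * box (fun z => f (p - z)) q := by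
  have hf1 : ContDiff ℝ 1 f := hf.of_le (by simp)
  have hpd : ∀ v, ContDiff ℝ ∞ (pd v f) := fun v => contDiff_infty_pd hf
  have h1 : ∀ v, pd v (pd v (f ⋆[ContinuousLinearMap.lsmul ℝ ℝ, volume] g)) p
      = ∫ q, g q * pd v (pd v (fun z => f (p - z))) q := by
    intro v
    have e1 : pd v (f ⋆[ContinuousLinearMap.lsmul ℝ ℝ, volume] g)
        = (pd v f ⋆[ContinuousLinearMap.lsmul ℝ ℝ, volume] g) :=
      funext fun q => pd_convolution hfc hf1 hg v q
    rw [e1, pd_convolution (hasCompactSupport_pd hfc) ((hpd v).of_le (by simp)) hg,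
      convolution_eq_swap]
    refine integral_congr_ae (Eventually.of_forall fun q => ?_)
    have e2 : pd v (fun z => f (p - z)) = fun z => -1 * pd v f (p - z) := by
      ext z; rw [pd_comp_sub_left (hf1.differentiable (by norm_num))]; ring
    have hd : DifferentiableAt ℝ (fun z => pd v f (p - z)) q := by
      have : ContDiff ℝ 1 fun z => pd v f (p - z) :=
        ((hpd v).of_le (by simp)).comp (contDiff_const.sub contDiff_id)
      exact this.differentiable (by norm_num) q
    simp only [ContinuousLinearMap.lsmul_apply, smul_eq_mul]
    rw [e2, pd_const_mul _ hd, pd_comp_sub_left (((hpd v).of_le (by simp)).differentiable one_ne_zero)]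
    ring
  have hu : ContDiff ℝ ∞ (f ⋆[ContinuousLinearMap.lsmul ℝ ℝ, volume] g) :=
    hfc.contDiff_convolution_left _ hf hg
  have hfs : ContDiff ℝ ∞ fun z => f (p - z) := hf.comp (contDiff_const.sub contDiff_id)
  have hfsc : HasCompactSupport fun z => f (p - z) :=
    hfc.comp_homeomorph (Homeomorph.subLeft p)
  have hint : ∀ v, Integrable fun q => g q * pd v (pd v (fun z => f (p - z))) q := fun v => by
    have := hg.integrable_smul_right_of_hasCompactSupport
      (contDiff_infty_pd (v := v) (contDiff_infty_pd (v := v) hfs)).continuous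
      (hasCompactSupport_pd (v := v) (hasCompactSupport_pd (v := v) hfsc))
    simpa only [smul_eq_mul] using this
  rw [box_eq (ContDiff.two_of_infty hu)]
  have hfs2 : ContDiff ℝ 2 fun z => f (p - z) := ContDiff.two_of_infty hfs
  simp only [dT, dX, h1, box_eq hfs2, mul_sub, Finset.mul_sum]
  rw [integral_sub (hint _) (integrable_finsetSum _ fun j _ => hint _),
    integral_finsetSum _ fun j _ => hint _]

/-- Uniqueness for distributional solutions with vanishing data. -/
lemma ae_eq_zero_of_integral_box_eq_zero {v : ST n → ℝ} {T : ℝ} (hv : LocallyIntegrable v)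
    (hneg : ∀ p : ST n, p.1 < 0 → v p = 0)
    (h : ∀ φ : ST n → ℝ, IsTestBefore T φ → ∫ p, v p * box φ p = 0) :
    ∀ᵐ p : ST n, p.1 < T → v p = 0 := by
  -- The ratio of outer to inner radius stays equal to `2`, as the almost everywhere convergence of
  -- mollifications of a locally integrable function requires.
  let ρ : ℕ → ContDiffBump (0 : ST n) := fun k =>
    ⟨1 / (2 * ((k : ℝ) + 1)), 1 / ((k : ℝ) + 1), by positivity, by
      apply one_div_lt_one_div_of_lt <;> nlinarith [Nat.cast_nonneg (α := ℝ) k]⟩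
  have hρ : Tendsto (fun k => (ρ k).rOut) atTop (𝓝 0) :=
    tendsto_one_div_add_atTop_nhds_zero_nat
  have hlim := ContDiffBump.ae_convolution_tendsto_right_of_locallyIntegrable
    (μ := (volume : Measure (ST n))) (φ := ρ) (K := 2) hρ (Eventually.of_forall fun k => by
      change 1 / ((k : ℝ) + 1) ≤ 2 * (1 / (2 * ((k : ℝ) + 1)))
      field_simp; norm_num) hv
  filter_upwards [hlim] with p hp hpT
  refine tendsto_nhds_unique hp (tendsto_const_nhds.congr' ?_)
  -- Mollification at radius `r` keeps the equation only for times before `T - r`, and spreads the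
  -- support to times at least `-r`.
  have hev : ∀ᶠ k in atTop, (ρ k).rOut < T - p.1 :=
    hρ.eventually (gt_mem_nhds (by linarith))
  filter_upwards [hev] with k hk
  set f := (ρ k).normed (volume : Measure (ST n)) with hf
  have hfs : ContDiff ℝ ∞ f := (ρ k).contDiff_normed
  have hfc : HasCompactSupport f := (ρ k).hasCompactSupport_normed
  have hft : tsupport f = Metric.closedBall 0 (ρ k).rOut := (ρ k).tsupport_normed_eq
  symm
  refine eq_zero_of_box_eq_zero (u := f ⋆[ContinuousLinearMap.lsmul ℝ ℝ, volume] v)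
    (ε := (ρ k).rOut) (T := T - (ρ k).rOut)
    (ContDiff.two_of_infty (hfc.contDiff_convolution_left _ hfs hv)) ?_ ?_ (by linarith)
  · intro q hq
    refine integral_eq_zero_of_ae (Eventually.of_forall fun z => ?_)
    by_cases hz : z ∈ tsupport f
    · rw [hft, mem_closedBall_zero_iff] at hz
      have h1 : |z.1| ≤ (ρ k).rOut := (norm_fst_le z).trans hz
      have h2 := neg_abs_le z.1
      have : v (q - z) = 0 := hneg _ (by change q.1 - z.1 < 0; linarith)
      simp [this]
    · simp [image_eq_zero_of_notMem_tsupport hz]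
  · intro q hq
    rw [box_convolution hfc hfs hv]
    refine h _ ⟨hfs.comp (contDiff_const.sub contDiff_id),
      hfc.comp_homeomorph (Homeomorph.subLeft q), fun z hz => ?_⟩
    have hz' : q - z ∈ tsupport f :=
      tsupport_comp_subset_preimage f (continuous_const.sub continuous_id) hz
    rw [hft, mem_closedBall_zero_iff] at hz'
    have h1 : |q.1 - z.1| ≤ (ρ k).rOut := (norm_fst_le (q - z)).trans hz'
    have h2 := neg_abs_le (q.1 - z.1)
    linarith

end Uniqueness

/-! ### From dual estimates to weighted `L²` bounds, by Riesz representation. -/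

section WeightedBound

variable {n : ℕ} {T : ℝ}

/-- The right-hand side of the estimate, without the constant. -/
def sourceNorm {𝕜 : Type*} [RCLike 𝕜] {n : ℕ} (T : ℝ) (F : ℝ → E n → 𝕜) : ℝ≥0∞ :=
  (∫⁻ t in Icc 0 T, mixedNormOn 1 2 {x : E n | 1 < ‖x‖}
      (fun x => (‖x‖ ^ (-(((n : ℝ) - 2) / 2))) • F t x))
    + ∫⁻ t in Icc 0 T, eLpNorm (F t) (ENNReal.ofReal (2 * (n : ℝ) / ((n : ℝ) + 2)))
      (volume.restrict {x : E n | ‖x‖ < 1})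

lemma slab_subset_halfSpace : slab n 0 T ⊆ halfSpace n :=
  prod_mono (fun _ ht => ht.1) le_rfl

lemma LocallyIntegrableOn.indicator_slab {f : ST n → ℝ}
    (hf : LocallyIntegrableOn f (halfSpace n)) :
    LocallyIntegrable ((slab n 0 T).indicator f) := by
  have hclosed : IsClosed (slab n 0 T) := isClosed_Icc.prod isClosed_univ
  rw [locallyIntegrable_iff]
  intro K hK
  rw [IntegrableOn, integrable_indicator_iff measurableSet_slab, IntegrableOn,
    Measure.restrict_restrict measurableSet_slab]
  exact hf.integrableOn_compact_subset (inter_subset_left.trans slab_subset_halfSpace)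
    (hK.inter_left hclosed)

lemma norm_fderiv_slice_sq_le {φ : ST n → ℝ} (hφ : ContDiff ℝ 1 φ) (p : ST n) :
    ‖fderiv ℝ (fun x => φ (p.1, x)) p.2‖ ^ 2 ≤ gradSq φ p := by
  have hd : DifferentiableAt ℝ φ p := hφ.differentiable (by norm_num) p
  have h : ‖fderiv ℝ (fun x => φ (p.1, x)) p.2‖ ≤ √(gradSq φ p) := by
    refine ContinuousLinearMap.opNorm_le_bound _ (Real.sqrt_nonneg _) fun v => ?_
    have h1 : fderiv ℝ (fun x => φ (p.1, x)) p.2 v = ∑ j, dX j φ p * v j := by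
      have hv : v = ∑ j, v j • EuclideanSpace.single j (1 : ℝ) := by
        have := (EuclideanSpace.basisFun (Fin n) ℝ).sum_repr v
        simpa using this.symm
      conv_lhs => rw [hv]
      rw [map_sum]
      refine Finset.sum_congr rfl fun j _ => ?_
      rw [map_smul, fderiv_slice hd, smul_eq_mul, mul_comm]
      rfl
    rw [h1, Real.norm_eq_abs]
    have h2 := Finset.sum_mul_sq_le_sq_mul_sq Finset.univ (fun j => dX j φ p) (fun j => v j)
    refine Real.abs_le_sqrt h2 |>.trans (le_of_eq ?_)
    rw [show ∑ i, dX i φ p ^ 2 = gradSq φ p from rfl, Real.sqrt_mul (gradSq_nonneg φ p)]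
    congr 1
    rw [EuclideanSpace.norm_eq]
    simp
  calc ‖fderiv ℝ (fun x => φ (p.1, x)) p.2‖ ^ 2 ≤ √(gradSq φ p) ^ 2 := by gcongr
    _ = gradSq φ p := Real.sq_sqrt (gradSq_nonneg φ p)

lemma eLpNorm_fderiv_slice_le {φ : ST n → ℝ} (hφ : ContDiff ℝ 1 φ) (hc : HasCompactSupport φ)
    (t : ℝ) {D : ℝ} (hD : ∫ x, gradSq φ (t, x) ≤ D) :
    eLpNorm (fderiv ℝ fun x => φ (t, x)) 2 volume ≤ ENNReal.ofReal √D := by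
  have hD0 : 0 ≤ D := (integral_nonneg fun x => gradSq_nonneg φ (t, x)).trans hD
  rw [← ENNReal.pow_le_pow_left_iff two_ne_zero, eLpNorm_two_sq,
    ← ENNReal.ofReal_pow (Real.sqrt_nonneg _), Real.sq_sqrt hD0]
  refine le_trans ?_ (ENNReal.ofReal_le_ofReal hD)
  rw [ofReal_integral_eq_lintegral_ofReal
    (integrable_slice_of_tsupport (continuous_gradSq hφ) hc
      (fun p hp => gradSq_eq_zero_of_notMem_tsupport hp) t)
    (Filter.Eventually.of_forall fun x => gradSq_nonneg φ (t, x))]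
  refine lintegral_mono fun x => ?_
  rw [← ofReal_norm, ← ENNReal.ofReal_pow (norm_nonneg _)]
  exact ENNReal.ofReal_le_ofReal (norm_fderiv_slice_sq_le hφ (t, x))

/-- Duality between the source and a test function. -/
lemma lintegral_slab_le (hn : 3 ≤ n) {F : ℝ → E n → ℝ}
    (hF : LocallyIntegrableOn (fun p : ST n => F p.1 p.2) (halfSpace n))
    {φ : ST n → ℝ} (hφ : ContDiff ℝ 1 φ) (hc : HasCompactSupport φ) {M : ℝ≥0∞} (hM : M ≠ ⊤)
    (h : ∀ t ∈ Icc 0 T, eLpNorm (fderiv ℝ fun x => φ (t, x)) 2 volume ≤ M) :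
    ∫⁻ p in slab n 0 T, ‖F p.1 p.2‖ₑ * ‖φ p‖ₑ ≤ sliceConst n * M * sourceNorm T F := by
  set A : Set (E n) := {x : E n | 1 < ‖x‖}
  set A' : Set (E n) := {x : E n | ‖x‖ < 1}
  have hclosed : IsClosed (halfSpace n) := isClosed_Ici.prod isClosed_univ
  have hFm : AEStronglyMeasurable (fun p : ST n => F p.1 p.2)
      ((volume.restrict (Icc 0 T)).prod (volume : Measure (E n))) := by
    rw [← restrict_slab]
    exact (hF.aestronglyMeasurable).mono_measure (Measure.restrict_mono slab_subset_halfSpace le_rfl)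
  have hm : AEMeasurable (fun p : ST n => ‖F p.1 p.2‖ₑ * ‖φ p‖ₑ)
      ((volume.restrict (Icc 0 T)).prod (volume : Measure (E n))) :=
    hFm.enorm.mul hφ.continuous.aestronglyMeasurable.enorm
  have hslice : ∀ᵐ t ∂volume.restrict (Icc 0 T), AEStronglyMeasurable (F t) volume :=
    hFm.prodMk_left
  have hg : ∀ t, ContDiff ℝ 1 fun x => φ (t, x) := fun t => hφ.comp (by fun_prop)
  have hgc := hasCompactSupport_slice hc
  have hsplit : ∀ f : E n → ℝ≥0∞, ∫⁻ x, f x = (∫⁻ x in A, f x) + ∫⁻ x in A', f x := fun f => by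
    conv_lhs => rw [← restrict_exterior_add_restrict_ball (n := n) (by omega)]
    exact lintegral_add_measure _ _ _
  rw [restrict_slab, lintegral_prod _ hm]
  simp only [hsplit]
  have hm1 : AEMeasurable (fun t => ∫⁻ x in A, ‖F t x‖ₑ * ‖φ (t, x)‖ₑ)
      (volume.restrict (Icc 0 T)) := by
    have h1 : (volume.restrict (Icc 0 T)).prod (volume.restrict A)
        ≤ (volume.restrict (Icc 0 T)).prod (volume : Measure (E n)) := by
      conv_lhs => rw [Measure.prod_restrict]
      conv_rhs => rw [← Measure.restrict_univ (μ := (volume : Measure (E n))),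
        Measure.prod_restrict]
      exact Measure.restrict_mono (prod_mono le_rfl (subset_univ _)) le_rfl
    exact (hm.mono_measure h1).lintegral_prod_right'
  rw [lintegral_add_left' hm1, sourceNorm, mul_add]
  have hK : (sliceConst n : ℝ≥0∞) * M ≠ ⊤ := ENNReal.mul_ne_top ENNReal.coe_ne_top hM
  refine add_le_add ?_ ?_
  · rw [← lintegral_const_mul' _ _ hK]
    refine lintegral_mono_ae ?_
    filter_upwards [hslice, ae_restrict_mem measurableSet_Icc] with t ht htT
    refine (lintegral_exterior_le hn ht (hg t) (hgc t)).trans ?_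
    rw [mul_comm]
    gcongr
    exact (h t htT).trans (le_mul_of_one_le_left zero_le one_le_sliceConst)
  · rw [← lintegral_const_mul' _ _ hK]
    refine lintegral_mono_ae ?_
    filter_upwards [hslice, ae_restrict_mem measurableSet_Icc] with t ht htT
    refine (lintegral_ball_le hn ht (hg t) (hgc t)).trans ?_
    rw [mul_comm]
    exact mul_le_mul_left (mul_le_mul' sobolevConst_le_sliceConst (h t htT)) _

/-- A functional which is bounded by the norm of a linear map into a Hilbert space is represented
by a vector. -/
lemma exists_inner_eq_of_abs_le {V H : Type*} [AddCommGroup V] [Module ℝ V]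
    [NormedAddCommGroup H] [InnerProductSpace ℝ H] [CompleteSpace H] (L : V →ₗ[ℝ] H)
    (l : V →ₗ[ℝ] ℝ) {M : ℝ} (hM : 0 ≤ M) (h : ∀ v, |l v| ≤ M * ‖L v‖) :
    ∃ y : H, ‖y‖ ≤ M ∧ ∀ v, inner ℝ y (L v) = l v := by
  -- The functional is transported to the range of `L` through an arbitrary linear section. The
  -- bound forces `l` to vanish on the kernel of `L`, so the choice is immaterial.
  obtain ⟨s, hs⟩ := L.rangeRestrict.exists_rightInverse_of_surjective L.range_rangeRestrict
  have hLs : ∀ z : LinearMap.range L, L (s z) = z := fun z => by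
    have := LinearMap.congr_fun hs z
    exact congrArg Subtype.val this
  let f : LinearMap.range L →ₗ[ℝ] ℝ := l ∘ₗ s
  have hf : ∀ z, ‖f z‖ ≤ M * ‖z‖ := fun z => by
    have := h (s z)
    rwa [hLs] at this
  obtain ⟨g, hg1, hg2⟩ := exists_extension_norm_eq _ (f.mkContinuous M hf)
  refine ⟨(InnerProductSpace.toDual ℝ H).symm g, ?_, fun v => ?_⟩
  · rw [LinearIsometryEquiv.norm_map, hg2]
    exact LinearMap.mkContinuous_norm_le _ hM _
  · rw [InnerProductSpace.toDual_symm_apply]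
    have h1 := hg1 ⟨L v, LinearMap.mem_range_self L v⟩
    change g (L v) = l (s ⟨L v, LinearMap.mem_range_self L v⟩) at h1
    rw [h1]
    have h2 := h (s ⟨L v, LinearMap.mem_range_self L v⟩ - v)
    rw [map_sub, map_sub, hLs, sub_self, norm_zero, mul_zero] at h2
    have := abs_nonpos_iff.mp h2
    linarith

lemma box_add {φ ψ : ST n → ℝ} (hφ : ContDiff ℝ ∞ φ) (hψ : ContDiff ℝ ∞ ψ) (p : ST n) :
    box (φ + ψ) p = box φ p + box ψ p := by
  have h1 : ∀ {f g : ST n → ℝ} (_ : ContDiff ℝ ∞ f) (_ : ContDiff ℝ ∞ g) (v : ST n),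
      pd v (f + g) = pd v f + pd v g := fun hf hg v => funext fun q =>
    pd_add (hf.differentiable (by simp) q) (hg.differentiable (by simp) q)
  have h2 : ∀ v, pd v (pd v (φ + ψ)) p = pd v (pd v φ) p + pd v (pd v ψ) p := fun v => by
    rw [h1 hφ hψ, h1 (contDiff_infty_pd hφ) (contDiff_infty_pd hψ)]; rfl
  have hs : ContDiff ℝ ∞ (φ + ψ) := hφ.add hψ
  rw [box_eq (ContDiff.two_of_infty hs), box_eq (ContDiff.two_of_infty hφ),
    box_eq (ContDiff.two_of_infty hψ)]
  simp only [dT, dX, h2, Finset.sum_add_distrib]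
  ring

lemma box_smul {φ : ST n → ℝ} (hφ : ContDiff ℝ ∞ φ) (c : ℝ) (p : ST n) :
    box (c • φ) p = c * box φ p := by
  have h1 : ∀ {f : ST n → ℝ} (_ : ContDiff ℝ ∞ f) (v : ST n),
      pd v (c • f) = c • pd v f := fun hf v => funext fun q =>
    pd_const_mul c (hf.differentiable (by simp) q)
  have h2 : ∀ v, pd v (pd v (c • φ)) p = c * pd v (pd v φ) p := fun v => by
    rw [h1 hφ, h1 (contDiff_infty_pd hφ)]; rfl
  have hs : ContDiff ℝ ∞ (c • φ) := contDiff_const.smul hφ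
  rw [box_eq (ContDiff.two_of_infty hs), box_eq (ContDiff.two_of_infty hφ)]
  simp only [dT, dX, h2, ← Finset.mul_sum]
  ring

/-- The space of test functions which vanish near and after time `T`. -/
def testSpace (n : ℕ) (T : ℝ) : Submodule ℝ (ST n → ℝ) where
  carrier := {φ | IsTestBefore T φ}
  add_mem' {φ ψ} hφ hψ := ⟨hφ.contDiff.add hψ.contDiff,
    hφ.hasCompactSupport.add hψ.hasCompactSupport, fun p hp =>
      (tsupport_add φ ψ hp).elim (hφ.tsupport_subset p) (hψ.tsupport_subset p)⟩
  zero_mem' := ⟨contDiff_const, HasCompactSupport.zero, fun p hp => by simp [tsupport] at hp⟩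
  smul_mem' c φ hφ := ⟨contDiff_const.smul hφ.contDiff, hφ.hasCompactSupport.smul_left,
    fun p hp => hφ.tsupport_subset p (tsupport_smul_subset_right (fun _ => c) φ hp)⟩

/-- A weighted dual estimate for test functions gives a weighted `L²` estimate for solutions. -/
lemma eLpNorm_sqrt_weight_mul_le (hn : 3 ≤ n) {w F : ℝ → E n → ℝ} (hsol : IsSolution w F)
    {a : ST n → ℝ} (ha : Continuous a) (ha0 : ∀ p, 0 < a p) {Λ : ℝ} (hΛ : 0 < Λ)
    (hdual : DualEstimate T a Λ) :
    eLpNorm (fun p : ST n => √(a p) * w p.1 p.2) 2 (volume.restrict (slab n 0 T))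
      ≤ sliceConst n * ENNReal.ofReal √Λ * sourceNorm T F := by
  set μ : Measure (ST n) := volume.restrict (slab n 0 T) with hμ
  set B := sourceNorm T F with hB
  have hs0 : (sliceConst n : ℝ≥0∞) * ENNReal.ofReal √Λ ≠ 0 := by
    refine mul_ne_zero ?_ ?_
    · exact (one_pos.trans_le one_le_sliceConst).ne'
    · rw [Ne, ENNReal.ofReal_eq_zero, not_le]; positivity
  have hΛ_top : (sliceConst n : ℝ≥0∞) * ENNReal.ofReal √Λ ≠ ⊤ :=
    ENNReal.mul_ne_top ENNReal.coe_ne_top ENNReal.ofReal_ne_top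
  by_cases hBtop : B = ⊤
  · rw [hBtop, ENNReal.mul_top hs0]; exact le_top
  set M : ℝ := ((sliceConst n : ℝ≥0∞) * ENNReal.ofReal √Λ * B).toReal with hMdef
  have hMtop : (sliceConst n : ℝ≥0∞) * ENNReal.ofReal √Λ * B ≠ ⊤ :=
    ENNReal.mul_ne_top hΛ_top hBtop
  set b : ST n → ℝ := fun p => √(a p) with hb
  have hbc : Continuous b := ha.sqrt
  have hb0 : ∀ p, 0 < b p := fun p => Real.sqrt_pos.mpr (ha0 p)
  have hbi : Continuous fun p => (b p)⁻¹ := hbc.inv₀ fun p => (hb0 p).ne'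
  have hFS : LocallyIntegrable ((slab n 0 T).indicator fun p : ST n => F p.1 p.2) :=
    LocallyIntegrableOn.indicator_slab hsol.locInt_F
  have hwS : LocallyIntegrable ((slab n 0 T).indicator fun p : ST n => w p.1 p.2) :=
    LocallyIntegrableOn.indicator_slab hsol.locInt_w
  have iF : ∀ φ : ST n → ℝ, IsTestBefore T φ → Integrable (fun p => φ p * F p.1 p.2) μ := by
    intro φ hφ
    have h1 := hFS.integrable_smul_left_of_hasCompactSupport hφ.contDiff.continuous
      hφ.hasCompactSupport
    rw [hμ, ← IntegrableOn, ← integrable_indicator_iff measurableSet_slab]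
    refine h1.congr (Filter.Eventually.of_forall fun p => ?_)
    by_cases hp : p ∈ slab n 0 T <;> simp [hp]
  have hLmem : ∀ φ : testSpace n T, MemLp (fun p => (b p)⁻¹ * box φ.1 p) 2 μ := fun φ => by
    have h2 := ContDiff.two_of_infty φ.2.contDiff
    refine MemLp.restrict _ (Continuous.memLp_of_hasCompactSupport
      (hbi.mul (continuous_box h2)) ?_)
    exact (hasCompactSupport_box h2 φ.2.hasCompactSupport).mul_left
  let L : testSpace n T →ₗ[ℝ] Lp ℝ 2 μ :=
    { toFun := fun φ => (hLmem φ).toLp _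
      map_add' := fun φ ψ => by
        rw [← MemLp.toLp_add]
        congr 1
        ext p
        simp only [Submodule.coe_add, Pi.add_apply, box_add φ.2.contDiff ψ.2.contDiff]
        ring
      map_smul' := fun c φ => by
        rw [RingHom.id_apply, ← MemLp.toLp_const_smul]
        congr 1
        ext p
        simp only [Submodule.coe_smul, Pi.smul_apply, smul_eq_mul, box_smul φ.2.contDiff]
        ring }
  let l : testSpace n T →ₗ[ℝ] ℝ :=
    { toFun := fun φ => ∫ p, φ.1 p * F p.1 p.2 ∂μ
      map_add' := fun φ ψ => by
        rw [← integral_add (iF _ φ.2) (iF _ ψ.2)]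
        congr 1 with p
        simp only [Submodule.coe_add, Pi.add_apply]; ring
      map_smul' := fun c φ => by
        rw [RingHom.id_apply, smul_eq_mul, ← integral_const_mul]
        congr 1 with p
        simp only [Submodule.coe_smul, Pi.smul_apply, smul_eq_mul]; ring }
  have hLnorm : ∀ φ : testSpace n T, ‖L φ‖ = √(∫ p, (a p)⁻¹ * box φ.1 p ^ 2 ∂μ) := by
    intro φ
    rw [eq_comm, Real.sqrt_eq_iff_eq_sq (integral_nonneg fun p => ?_) (norm_nonneg _),
      ← real_inner_self_eq_norm_sq, L2.inner_def]
    · refine integral_congr_ae ?_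
      filter_upwards [(hLmem φ).coeFn_toLp] with p hp
      change _ = inner ℝ (((hLmem φ).toLp _) p) (((hLmem φ).toLp _) p)
      rw [hp, real_inner_self_eq_norm_sq, Real.norm_eq_abs, sq_abs, mul_pow, inv_pow,
        Real.sq_sqrt (ha0 p).le]
    · exact mul_nonneg (inv_nonneg.mpr (ha0 p).le) (sq_nonneg _)
  have hbound : ∀ φ, |l φ| ≤ M * ‖L φ‖ := by
    intro φ
    have h2 := ContDiff.two_of_infty φ.2.contDiff
    have h1 : ContDiff ℝ 1 φ.1 := h2.of_le (by norm_num)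
    have hc := φ.2.hasCompactSupport
    set N := ∫ p, (a p)⁻¹ * box φ.1 p ^ 2 ∂μ with hN
    have hd := hdual φ.1 h2 hc (fun x hx => lt_irrefl T (φ.2.tsupport_subset _ hx))
    have key := lintegral_slab_le (T := T) hn hsol.locInt_F h1 hc (M := ENNReal.ofReal √(Λ * N))
      ENNReal.ofReal_ne_top fun t ht => eLpNorm_fderiv_slice_le h1 hc t (hd t ht)
    have h3 : ENNReal.ofReal |l φ| ≤ ENNReal.ofReal (M * ‖L φ‖) := by
      calc ENNReal.ofReal |l φ| = ‖l φ‖ₑ := by rw [← Real.norm_eq_abs, ofReal_norm]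
        _ ≤ ∫⁻ p, ‖φ.1 p * F p.1 p.2‖ₑ ∂μ := enorm_integral_le_lintegral_enorm _
        _ = ∫⁻ p in slab n 0 T, ‖F p.1 p.2‖ₑ * ‖φ.1 p‖ₑ := by
            simp only [enorm_mul, mul_comm]; rfl
        _ ≤ _ := key
        _ = ENNReal.ofReal (M * ‖L φ‖) := by
            rw [hLnorm φ, Real.sqrt_mul hΛ.le, ENNReal.ofReal_mul (Real.sqrt_nonneg _),
              ENNReal.ofReal_mul ENNReal.toReal_nonneg, ENNReal.ofReal_toReal hMtop]
            ring
    exact (ENNReal.ofReal_le_ofReal_iff (by positivity)).mp h3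
  -- By construction `b⁻¹ y`, with `b² = a`, has the same pairings with `box φ` over the slab as
  -- `w`, for all `φ` in `testSpace`.
  obtain ⟨y, hyM, hy⟩ := exists_inner_eq_of_abs_le L l ENNReal.toReal_nonneg hbound
  have hyS : LocallyIntegrable ((slab n 0 T).indicator fun p => (b p)⁻¹ * y p) := by
    have h1 : MemLp ((slab n 0 T).indicator fun p => y p) 2 (volume : Measure (ST n)) :=
      (memLp_indicator_iff_restrict measurableSet_slab).mpr (Lp.memLp y)
    have h2 := h1.locallyIntegrable (by norm_num)
    rw [locallyIntegrable_iff]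
    intro K hK
    have h3 := (h2.integrableOn_isCompact hK).continuousOn_mul hbi.continuousOn hK
    refine h3.congr (Filter.Eventually.of_forall fun p => ?_)
    by_cases hp : p ∈ slab n 0 T <;> simp [hp]
  have huniq := ae_eq_zero_of_integral_box_eq_zero (T := T) (hwS.sub hyS) ?_ ?_
  · have hae : ∀ᵐ p ∂μ, √(a p) * w p.1 p.2 = y p := by
      -- Uniqueness gives equality for times strictly before `T`; the remaining slice is null.
      have hT0 : ∀ᵐ p ∂(volume : Measure (ST n)), p.1 ≠ T := by
        rw [Measure.volume_eq_prod]
        refine Measure.ae_prod_iff_ae_ae ?_ |>.mpr ?_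
        · exact (measurableSet_eq_fun measurable_fst measurable_const).compl
        · filter_upwards [compl_mem_ae_iff.mpr (measure_singleton T)] with t ht
          exact Filter.Eventually.of_forall fun _ => ht
      filter_upwards [ae_restrict_of_ae huniq, ae_restrict_of_ae hT0,
        ae_restrict_mem measurableSet_slab] with p hp hpT hps
      have h1 := hp (lt_of_le_of_ne hps.1.2 hpT)
      simp only [Pi.sub_apply, indicator_of_mem hps] at h1
      have h2 := (hb0 p).ne'
      rw [sub_eq_zero.mp h1]
      change b p * ((b p)⁻¹ * y p) = y p
      field_simp
    rw [eLpNorm_congr_ae hae]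
    have h1 : eLpNorm y 2 μ = ENNReal.ofReal ‖y‖ := by
      rw [Lp.norm_def, ENNReal.ofReal_toReal (Lp.eLpNorm_ne_top y)]
    rw [h1, ← ENNReal.ofReal_toReal hMtop]
    exact ENNReal.ofReal_le_ofReal hyM
  · intro p hp
    have : p ∉ slab n 0 T := fun h => absurd h.1.1 (not_le.mpr hp)
    simp [this]
  · intro φ hφ
    have h2 := ContDiff.two_of_infty hφ.contDiff
    have hcb := continuous_box h2
    have hccb := hasCompactSupport_box h2 hφ.hasCompactSupport
    have i1 := hwS.integrable_smul_right_of_hasCompactSupport hcb hccb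
    have i2 := hyS.integrable_smul_right_of_hasCompactSupport hcb hccb
    simp only [smul_eq_mul] at i1 i2
    simp only [Pi.sub_apply, sub_mul]
    rw [integral_sub i1 i2]
    have e1 : ∫ p, (slab n 0 T).indicator (fun p : ST n => w p.1 p.2) p * box φ p
        = ∫ p in slab n 0 T, box φ p • w p.1 p.2 := by
      rw [← integral_indicator measurableSet_slab]
      congr 1 with p
      by_cases hp : p ∈ slab n 0 T <;> simp [hp, mul_comm]
    have e2 : ∫ p, (slab n 0 T).indicator (fun p => (b p)⁻¹ * y p) p * box φ p
        = ∫ p, φ p * F p.1 p.2 ∂μ := by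
      have h3 := hy ⟨φ, hφ⟩
      change _ = ∫ p, φ p * F p.1 p.2 ∂μ at h3
      have h4 : ∫ p, (slab n 0 T).indicator (fun p => (b p)⁻¹ * y p) p * box φ p
          = ∫ p, (b p)⁻¹ * y p * box φ p ∂μ := by
        refine Eq.trans ?_ (integral_indicator measurableSet_slab)
        congr 1 with p
        by_cases hp : p ∈ slab n 0 T <;> simp [hp]
      rw [← h3, L2.inner_def, h4]
      refine integral_congr_ae ?_
      filter_upwards [(hLmem ⟨φ, hφ⟩).coeFn_toLp] with p hp
      change _ = inner ℝ (y p) (((hLmem ⟨φ, hφ⟩).toLp _) p)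
      rw [hp, RCLike.inner_apply, conj_trivial]
      ring
    -- A test function vanishing after `T` does not see the difference between the slab and the half
    -- space. It need not vanish at `t = 0`, where the weak equation carries the zero initial data.
    have hzero : ∀ p ∈ halfSpace n \ slab n 0 T, p ∉ tsupport φ := fun p hp h =>
      hp.2 ⟨⟨hp.1.1, (hφ.tsupport_subset p h).le⟩, mem_univ _⟩
    have e3 : ∫ p in slab n 0 T, box φ p • w p.1 p.2
        = ∫ p in halfSpace n, box φ p • w p.1 p.2 :=
      (setIntegral_eq_of_subset_of_forall_sdiff_eq_zero
        (measurableSet_Ici.prod MeasurableSet.univ) slab_subset_halfSpace fun p hp => by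
          rw [box_eq_zero_of_notMem_tsupport h2 (hzero p hp), zero_smul]).symm
    have e4 : ∫ p in slab n 0 T, φ p • F p.1 p.2 = ∫ p in halfSpace n, φ p • F p.1 p.2 :=
      (setIntegral_eq_of_subset_of_forall_sdiff_eq_zero
        (measurableSet_Ici.prod MeasurableSet.univ) slab_subset_halfSpace fun p hp => by
          rw [image_eq_zero_of_notMem_tsupport (hzero p hp), zero_smul]).symm
    rw [e1, e2, e3, hsol.weak_eq φ hφ.contDiff hφ.hasCompactSupport, ← e4]
    simp [hμ]

end WeightedBound

/-! ### The `L²` bound on the slice at time `T`. -/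

section SliceBound

open Filter Topology

variable {n : ℕ} {T : ℝ}

/-- The smooth compactly supported functions on `ℝⁿ`. -/
def sliceTestSpace (n : ℕ) : Submodule ℝ (E n → ℝ) where
  carrier := {ψ | ContDiff ℝ ∞ ψ ∧ HasCompactSupport ψ}
  add_mem' hφ hψ := ⟨hφ.1.add hψ.1, hφ.2.add hψ.2⟩
  zero_mem' := ⟨contDiff_const, HasCompactSupport.zero⟩
  smul_mem' _ _ hφ := ⟨contDiff_const.smul hφ.1, hφ.2.smul_left⟩

lemma memLp_sliceTestSpace (ψ : sliceTestSpace n) : MemLp ψ.1 2 (volume : Measure (E n)) :=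
  ψ.2.1.continuous.memLp_of_hasCompactSupport ψ.2.2

/-- A locally integrable function which is bounded by the `L²` norm on test functions lies in
`L²`. -/
lemma eLpNorm_two_le_of_integral_le {f : E n → ℝ} (hf : LocallyIntegrable f) {M : ℝ≥0∞}
    (hM : M ≠ ⊤) (h : ∀ ψ : E n → ℝ, ContDiff ℝ ∞ ψ → HasCompactSupport ψ →
      ‖∫ x, ψ x • f x‖ₑ ≤ M * eLpNorm ψ 2 volume) :
    eLpNorm f 2 volume ≤ M := by
  have hi : ∀ ψ : sliceTestSpace n, Integrable fun x => ψ.1 x • f x := fun ψ =>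
    hf.integrable_smul_left_of_hasCompactSupport ψ.2.1.continuous ψ.2.2
  let L : sliceTestSpace n →ₗ[ℝ] Lp ℝ 2 (volume : Measure (E n)) :=
    { toFun := fun ψ => (memLp_sliceTestSpace ψ).toLp _
      map_add' := fun φ ψ => rfl
      map_smul' := fun c ψ => rfl }
  let l : sliceTestSpace n →ₗ[ℝ] ℝ :=
    { toFun := fun ψ => ∫ x, ψ.1 x • f x
      map_add' := fun φ ψ => by
        rw [← integral_add (hi φ) (hi ψ)]
        congr 1 with x
        simp [add_mul]
      map_smul' := fun c ψ => by
        rw [RingHom.id_apply, smul_eq_mul, ← integral_const_mul]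
        congr 1 with x
        simp [mul_assoc] }
  have hbound : ∀ ψ, |l ψ| ≤ M.toReal * ‖L ψ‖ := by
    intro ψ
    have h1 := h ψ.1 ψ.2.1 ψ.2.2
    have h2 := ENNReal.toReal_mono (ENNReal.mul_ne_top hM (memLp_sliceTestSpace ψ).eLpNorm_ne_top) h1
    rw [ENNReal.toReal_mul, toReal_enorm, Real.norm_eq_abs] at h2
    change |l ψ| ≤ M.toReal * ‖(memLp_sliceTestSpace ψ).toLp _‖
    rwa [Lp.norm_toLp]
  obtain ⟨y, hyM, hy⟩ := exists_inner_eq_of_abs_le L l ENNReal.toReal_nonneg hbound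
  have hyl : LocallyIntegrable y (volume : Measure (E n)) :=
    (Lp.memLp y).locallyIntegrable (by norm_num)
  have hae : f =ᵐ[volume] y := by
    refine ae_eq_of_integral_contDiff_smul_eq hf hyl fun ψ hψ hψc => ?_
    have h1 := hy ⟨ψ, hψ, hψc⟩
    change _ = ∫ x, ψ x • f x at h1
    rw [← h1, L2.inner_def]
    refine integral_congr_ae ?_
    filter_upwards [(memLp_sliceTestSpace ⟨ψ, hψ, hψc⟩).coeFn_toLp] with x hx
    change inner ℝ (y x) (((memLp_sliceTestSpace ⟨ψ, hψ, hψc⟩).toLp _) x) = _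
    rw [hx, RCLike.inner_apply, conj_trivial, smul_eq_mul]
  rw [eLpNorm_congr_ae hae]
  have h1 : eLpNorm y 2 volume = ENNReal.ofReal ‖y‖ := by
    rw [Lp.norm_def, ENNReal.ofReal_toReal (Lp.eLpNorm_ne_top y)]
  rw [h1, ← ENNReal.ofReal_toReal hM]
  exact ENNReal.ofReal_le_ofReal hyM

/-- The value of a function at the right end of an interval is bounded by its averages. -/
lemma enorm_le_of_lintegral_Icc_le {m : ℝ → ℝ} {T : ℝ} (hT : 0 < T)
    (hm : ContinuousOn m (Ici 0)) {B : ℝ≥0∞}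
    (h : ∀ ε : ℝ, 0 < ε → ε ≤ T → ∫⁻ t in Icc (T - ε) T, ‖m t‖ₑ ≤ ENNReal.ofReal ε * B) :
    ‖m T‖ₑ ≤ B := by
  refine le_of_forall_lt fun c hc => ?_
  obtain ⟨c', hc1, hc2⟩ := exists_between hc
  refine hc1.trans_le ?_
  have hcont : Tendsto (fun t => ‖m t‖ₑ) (𝓝 T) (𝓝 ‖m T‖ₑ) :=
    ((hm.continuousAt (Ici_mem_nhds hT)).enorm)
  obtain ⟨η, hη, hηm⟩ := Metric.eventually_nhds_iff.mp (hcont.eventually (lt_mem_nhds hc2))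
  set ε := min (η / 2) T with hε
  have hε0 : 0 < ε := lt_min (by linarith) hT
  have h1 : ENNReal.ofReal ε * c' ≤ ∫⁻ t in Icc (T - ε) T, ‖m t‖ₑ := by
    calc ENNReal.ofReal ε * c' = ∫⁻ _ in Icc (T - ε) T, c' := by
          rw [setLIntegral_const, Real.volume_Icc, mul_comm]; congr 2; ring
      _ ≤ _ := setLIntegral_mono' measurableSet_Icc fun t ht => by
          refine (hηm ?_).le
          have := min_le_left (η / 2) T
          rw [Real.dist_eq, abs_lt]
          constructor <;> linarith [ht.1, ht.2]
  have h2 := h1.trans (h ε hε0 (min_le_right _ _))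
  rwa [ENNReal.mul_le_mul_iff_right (by simpa using hε0) ENNReal.ofReal_ne_top] at h2

/-- The `L²` estimate for time slices. -/
lemma eLpNorm_slice_le (hn : 3 ≤ n) {w F : ℝ → E n → ℝ} (hsol : IsSolution w F) (hT : 0 < T) :
    eLpNorm (w T) 2 volume
      ≤ sliceConst n * ENNReal.ofReal √(4 * Real.exp 1) * sourceNorm T F := by
  by_cases hB : sourceNorm T F = ⊤
  · rw [hB, ENNReal.mul_top]
    · exact le_top
    · refine mul_ne_zero (one_pos.trans_le one_le_sliceConst).ne' ?_
      rw [Ne, ENNReal.ofReal_eq_zero, not_le]; positivity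
  refine eLpNorm_two_le_of_integral_le (hsol.locInt_slice T hT.le)
    (ENNReal.mul_ne_top (ENNReal.mul_ne_top ENNReal.coe_ne_top ENNReal.ofReal_ne_top) hB)
    fun ψ hψ hψc => ?_
  refine enorm_le_of_lintegral_Icc_le hT (hsol.weak_cont ψ hψ hψc) fun ε hε hεT => ?_
  have hsub : slab n (T - ε) T ⊆ slab n 0 T :=
    prod_mono (Icc_subset_Icc_left (by linarith)) le_rfl
  have hwm : AEStronglyMeasurable (fun p : ST n => w p.1 p.2)
      (volume.restrict (slab n (T - ε) T)) := by
    exact (hsol.locInt_w.aestronglyMeasurable).mono_measure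
      (Measure.restrict_mono (hsub.trans slab_subset_halfSpace) le_rfl)
  have hψm : AEStronglyMeasurable (fun p : ST n => ψ p.2)
      (volume.restrict (slab n (T - ε) T)) :=
    (hψ.continuous.comp continuous_snd).aestronglyMeasurable
  have h1 : ∫⁻ t in Icc (T - ε) T, ‖∫ x, ψ x • w t x‖ₑ
      ≤ ∫⁻ p in slab n (T - ε) T, ‖ψ p.2‖ₑ * ‖w p.1 p.2‖ₑ := by
    have hm := hψm.enorm.mul hwm.enorm
    rw [restrict_slab] at hm ⊢
    rw [lintegral_prod _ (by exact hm)]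
    refine lintegral_mono fun t => (enorm_integral_le_lintegral_enorm _).trans (le_of_eq ?_)
    simp only [smul_eq_mul, enorm_mul]
  have h2 := lintegral_enorm_mul_le 2 2 hψm hwm
  have h3 : eLpNorm (fun p : ST n => ψ p.2) 2 (volume.restrict (slab n (T - ε) T))
      = ENNReal.ofReal √ε * eLpNorm ψ 2 volume := by
    refine (fun h => le_antisymm ((ENNReal.pow_le_pow_left_iff two_ne_zero).mp h.le)
      ((ENNReal.pow_le_pow_left_iff two_ne_zero).mp h.ge) : _ ^ 2 = _ ^ 2 → _) ?_
    have hψe : Measurable fun x => ‖ψ x‖ₑ ^ 2 := hψ.continuous.enorm.measurable.pow_const 2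
    rw [eLpNorm_two_sq, mul_pow, eLpNorm_two_sq, restrict_slab,
      lintegral_prod _ (by exact (hψe.comp measurable_snd).aemeasurable),
      ← ENNReal.ofReal_pow (Real.sqrt_nonneg _), Real.sq_sqrt hε.le]
    simp only [lintegral_const, Measure.restrict_apply_univ, Real.volume_Icc]
    rw [mul_comm]
    congr 2; ring
  -- On the slab `[T-ε, T]` the square root of the exponential weight is at least `e^{-1/2}`. The
  -- bound carries `√ε` from the dual constant, and the norm of `ψ` over the slab carries another,
  -- so the product is of order `ε`, as averaging over an interval of length `ε` demands.
  have h4 : eLpNorm (fun p : ST n => w p.1 p.2) 2 (volume.restrict (slab n (T - ε) T))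
      ≤ ENNReal.ofReal √(Real.exp 1)
        * (sliceConst n * ENNReal.ofReal √(4 * ε) * sourceNorm T F) := by
    have h5 := eLpNorm_sqrt_weight_mul_le (a := fun p : ST n => Real.exp ((p.1 - T) / ε))
      (Λ := 4 * ε) hn hsol (by fun_prop) (fun p => Real.exp_pos _) (by positivity)
      (dualEstimate_exp hε hT)
    refine le_trans ?_ (mul_le_mul_right h5 _)
    refine le_trans ?_ (mul_le_mul_right (eLpNorm_mono_measure _
      (Measure.restrict_mono hsub le_rfl)) _)
    refine eLpNorm_le_mul_eLpNorm_of_ae_le_mul ?_ 2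
    filter_upwards [ae_restrict_mem measurableSet_slab] with p hp
    rw [norm_mul, Real.norm_of_nonneg (Real.sqrt_nonneg _), ← mul_assoc,
      ← Real.sqrt_mul (Real.exp_pos _).le, ← Real.exp_add]
    refine le_mul_of_one_le_left (norm_nonneg _) ?_
    rw [Real.one_le_sqrt, Real.one_le_exp_iff]
    have h6 : T - ε ≤ p.1 := hp.1.1
    have : -1 ≤ (p.1 - T) / ε := by rw [le_div_iff₀ hε]; linarith
    linarith
  refine (h1.trans h2).trans ?_
  rw [h3]
  refine (mul_le_mul_right h4 _).trans (le_of_eq ?_)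
  have e1 : ENNReal.ofReal √(4 * ε) = ENNReal.ofReal √4 * ENNReal.ofReal √ε := by
    rw [Real.sqrt_mul (by norm_num), ENNReal.ofReal_mul (Real.sqrt_nonneg _)]
  have e2 : ENNReal.ofReal √(4 * Real.exp 1)
      = ENNReal.ofReal √4 * ENNReal.ofReal √(Real.exp 1) := by
    rw [Real.sqrt_mul (by norm_num), ENNReal.ofReal_mul (Real.sqrt_nonneg _)]
  have e3 : ENNReal.ofReal ε = ENNReal.ofReal √ε * ENNReal.ofReal √ε := by
    rw [← ENNReal.ofReal_mul (Real.sqrt_nonneg _), Real.mul_self_sqrt hε.le]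
  rw [e1, e2, e3]
  ring

end SliceBound

/-! ### Assembly, and reduction to real-valued solutions. -/

section Main

variable {n : ℕ} {T : ℝ}

/-- The left-hand side of the estimate. -/
def solutionNorm {𝕜 : Type*} [RCLike 𝕜] {n : ℕ} (δ T : ℝ) (w : ℝ → E n → 𝕜) : ℝ≥0∞ :=
  ENNReal.ofReal ((Real.log (2 + T)) ^ (-(1 / 2) : ℝ)) * weightedStripNorm (-(1 / 2)) T w
    + weightedStripNorm (-(1 / 2) - δ) T w + eLpNorm (w T) 2 volume

lemma weightedStripNorm_eq (s : ℝ) (w : ℝ → E n → ℝ) :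
    weightedStripNorm (s / 2) T w
      = eLpNorm (fun p : ST n => √(bracket p.2 ^ s) * w p.1 p.2) 2
        (volume.restrict (slab n 0 T)) := by
  have : ∀ p : ST n, √(bracket p.2 ^ s) = bracket p.2 ^ (s / 2) := fun p => by
    rw [Real.sqrt_eq_rpow, ← Real.rpow_mul (bracket_pos _).le]; congr 1; ring
  simp only [this]
  rfl

/-- The constant for the weight `⟨x⟩^{-1/2-δ}`. -/
def decayConst (n : ℕ) (θ : ℝ) : ℝ := 2 * (256 * (n + 1) * (1 - (2 : ℝ) ^ (-θ))⁻¹)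

/-- The constant for the logarithmic term. -/
def logConst (n : ℕ) : ℝ := 2 * (256 * (n + 1) * 4 + 20)

/-- The three terms come from three choices of `a`. The weights multiplying `w` are `√a`, so the
exponent `-1/2 - δ` needs `θ = 2δ`, and the factor `log(2+T)` in the dual constant becomes its
square root, cancelled by the prefactor. -/
lemma solutionNorm_real_le (hn : 3 ≤ n) {δ : ℝ} (hδ : 0 < δ) (hT : 0 < T) {w F : ℝ → E n → ℝ}
    (hsol : IsSolution w F) :
    solutionNorm δ T w ≤ sliceConst n * (ENNReal.ofReal √(logConst n)
      + ENNReal.ofReal √(decayConst n (2 * δ)) + ENNReal.ofReal √(4 * Real.exp 1))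
      * sourceNorm T F := by
  have hlog : 0 < Real.log (2 + T) := Real.log_pos (by linarith)
  have h1 : ENNReal.ofReal ((Real.log (2 + T)) ^ (-(1 / 2) : ℝ)) * weightedStripNorm (-(1 / 2)) T w
      ≤ sliceConst n * ENNReal.ofReal √(logConst n) * sourceNorm T F := by
    have hΛ : 0 < 2 * ((256 * ((n : ℝ) + 1) * 4 + 20) * Real.log (2 + T)) := by positivity
    have h2 := eLpNorm_sqrt_weight_mul_le (a := fun p : ST n => bracket p.2 ^ (-1 : ℝ)) hn hsol
      ((continuous_bracket_rpow _).comp continuous_snd)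
      (fun p => Real.rpow_pos_of_pos (bracket_pos _) _) hΛ (dualEstimate_inv hn hT)
    rw [← weightedStripNorm_eq, show (-1 : ℝ) / 2 = -(1 / 2) by norm_num] at h2
    refine (mul_le_mul_right h2 _).trans (le_of_eq ?_)
    have e1 : 2 * ((256 * ((n : ℝ) + 1) * 4 + 20) * Real.log (2 + T))
        = logConst n * Real.log (2 + T) := by unfold logConst; ring
    have e2 : ENNReal.ofReal ((Real.log (2 + T)) ^ (-(1 / 2) : ℝ))
        * ENNReal.ofReal √(Real.log (2 + T)) = 1 := by
      rw [← ENNReal.ofReal_mul (by positivity), Real.sqrt_eq_rpow, ← Real.rpow_add hlog]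
      simp
    have hlc : 0 ≤ logConst n := by unfold logConst; positivity
    rw [e1, Real.sqrt_mul hlc, ENNReal.ofReal_mul (Real.sqrt_nonneg _)]
    calc _ = (ENNReal.ofReal ((Real.log (2 + T)) ^ (-(1 / 2) : ℝ))
          * ENNReal.ofReal √(Real.log (2 + T)))
          * (sliceConst n * ENNReal.ofReal √(logConst n) * sourceNorm T F) := by ring
      _ = _ := by rw [e2, one_mul]
  have h2 : weightedStripNorm (-(1 / 2) - δ) T w
      ≤ sliceConst n * ENNReal.ofReal √(decayConst n (2 * δ)) * sourceNorm T F := by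
    have hΛ : 0 < decayConst n (2 * δ) := by
      have h2 : (2 : ℝ) ^ (-(2 * δ)) < 1 :=
        Real.rpow_lt_one_of_one_lt_of_neg (by norm_num) (by linarith)
      have : 0 < 1 - (2 : ℝ) ^ (-(2 * δ)) := by linarith
      unfold decayConst
      positivity
    have h2 := eLpNorm_sqrt_weight_mul_le
      (a := fun p : ST n => bracket p.2 ^ (-1 - 2 * δ)) hn hsol
      ((continuous_bracket_rpow _).comp continuous_snd)
      (fun p => Real.rpow_pos_of_pos (bracket_pos _) _) hΛ
      (dualEstimate_rpow hn (θ := 2 * δ) (by linarith) hT.le)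
    rwa [← weightedStripNorm_eq, show (-1 - 2 * δ : ℝ) / 2 = -(1 / 2) - δ by ring] at h2
  have h3 := eLpNorm_slice_le hn hsol hT
  refine (add_le_add (add_le_add h1 h2) h3).trans (le_of_eq ?_)
  ring

variable {𝕜 : Type*} [RCLike 𝕜]

/-- Test functions are real, so a real-linear functional commutes with all integrals in the
definition. Applied to real and imaginary parts, this reduces the theorem to real-valued solutions.
-/
lemma IsSolution.comp_clm {w F : ℝ → E n → 𝕜} (hsol : IsSolution w F) (l : 𝕜 →L[ℝ] ℝ) :
    IsSolution (fun t x => l (w t x)) (fun t x => l (F t x)) := by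
  have hclosed : IsClosed (halfSpace n) := isClosed_Ici.prod isClosed_univ
  have hint : ∀ (f : ST n → 𝕜), LocallyIntegrableOn f (halfSpace n) → ∀ ψ : ST n → ℝ,
      Continuous ψ → HasCompactSupport ψ → IntegrableOn (fun p => ψ p • f p) (halfSpace n) := by
    intro f hf ψ hψ hψc
    have h1 : LocallyIntegrable ((halfSpace n).indicator f) := by
      rw [locallyIntegrable_iff]
      intro K hK
      rw [IntegrableOn, integrable_indicator_iff hclosed.measurableSet, IntegrableOn,
        Measure.restrict_restrict hclosed.measurableSet]
      exact hf.integrableOn_compact_subset inter_subset_left (hK.inter_left hclosed)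
    rw [← integrable_indicator_iff hclosed.measurableSet]
    refine (h1.integrable_smul_left_of_hasCompactSupport hψ hψc).congr
      (Filter.Eventually.of_forall fun p => ?_)
    by_cases hp : p ∈ halfSpace n <;> simp [hp]
  refine ⟨?_, ?_, fun t ht => ?_, fun ψ hψ hψc => ?_, fun φ hφ hφc => ?_⟩
  · exact fun p hp => (hsol.locInt_w p hp).imp fun s hs => ⟨hs.1, l.integrable_comp hs.2⟩
  · exact fun p hp => (hsol.locInt_F p hp).imp fun s hs => ⟨hs.1, l.integrable_comp hs.2⟩
  · exact fun p => (hsol.locInt_slice t ht p).imp fun s hs => ⟨hs.1, l.integrable_comp hs.2⟩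
  · refine (l.continuous.comp_continuousOn (hsol.weak_cont ψ hψ hψc)).congr fun t ht => ?_
    have := l.integral_comp_comm ((hsol.locInt_slice t ht).integrable_smul_left_of_hasCompactSupport
      hψ.continuous hψc)
    simpa using this
  · have h2 := ContDiff.two_of_infty hφ
    have h3 := congrArg l (hsol.weak_eq φ hφ hφc)
    rw [← l.integral_comp_comm (hint _ hsol.locInt_w _ (continuous_box h2)
      (hasCompactSupport_box h2 hφc)),
      ← l.integral_comp_comm (hint _ hsol.locInt_F _ hφ.continuous hφc)] at h3
    simpa using h3

lemma sourceNorm_comp_le {F : ℝ → E n → 𝕜} {l : 𝕜 →L[ℝ] ℝ} (hl : ∀ z, ‖l z‖ ≤ ‖z‖) :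
    sourceNorm T (fun t x => l (F t x)) ≤ sourceNorm T F := by
  refine add_le_add (lintegral_mono fun t => ?_) (lintegral_mono fun t => ?_)
  · refine eLpNorm_mono_enorm fun r => ?_
    rw [enorm_eq_self, enorm_eq_self]
    refine eLpNorm_mono fun θ => ?_
    by_cases h : r • (θ : E n) ∈ {x : E n | 1 < ‖x‖}
    · rw [indicator_of_mem h, indicator_of_mem h]
      exact (norm_smul _ _).trans_le ((mul_le_mul_of_nonneg_left (hl (F t (r • (θ : E n))))
        (norm_nonneg (‖r • (θ : E n)‖ ^ (-(((n : ℝ) - 2) / 2))))).trans_eq (norm_smul _ _).symm)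
    · simp [indicator_of_notMem h]
  · exact eLpNorm_mono fun x => hl (F t x)

lemma eLpNorm_le_re_add_im {α : Type*} [MeasurableSpace α] {μ : Measure α} {f : α → 𝕜}
    (hf : AEStronglyMeasurable f μ) : eLpNorm f 2 μ
      ≤ eLpNorm (fun x => RCLike.reCLM (f x)) 2 μ + eLpNorm (fun x => RCLike.imCLM (f x)) 2 μ := by
  have hre : AEStronglyMeasurable (fun x => RCLike.reCLM (f x)) μ :=
    RCLike.reCLM.continuous.comp_aestronglyMeasurable hf
  have him : AEStronglyMeasurable (fun x => RCLike.imCLM (f x)) μ :=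
    RCLike.imCLM.continuous.comp_aestronglyMeasurable hf
  have hadd := eLpNorm_add_le (p := 2) hre.norm him.norm one_le_two
  rw [eLpNorm_norm, eLpNorm_norm] at hadd
  refine le_trans (eLpNorm_mono_real fun x => ?_) hadd
  have h1 : ‖f x‖ ^ 2 = _ := RCLike.norm_sq_eq_def
  change ‖f x‖ ≤ |RCLike.re (f x)| + |RCLike.im (f x)|
  refine abs_le_of_sq_le_sq' ?_ (by positivity) |>.2
  nlinarith [abs_mul_abs_self (RCLike.re (f x)), abs_mul_abs_self (RCLike.im (f x)),
    mul_nonneg (abs_nonneg (RCLike.re (f x))) (abs_nonneg (RCLike.im (f x)))]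

lemma weightedStripNorm_le_re_add_im {w F : ℝ → E n → 𝕜} (hsol : IsSolution w F) (s : ℝ) :
    weightedStripNorm s T w ≤ weightedStripNorm s T (fun t x => RCLike.reCLM (w t x))
      + weightedStripNorm s T (fun t x => RCLike.imCLM (w t x)) := by
  have hclosed : IsClosed (halfSpace n) := isClosed_Ici.prod isClosed_univ
  have hm : AEStronglyMeasurable (fun p : ST n => w p.1 p.2) (stripMeasure n T) :=
    (hsol.locInt_w.aestronglyMeasurable).mono_measure
      (Measure.restrict_mono slab_subset_halfSpace le_rfl)
  have hb : AEStronglyMeasurable (fun p : ST n => bracket p.2 ^ s) (stripMeasure n T) :=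
    ((continuous_bracket_rpow s).comp continuous_snd).aestronglyMeasurable
  have := eLpNorm_le_re_add_im (hb.smul hm)
  refine this.trans (le_of_eq ?_)
  unfold weightedStripNorm
  simp

lemma solutionNorm_le_re_add_im {w F : ℝ → E n → 𝕜} (hsol : IsSolution w F) (δ : ℝ)
    (hT : 0 ≤ T) :
    solutionNorm δ T w ≤ solutionNorm δ T (fun t x => RCLike.reCLM (w t x))
      + solutionNorm δ T (fun t x => RCLike.imCLM (w t x)) := by
  have h1 := weightedStripNorm_le_re_add_im (T := T) hsol (-(1 / 2))
  have h2 := weightedStripNorm_le_re_add_im (T := T) hsol (-(1 / 2) - δ)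
  have h3 := eLpNorm_le_re_add_im (hsol.locInt_slice T hT).aestronglyMeasurable
  unfold solutionNorm
  refine (add_le_add (add_le_add (mul_le_mul_right h1 _) h2) h3).trans (le_of_eq ?_)
  ring

end Main

end WaveKSS

end

theorem theorem2p3 {𝕜 : Type*} [RCLike 𝕜] (n : ℕ) (hn : 3 ≤ n) (δ : ℝ) (hδ : 0 < δ) :
    ∃ C : ℝ≥0, ∀ w F : ℝ → WaveKSS.E n → 𝕜, WaveKSS.IsSolution w F → ∀ T : ℝ, 0 < T →
      ENNReal.ofReal ((Real.log (2 + T)) ^ (-(1 / 2) : ℝ))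
            * WaveKSS.weightedStripNorm (-(1 / 2)) T w
          + WaveKSS.weightedStripNorm (-(1 / 2) - δ) T w
          + eLpNorm (w T) 2 volume
        ≤ C * (∫⁻ t in Icc 0 T, WaveKSS.mixedNormOn 1 2 {x : WaveKSS.E n | 1 < ‖x‖}
              (fun x => (‖x‖ ^ (-(((n : ℝ) - 2) / 2))) • F t x))
          + C * (∫⁻ t in Icc 0 T, eLpNorm (F t) (ENNReal.ofReal (2 * (n : ℝ) / ((n : ℝ) + 2)))
              (volume.restrict {x : WaveKSS.E n | ‖x‖ < 1})) := by
  set K : ℝ≥0 := WaveKSS.sliceConst n * (Real.toNNReal √(WaveKSS.logConst n)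
    + Real.toNNReal √(WaveKSS.decayConst n (2 * δ)) + Real.toNNReal √(4 * Real.exp 1)) with hK
  -- The factor `2` accounts for the real and imaginary parts, each with source norm at most that of
  -- `F`.
  refine ⟨2 * K, fun w F hsol T hT => ?_⟩
  rw [← mul_add]
  have hreal : ∀ l : 𝕜 →L[ℝ] ℝ, (∀ z, ‖l z‖ ≤ ‖z‖) →
      WaveKSS.solutionNorm δ T (fun t x => l (w t x)) ≤ K * WaveKSS.sourceNorm T F := by
    intro l hl
    have h1 := WaveKSS.solutionNorm_real_le hn hδ hT (hsol.comp_clm l)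
    have h2 := h1.trans (mul_le_mul_right (WaveKSS.sourceNorm_comp_le hl) _)
    rw [hK]
    push_cast
    exact h2
  have h1 := WaveKSS.solutionNorm_le_re_add_im hsol δ hT.le
  have h2 := add_le_add (hreal RCLike.reCLM RCLike.norm_re_le_norm)
    (hreal RCLike.imCLM RCLike.norm_im_le_norm)
  refine (h1.trans h2).trans (le_of_eq ?_)
  rw [← two_mul, ← mul_assoc]
  push_cast
  rfl
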